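/- Let $\mathbb H^2$ be the hyperbolic plane and let $\alpha<0$. Let $X_0:S^1\to\mathbb H^2$ be a smooth, simple, closed curve $\gamma_0$ with geodesic curvature $\kappa>0$ with respect to the inner unit normal. For a smooth closed curve $\gamma$ with arc length $s$, length $L$ and curvature $\kappa$ put $$\phi_1=\frac1{L}\int_{\gamma}\kappa^{\alpha}\,ds,\qquad \phi_2=\frac{1}{\int_{\gamma}\kappa\,ds}\int_{\gamma}\kappa^{\alpha+1}\,ds .$$ For $i\in\{1,2\}$ consider smooth solutions $X:S^1\times[0,\infty)\to\mathbb H^2$ of $$\frac{\partial X}{\partial t}=\bigl(\phi_i(t)-\kappa^{\alpha}\bigr)\nu,\qquad X(\cdot,0)=X_0,$$ where $\gamma_t=X(S^1,t)$ is a regular closed curve, $\nu$ is its unit normal (inner at $t=0$ and continuous in $t$), $\kappa$ is its curvature with respect to $\nu$, and $\phi_i(t)$ is evaluated on $\gamma_t$; the flow is area-preserving for $i=1$ and length-preserving for $i=2$. Let $A(0)$ be the area enclosed by $\gamma_0$ and $L(0)$ the length of $\gamma_0$, and let $$\rho_\infty=\cosh^{-1}\Bigl(\frac{A(0)}{2\pi}+1\Bigr)\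 \text{ if } i=1,\qquad \rho_\infty=\sinh^{-1}\Bigl(\frac{L(0)}{2\pi}\Bigr)\ \text{ if } i=2 .$$ Let $D$ be either $\rho_\infty$ or $\tanh\rho_\infty$. Then there is a constant $C>0$, depending only on $\alpha$ and $X_0$, such that the following holds for every such solution, for $i=1$ and $i=2$ and for either choice of $D$. Write $V=1/\kappa$. If for every $t\in[0,\infty)$ there is a point $s(t)\in S^1$ with $V(s(t),t)=D$, then $$0<\kappa\le C\quad\text{and}\quad V\ge C^{-1}\qquad\text{on } S^1\times[0,\infty).$$ -/

import Mathlib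

open scoped UpperHalfPlane ContDiff Topology

noncomputable section

namespace HypFlow

/-! The hyperbolic plane is the upper half-plane `ℍ` with the metric `|dz|² / (Im z)²`. A closed curve
`S¹ → ℍ` is a `2π`-periodic map `ℝ → ℍ`; tangent vectors are complex numbers, and the hyperbolic
inner product of `v`, `w` at `z` is `Re (conj v * w) / (Im z)²`. -/

/-- The velocity `∂γ/∂u`. -/
def velocity (γ : ℝ → ℍ) (u : ℝ) : ℂ := deriv (fun x => (γ x : ℂ)) u

/-- A smooth, regular, simple closed curve. -/
structure IsSimpleClosedCurve (γ : ℝ → ℍ) : Prop where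
  periodic : Function.Periodic γ (2 * Real.pi)
  smooth : ContDiff ℝ ∞ (fun u => (γ u : ℂ))
  regular : ∀ u, velocity γ u ≠ 0
  simple : Set.InjOn γ (Set.Ico 0 (2 * Real.pi))

/-- The hyperbolic speed `g = |∂γ/∂u|`, so that `ds = g du`. -/
def speed (γ : ℝ → ℍ) (u : ℝ) : ℝ := ‖velocity γ u‖ / (γ u).im

/-- The hyperbolic unit tangent `∂γ/∂s = g⁻¹ ∂γ/∂u`. -/
def tangent (γ : ℝ → ℍ) (u : ℝ) : ℂ := velocity γ u / (speed γ u : ℂ)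

/-- The unit normal on the side `σ`: to the left of the tangent if `σ = 1`, to its right if
`σ = -1`. -/
def normal (σ : ℝ) (γ : ℝ → ℍ) (u : ℝ) : ℂ := (σ : ℂ) * Complex.I * tangent γ u

/-- The Levi-Civita derivative, in the direction `∂γ/∂u`, of a vector field `W` along `γ`. The metric
`|dz|² / y²` is Kähler and its only Christoffel symbol of type `(1,0)` is
`∂_z log (y⁻²) = i / y`. -/
def covDeriv (γ : ℝ → ℍ) (W : ℝ → ℂ) (u : ℝ) : ℂ :=
  deriv W u + Complex.I / ((γ u).im : ℂ) * velocity γ u * W u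

/-- The geodesic curvature with respect to the normal `ν` on the side `σ`, that is, the `κ` with
`∇_s (∂γ/∂s) = κ ν`, computed as the hyperbolic inner product of `∇_s (∂γ/∂s)` and `ν`. -/
def curvature (σ : ℝ) (γ : ℝ → ℍ) (u : ℝ) : ℝ :=
  (starRingEnd ℂ (normal σ γ u) * (covDeriv γ (tangent γ) u / (speed γ u : ℂ))).re /
    (γ u).im ^ 2

/-- The integral `∫_γ f ds`. -/
def arcIntegral (γ : ℝ → ℍ) (f : ℝ → ℝ) : ℝ :=
  ∫ u in (0 : ℝ)..(2 * Real.pi), f u * speed γ u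

/-- The hyperbolic length. -/
def length (γ : ℝ → ℍ) : ℝ := arcIntegral γ (fun _ => 1)

/-- The domain enclosed by a closed curve: the points off the curve whose connected component in the
complement of the curve is bounded. -/
def enclosed (γ : ℝ → ℍ) : Set ℍ :=
  {p | p ∉ Set.range γ ∧ Bornology.IsBounded (connectedComponentIn (Set.range γ)ᶜ p)}

/-- The enclosed hyperbolic area; the measure on `ℍ` is `dx dy / y²`. -/
def area (γ : ℝ → ℍ) : ℝ := (MeasureTheory.volume (enclosed γ)).toReal

/-- The normal on the side `σ` is the inner normal: it points into the enclosed domain. -/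
def IsInner (σ : ℝ) (γ : ℝ → ℍ) : Prop :=
  ∀ u, ∀ᶠ ε : ℝ in 𝓝[>] (0 : ℝ), ∃ p ∈ enclosed γ, (p : ℂ) = γ u + (ε : ℂ) * normal σ γ u

/-- The two kinds of flow. -/
inductive Kind where
  | areaPreserving
  | lengthPreserving

/-- The nonlocal term: `L⁻¹ ∫ κ^α ds` for the area-preserving flow and
`(∫ κ ds)⁻¹ ∫ κ^(α+1) ds` for the length-preserving flow. -/
def phi (σ α : ℝ) (γ : ℝ → ℍ) : Kind → ℝ
  | .areaPreserving => (1 / length γ) * arcIntegral γ (fun u => curvature σ γ u ^ α)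
  | .lengthPreserving =>
      (1 / arcIntegral γ (curvature σ γ)) * arcIntegral γ (fun u => curvature σ γ u ^ (α + 1))

/-- The radius of the geodesic circle with the same area (respectively length) as `γ`. -/
def circleRadius (γ : ℝ → ℍ) : Kind → ℝ
  | .areaPreserving => Real.arcosh (area γ / (2 * Real.pi) + 1)
  | .lengthPreserving => Real.arsinh (length γ / (2 * Real.pi))

/-- `X t u` (the curve `X t` at time `t`) is a smooth solution of the flow
`∂X/∂t = (φ(t) - κ^α) ν` on `[0,∞)` with initial curve `X₀`. The side `σ` of the normal `ν`,
to be chosen as the inner side of `X₀`, does not change with `t`. Values at `t < 0` are irrelevant. -/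
structure IsGlobalFlow (k : Kind) (σ α : ℝ) (X₀ : ℝ → ℍ) (X : ℝ → ℝ → ℍ) : Prop where
  initial : X 0 = X₀
  periodic : ∀ t, 0 ≤ t → Function.Periodic (X t) (2 * Real.pi)
  smooth : ContDiffOn ℝ ∞ (fun p : ℝ × ℝ => (X p.1 p.2 : ℂ)) (Set.Ici 0 ×ˢ Set.univ)
  regular : ∀ t, 0 ≤ t → ∀ u, velocity (X t) u ≠ 0
  evolution : ∀ t, 0 ≤ t → ∀ u,
    HasDerivWithinAt (fun τ => (X τ u : ℂ))
      (((phi σ α (X t) k - curvature σ (X t) u ^ α : ℝ) : ℂ) * normal σ (X t) u)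
      (Set.Ici 0) t

end HypFlow

end

open scoped UpperHalfPlane ContDiff Topology
open MeasureTheory

noncomputable section

namespace HypFlow

/-! Write F = φ - κ^α, V = 1/κ and f = κ^(α/2-1) = V^(1-α/2). Smoothness of the flow bounds F on
compact time intervals, and κ = 1/D somewhere, so φ and hence κ^α are bounded there. As α < 0, a
positive κ then stays away from zero, and convexity persists (`IsGlobalFlow.curvature_pos`). The
flow now reduces to the system g_t = -κFg, κ_t = F_ss + (κ²-1)F for speed and curvature
(`NormalFlow`). The maximum principle gives κ ≥ c > 0 for all time (`exists_curv_ge`) and shows that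
min V decreases at a rate of at most c^α (`inv_curv_ge`).

The upper bound on κ comes from three integral facts. (1) Minus the length (i = 1), or the area (i =
2), is monotone and bounded, and its derivative dominates ∫(f - f(z))² ds, where z is a point with
κ^α = φ (`exists_functional`). Its increments over a fixed time are therefore small at late times.
(2) Up to a bounded error, ∫V ds decreases at a rate of at least a constant times ∫f_s² ds
(`exists_energy_bound`). (3) For every l > 0, (f(x) - f(z))² ≤ l⁻¹∫(f - f(z))² ds + l∫f_s² ds
(`sq_sub_le_of_periodic`).

Suppose V < D/4 somewhere at a late time t₁. By the rate bound min V < D/2 on a whole interval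
[t₁-τ, t₁], while V = D is attained throughout; so f oscillates by at least a fixed δ. Integrating
(3) in time, with l small and then t₁ large, contradicts (1) and (2). Earlier times are covered by
compactness (`exists_curv_le`).

What "late" means depends on the solution. A constant depending only on α and X₀ follows from
uniqueness: an energy estimate shows that the initial curve determines the curvature
(`curv_eq_of_initial`). -/

/-- Smoothness on `[0,∞) × ℝ` of a function of time and parameter. -/
def SmoothFlow {E : Type*} [NormedAddCommGroup E] [NormedSpace ℝ E] (f : ℝ → ℝ → E) : Prop :=
  ContDiffOn ℝ ∞ (fun p : ℝ × ℝ => f p.1 p.2) (Set.Ici 0 ×ˢ Set.univ)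

/-- The derivative in the parameter. -/
def du {E : Type*} [NormedAddCommGroup E] [NormedSpace ℝ E] (f : ℝ → ℝ → E) (t u : ℝ) : E :=
  deriv (f t) u

/-- The derivative in time. -/
def dt {E : Type*} [NormedAddCommGroup E] [NormedSpace ℝ E] (f : ℝ → ℝ → E) (t u : ℝ) : E :=
  deriv (fun τ => f τ u) t

/-! ### Calculus of functions smooth on [0,∞) × ℝ -/

section Calculus

variable {E : Type*} [NormedAddCommGroup E] [NormedSpace ℝ E] {f : ℝ → ℝ → E}

lemma uniqueDiffOn_halfPlane :
    UniqueDiffOn ℝ (Set.Ici (0 : ℝ) ×ˢ (Set.univ : Set ℝ)) :=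
  (uniqueDiffOn_Ici 0).prod uniqueDiffOn_univ

namespace SmoothFlow

lemma slice (hf : SmoothFlow f) {t : ℝ} (ht : 0 ≤ t) : ContDiff ℝ ∞ (f t) := by
  rw [← contDiffOn_univ]
  exact ContDiffOn.comp (g := fun p : ℝ × ℝ => f p.1 p.2) (f := fun u : ℝ => (t, u)) hf
    (by fun_prop) (fun u _ => ⟨ht, trivial⟩)

lemma differentiableAt_slice (hf : SmoothFlow f) {t : ℝ} (ht : 0 ≤ t) (u : ℝ) :
    DifferentiableAt ℝ (f t) u :=
  ((hf.slice ht).differentiable (by simp)) u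

lemma hasDerivAt_du (hf : SmoothFlow f) {t : ℝ} (ht : 0 ≤ t) (u : ℝ) :
    HasDerivAt (f t) (HypFlow.du f t u) u :=
  (hf.differentiableAt_slice ht u).hasDerivAt

lemma continuousOn (hf : SmoothFlow f) :
    ContinuousOn (fun p : ℝ × ℝ => f p.1 p.2) (Set.Ici 0 ×ˢ Set.univ) :=
  ContDiffOn.continuousOn hf

lemma contDiffAt (hf : SmoothFlow f) {t : ℝ} (ht : 0 < t) (u : ℝ) :
    ContDiffAt ℝ ∞ (fun p : ℝ × ℝ => f p.1 p.2) (t, u) :=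
  ContDiffOn.contDiffAt hf (prod_mem_nhds (Ici_mem_nhds ht) Filter.univ_mem)

/-- The parameter direction stays inside the half-plane even at t = 0, so the ordinary derivative is
a component of the one within the set. This makes `du` smooth up to t = 0. -/
lemma du_eq_fderivWithin (hf : SmoothFlow f) {t : ℝ} (ht : 0 ≤ t) (u : ℝ) :
    HypFlow.du f t u = fderivWithin ℝ (fun p : ℝ × ℝ => f p.1 p.2)
      (Set.Ici 0 ×ˢ Set.univ) (t, u) (0, 1) := by
  have h1 : HasFDerivWithinAt (fun p : ℝ × ℝ => f p.1 p.2) _ (Set.Ici 0 ×ˢ Set.univ) (t, u) :=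
    (ContDiffOn.differentiableOn hf (by simp) (t, u) ⟨ht, trivial⟩).hasFDerivWithinAt
  have h2 : HasDerivWithinAt (fun v : ℝ => (t, v)) ((0 : ℝ), (1 : ℝ)) Set.univ u :=
    (hasDerivWithinAt_const _ _ _).prodMk (hasDerivWithinAt_id _ _)
  have h3 := h1.comp_hasDerivWithinAt u h2 (fun v _ => ⟨ht, trivial⟩)
  exact (hasDerivWithinAt_univ.1 h3).deriv

lemma du (hf : SmoothFlow f) : SmoothFlow (HypFlow.du f) := by
  have h : ContDiffOn ℝ ∞ (fun p : ℝ × ℝ => fderivWithin ℝ (fun p : ℝ × ℝ => f p.1 p.2)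
      (Set.Ici 0 ×ˢ Set.univ) p ((0 : ℝ), (1 : ℝ))) (Set.Ici 0 ×ˢ Set.univ) :=
    (ContDiffOn.fderivWithin hf uniqueDiffOn_halfPlane (by simp)).clm_apply contDiffOn_const
  exact h.congr fun p hp => hf.du_eq_fderivWithin hp.1 p.2

/-- At t = 0 the two-sided time derivative would involve the arbitrary values at t < 0; the
monotonicity arguments below reach t = 0 by continuity instead. -/
lemma hasDerivAt_dt (hf : SmoothFlow f) {t : ℝ} (ht : 0 < t) (u : ℝ) :
    HasDerivAt (fun τ => f τ u) (HypFlow.dt f t u) t := by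
  have h : DifferentiableAt ℝ (fun τ => f τ u) t :=
    DifferentiableAt.comp (g := fun p : ℝ × ℝ => f p.1 p.2) (f := fun τ : ℝ => (τ, u)) t
      ((hf.contDiffAt ht u).differentiableAt (by simp)) (by fun_prop)
  exact h.hasDerivAt

lemma dt_eq_fderiv (hf : SmoothFlow f) {t : ℝ} (ht : 0 < t) (u : ℝ) :
    HypFlow.dt f t u = fderiv ℝ (fun p : ℝ × ℝ => f p.1 p.2) (t, u) (1, 0) := by
  have h1 := ((hf.contDiffAt ht u).differentiableAt (by simp)).hasFDerivAt
  have h2 : HasDerivAt (fun τ : ℝ => (τ, u)) ((1 : ℝ), (0 : ℝ)) t :=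
    (hasDerivAt_id _).prodMk (hasDerivAt_const _ _)
  exact (h1.comp_hasDerivAt t h2).deriv

lemma du_eq_fderiv (hf : SmoothFlow f) {t : ℝ} (ht : 0 < t) (u : ℝ) :
    HypFlow.du f t u = fderiv ℝ (fun p : ℝ × ℝ => f p.1 p.2) (t, u) (0, 1) := by
  have h1 := ((hf.contDiffAt ht u).differentiableAt (by simp)).hasFDerivAt
  have h2 : HasDerivAt (fun v : ℝ => (t, v)) ((0 : ℝ), (1 : ℝ)) u :=
    (hasDerivAt_const _ _).prodMk (hasDerivAt_id _)
  exact (h1.comp_hasDerivAt u h2).deriv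

lemma contDiffAt_fderiv (hf : SmoothFlow f) {t : ℝ} (ht : 0 < t) (u : ℝ) :
    ContDiffAt ℝ ∞ (fderiv ℝ (fun p : ℝ × ℝ => f p.1 p.2)) (t, u) :=
  (hf.contDiffAt ht u).fderiv_right (by simp)

lemma continuousAt_dt (hf : SmoothFlow f) {t : ℝ} (ht : 0 < t) (u : ℝ) :
    ContinuousAt (fun p : ℝ × ℝ => HypFlow.dt f p.1 p.2) (t, u) := by
  have h : ContinuousAt (fun p : ℝ × ℝ => fderiv ℝ (fun p : ℝ × ℝ => f p.1 p.2) p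
      ((1 : ℝ), (0 : ℝ))) (t, u) :=
    (hf.contDiffAt_fderiv ht u).continuousAt.clm_apply continuousAt_const
  refine h.congr ?_
  filter_upwards [prod_mem_nhds (Ioi_mem_nhds ht) (Filter.univ_mem (f := 𝓝 u))] with p hp
  exact (hf.dt_eq_fderiv hp.1 p.2).symm

/-- Mixed partial derivatives commute. -/
lemma hasDerivAt_du_time (hf : SmoothFlow f) {t : ℝ} (ht : 0 < t) (u : ℝ) :
    HasDerivAt (fun τ => HypFlow.du f τ u) (HypFlow.du (HypFlow.dt f) t u) t := by
  set G := fderiv ℝ (fun p : ℝ × ℝ => f p.1 p.2) with hG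
  have hd : HasFDerivAt G (fderiv ℝ G (t, u)) (t, u) :=
    ((hf.contDiffAt_fderiv ht u).differentiableAt (by simp)).hasFDerivAt
  have hsymm : IsSymmSndFDerivAt ℝ (fun p : ℝ × ℝ => f p.1 p.2) (t, u) :=
    (hf.contDiffAt ht u).isSymmSndFDerivAt (by
      rw [minSmoothness_of_isRCLikeNormedField]; exact WithTop.coe_le_coe.2 le_top)
  have h1 : HasDerivAt (fun τ : ℝ => (τ, u)) ((1 : ℝ), (0 : ℝ)) t :=
    (hasDerivAt_id _).prodMk (hasDerivAt_const _ _)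
  have h2 : HasDerivAt (fun v : ℝ => (t, v)) ((0 : ℝ), (1 : ℝ)) u :=
    (hasDerivAt_const _ _).prodMk (hasDerivAt_id _)
  have k1 : HasDerivAt (fun τ => G (τ, u) (0, 1)) (fderiv ℝ G (t, u) (1, 0) (0, 1)) t :=
    (ContinuousLinearMap.apply ℝ E ((0 : ℝ), (1 : ℝ))).hasFDerivAt.comp_hasDerivAt t
      (hd.comp_hasDerivAt t h1)
  have k2 : HasDerivAt (fun v => G (t, v) (1, 0)) (fderiv ℝ G (t, u) (0, 1) (1, 0)) u :=
    (ContinuousLinearMap.apply ℝ E ((1 : ℝ), (0 : ℝ))).hasFDerivAt.comp_hasDerivAt u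
      (hd.comp_hasDerivAt u h2)
  have e1 : HypFlow.du (HypFlow.dt f) t u = fderiv ℝ G (t, u) (1, 0) (0, 1) := by
    have : HypFlow.dt f t = fun v => G (t, v) (1, 0) := funext fun v => hf.dt_eq_fderiv ht v
    rw [HypFlow.du, this, k2.deriv]
    exact hsymm _ _
  rw [e1]
  refine k1.congr_of_eventuallyEq ?_
  filter_upwards [Ioi_mem_nhds ht] with τ hτ
  exact hf.du_eq_fderiv hτ u

lemma dt_du (hf : SmoothFlow f) {t : ℝ} (ht : 0 < t) :
    HypFlow.dt (HypFlow.du f) t = HypFlow.du (HypFlow.dt f) t :=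
  funext fun u => (hf.hasDerivAt_du_time ht u).deriv

lemma continuous_slice (hf : SmoothFlow f) {t : ℝ} (ht : 0 ≤ t) : Continuous (f t) :=
  (hf.slice ht).continuous

lemma continuous_dt (hf : SmoothFlow f) {t : ℝ} (ht : 0 < t) : Continuous (HypFlow.dt f t) :=
  continuous_iff_continuousAt.2 fun u =>
    ContinuousAt.comp (g := fun p : ℝ × ℝ => HypFlow.dt f p.1 p.2) (f := fun v : ℝ => (t, v))
      (hf.continuousAt_dt ht u) (by fun_prop)

lemma exists_bound (hf : SmoothFlow f) {c : ℝ} (hc : 0 < c)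
    (hp : ∀ t, 0 ≤ t → Function.Periodic (f t) c) (T : ℝ) :
    ∃ B, 0 < B ∧ ∀ t ∈ Set.Icc 0 T, ∀ u, ‖f t u‖ ≤ B := by
  have hK : IsCompact (Set.Icc (0 : ℝ) T ×ˢ Set.Icc (0 : ℝ) c) := isCompact_Icc.prod isCompact_Icc
  obtain ⟨B, hB⟩ := hK.exists_bound_of_continuousOn
    (hf.continuousOn.mono (Set.prod_mono (fun t ht => ht.1) (Set.subset_univ _)))
  refine ⟨|B| + 1, by positivity, fun t ht u => ?_⟩
  obtain ⟨v, hv, huv⟩ := (hp t ht.1).exists_mem_Ico₀ hc u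
  rw [huv]
  exact (hB (t, v) ⟨ht, hv.1, hv.2.le⟩).trans ((le_abs_self B).trans (by linarith))

end SmoothFlow

lemma periodic_du {t c : ℝ} (h : Function.Periodic (f t) c) :
    Function.Periodic (HypFlow.du f t) c := by
  intro u
  have : f t = fun v => f t (v + c) := funext fun v => (h v).symm
  unfold HypFlow.du
  conv_rhs => rw [this]
  rw [deriv_comp_add_const]

end Calculus

/-! ### Integrals depending on time -/

section Integral

variable {f : ℝ → ℝ → ℝ}

lemma SmoothFlow.continuousOn_integral (hf : SmoothFlow f) (a b : ℝ) :
    ContinuousOn (fun t => ∫ u in a..b, f t u) (Set.Ici 0) := by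
  -- Freezing the time at 0 for t < 0 extends f continuously to all times.
  have h : Continuous (fun t => ∫ u in a..b, f (max t 0) u) := by
    apply intervalIntegral.continuous_parametric_intervalIntegral_of_continuous'
    refine hf.continuousOn.comp_continuous (f := fun p : ℝ × ℝ => (max p.1 0, p.2))
      (by fun_prop) (fun p => ⟨le_max_right p.1 0, trivial⟩)
  refine h.continuousOn.congr fun t ht => ?_
  simp only [max_eq_left (show (0 : ℝ) ≤ t from ht)]

lemma SmoothFlow.hasDerivAt_integral (hf : SmoothFlow f) {a b : ℝ} (hab : a ≤ b) {t : ℝ}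
    (ht : 0 < t) :
    HasDerivAt (fun τ => ∫ u in a..b, f τ u) (∫ u in a..b, HypFlow.dt f t u) t := by
  have hK : IsCompact (Set.Icc (t / 2) (t + 1) ×ˢ Set.Icc a b) := isCompact_Icc.prod isCompact_Icc
  have hcont : ContinuousOn (fun p : ℝ × ℝ => HypFlow.dt f p.1 p.2)
      (Set.Icc (t / 2) (t + 1) ×ˢ Set.Icc a b) := fun p hp =>
    (hf.continuousAt_dt (t := p.1) (by have := hp.1.1; linarith) p.2).continuousWithinAt
  obtain ⟨B, hB⟩ := hK.exists_bound_of_continuousOn hcont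
  refine (intervalIntegral.hasDerivAt_integral_of_dominated_loc_of_deriv_le
    (F := f) (F' := HypFlow.dt f) (bound := fun _ => B) (s := Set.Icc (t / 2) (t + 1))
    (Icc_mem_nhds (by linarith) (by linarith)) ?_ ?_ ?_ ?_ ?_ ?_).2
  · filter_upwards [Ioi_mem_nhds ht] with τ hτ
    exact (hf.continuous_slice (le_of_lt hτ)).aestronglyMeasurable
  · exact (hf.continuous_slice ht.le).intervalIntegrable _ _
  · exact (hf.continuous_dt ht).aestronglyMeasurable
  · refine Filter.Eventually.of_forall fun u hu τ hτ => hB (τ, u) ⟨hτ, ?_⟩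
    rw [Set.uIoc_of_le hab] at hu
    exact ⟨hu.1.le, hu.2⟩
  · exact intervalIntegrable_const
  · exact Filter.Eventually.of_forall fun u _ τ hτ =>
      hf.hasDerivAt_dt (by have := hτ.1; linarith) u

end Integral

/-! ### Integration by parts, a minimum principle, a Gronwall argument -/

/-- Integration by parts for periodic functions. -/
lemma integral_mul_deriv_of_periodic {p q p' q' : ℝ → ℝ} {c : ℝ}
    (hp : ∀ u, HasDerivAt p (p' u) u) (hq : ∀ u, HasDerivAt q (q' u) u)
    (hp' : Continuous p') (hq' : Continuous q')
    (pp : Function.Periodic p c) (pq : Function.Periodic q c) :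
    ∫ u in (0 : ℝ)..c, p u * q' u = -∫ u in (0 : ℝ)..c, p' u * q u := by
  rw [intervalIntegral.integral_mul_deriv_eq_deriv_mul (fun u _ => hp u) (fun u _ => hq u)
    (hp'.intervalIntegrable _ _) (hq'.intervalIntegrable _ _)]
  have h1 : p c = p 0 := by simpa using pp 0
  have h2 : q c = q 0 := by simpa using pq 0
  rw [h1, h2]; ring

lemma integral_deriv_of_periodic {p p' : ℝ → ℝ} {c : ℝ}
    (hp : ∀ u, HasDerivAt p (p' u) u) (hp' : Continuous p') (pp : Function.Periodic p c) :
    ∫ u in (0 : ℝ)..c, p' u = 0 := by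
  rw [intervalIntegral.integral_eq_sub_of_hasDerivAt (fun u _ => hp u)
    (hp'.intervalIntegrable _ _)]
  have h1 : p c = p 0 := by simpa using pp 0
  rw [h1, sub_self]

/-- A minimum principle: if the time derivative is at least `-c` at every spatial minimum at which
`f` is below `ℓ`, then the minimum decreases at most at the rate `c` while it is below `ℓ`. -/
lemma min_principle {f : ℝ → ℝ → ℝ} {P a b ℓ c : ℝ} (hP : 0 < P) (hab : a ≤ b)
    (hf : ContinuousOn (fun p : ℝ × ℝ => f p.1 p.2) (Set.Icc a b ×ˢ Set.univ))
    (per : ∀ t ∈ Set.Icc a b, Function.Periodic (f t) P)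
    (ha : ∀ u, ℓ ≤ f a u)
    (hmin : ∀ t ∈ Set.Ioc a b, ∀ u, (∀ v, f t u ≤ f t v) → f t u < ℓ →
      ∃ f', HasDerivAt (fun τ => f τ u) f' t ∧ -c ≤ f') (hc : 0 ≤ c) (u : ℝ) :
    ℓ - c * (b - a) ≤ f b u := by
  refine le_of_forall_pos_le_add fun ε hε => ?_
  -- The extra slope δ makes the comparison at a minimum strict and costs at most ε in total.
  obtain ⟨δ, hδ, hδε⟩ : ∃ δ > 0, δ * (b - a) ≤ ε := by
    refine ⟨ε / (b - a + 1), by have := sub_nonneg.2 hab; positivity, ?_⟩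
    have h := sub_nonneg.2 hab
    rw [div_mul_eq_mul_div, div_le_iff₀ (by linarith)]
    nlinarith
  set F : ℝ × ℝ → ℝ := fun p => f p.1 p.2 + (c + δ) * (p.1 - a) with hF
  have hK : IsCompact (Set.Icc a b ×ˢ Set.Icc (0 : ℝ) P) := isCompact_Icc.prod isCompact_Icc
  have hne : (Set.Icc a b ×ˢ Set.Icc (0 : ℝ) P).Nonempty :=
    ⟨(a, 0), ⟨⟨le_rfl, hab⟩, ⟨le_rfl, hP.le⟩⟩⟩
  have hcF : ContinuousOn F (Set.Icc a b ×ˢ Set.Icc (0 : ℝ) P) := by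
    refine ContinuousOn.add (hf.mono (Set.prod_mono le_rfl (Set.subset_univ _))) ?_
    fun_prop
  obtain ⟨⟨t₀, u₀⟩, ⟨ht₀, hu₀⟩, hmin₀⟩ := hK.exists_isMinOn hne hcF
  have hall : ∀ t ∈ Set.Icc a b, ∀ v, F (t₀, u₀) ≤ F (t, v) := by
    intro t ht v
    obtain ⟨w, hw, hvw⟩ := (per t ht).exists_mem_Ico₀ hP v
    have := hmin₀ (show (t, w) ∈ Set.Icc a b ×ˢ Set.Icc (0 : ℝ) P from ⟨ht, hw.1, hw.2.le⟩)
    simp only [hF, hvw] at this ⊢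
    exact this
  have hkey : ℓ ≤ F (t₀, u₀) := by
    rcases eq_or_lt_of_le ht₀.1 with h | h
    · simp only at h
      simp only [hF, ← h, sub_self, mul_zero, add_zero]
      exact ha u₀
    by_contra! hlt
    have hlt' : f t₀ u₀ < ℓ := by
      simp only [hF] at hlt
      nlinarith [mul_pos (show 0 < c + δ by linarith) (sub_pos.2 h)]
    obtain ⟨f', hf', hcf⟩ := hmin t₀ ⟨h, ht₀.2⟩ u₀ (fun v => by
      have := hall t₀ ht₀ v
      simpa [hF] using this) hlt'
    have hG : HasDerivAt (fun τ => F (τ, u₀)) (f' + (c + δ)) t₀ := by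
      have h2 : HasDerivAt (fun τ : ℝ => (c + δ) * (τ - a)) (c + δ) t₀ := by
        simpa using ((hasDerivAt_id t₀).sub_const a).const_mul (c + δ)
      exact hf'.add h2
    -- Only earlier times are compared, because t₀ may be the right end b.
    have hle : f' + (c + δ) ≤ 0 := by
      have hs := hG.hasDerivWithinAt (s := Set.Iio t₀)
      rw [hasDerivWithinAt_iff_tendsto_slope' (by simp)] at hs
      refine le_of_tendsto hs ?_
      filter_upwards [Ioo_mem_nhdsLT h] with τ hτ
      have := hall τ ⟨hτ.1.le, hτ.2.le.trans ht₀.2⟩ u₀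
      rw [slope_def_field]
      exact div_nonpos_of_nonneg_of_nonpos (by linarith) (by linarith [hτ.2])
    linarith
  have := hkey.trans (hall b ⟨hab, le_rfl⟩ u)
  simp only [hF] at this
  nlinarith

/-- A differential inequality with zero initial value. -/
lemma eq_zero_of_deriv_le_mul {e : ℝ → ℝ} {T C : ℝ} (hcont : ContinuousOn e (Set.Icc 0 T))
    (h0 : e 0 = 0) (hnn : ∀ t ∈ Set.Icc 0 T, 0 ≤ e t)
    (hd : ∀ t ∈ Set.Ioo 0 T, ∃ e', HasDerivAt e e' t ∧ e' ≤ C * e t) :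
    ∀ t ∈ Set.Icc 0 T, e t = 0 := by
  have hanti : AntitoneOn (fun t => Real.exp (-(C * t)) * e t) (Set.Icc 0 T) := by
    have hder : ∀ t ∈ Set.Ioo 0 T, ∃ d, HasDerivAt (fun t => Real.exp (-(C * t)) * e t) d t ∧
        d ≤ 0 := by
      intro t ht
      obtain ⟨e', he', hle⟩ := hd t ht
      have h1 : HasDerivAt (fun t : ℝ => Real.exp (-(C * t))) (Real.exp (-(C * t)) * (-C)) t := by
        simpa using (((hasDerivAt_id t).const_mul C).neg).exp
      refine ⟨_, h1.mul he', ?_⟩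
      have := Real.exp_pos (-(C * t))
      nlinarith
    apply antitoneOn_of_deriv_nonpos (convex_Icc 0 T)
    · exact ContinuousOn.mul (by fun_prop) hcont
    · rw [interior_Icc]
      intro t ht
      obtain ⟨d, hd, -⟩ := hder t ht
      exact hd.differentiableAt.differentiableWithinAt
    · rw [interior_Icc]
      intro t ht
      obtain ⟨d, hd, hle⟩ := hder t ht
      rw [hd.deriv]; exact hle
  intro t ht
  have h := hanti ⟨le_rfl, ht.1.trans ht.2⟩ ht ht.1
  simp only [h0, mul_zero] at h
  have hp := Real.exp_pos (-(C * t))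
  exact le_antisymm (by by_contra! hpos; nlinarith) (hnn t ht)

lemma two_pi_pos : 0 < 2 * Real.pi := by positivity

/-! ### Speed and curvature in half-plane coordinates -/

section Curve

variable {γ : ℝ → ℍ}

lemma hasDerivAt_re {z : ℝ → ℂ} {z' : ℂ} {u : ℝ} (h : HasDerivAt z z' u) :
    HasDerivAt (fun v => (z v).re) z'.re u :=
  Complex.reCLM.hasFDerivAt.comp_hasDerivAt u h

lemma hasDerivAt_im {z : ℝ → ℂ} {z' : ℂ} {u : ℝ} (h : HasDerivAt z z' u) :
    HasDerivAt (fun v => (z v).im) z'.im u :=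
  Complex.imCLM.hasFDerivAt.comp_hasDerivAt u h

lemma speed_eq_sqrt (u : ℝ) :
    speed γ u = √((velocity γ u).re ^ 2 + (velocity γ u).im ^ 2) / (γ u).im := by
  rw [speed, Complex.norm_def, Complex.normSq_apply]
  ring_nf

lemma speed_pos {u : ℝ} (h : velocity γ u ≠ 0) : 0 < speed γ u :=
  div_pos (norm_pos_iff.2 h) (γ u).im_pos

lemma normSq_velocity_pos {u : ℝ} (h : velocity γ u ≠ 0) :
    0 < (velocity γ u).re ^ 2 + (velocity γ u).im ^ 2 := by
  have := Complex.normSq_pos.2 h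
  rw [Complex.normSq_apply] at this
  nlinarith

lemma speed_sq_mul {u : ℝ} : (speed γ u * (γ u).im) ^ 2 =
    (velocity γ u).re ^ 2 + (velocity γ u).im ^ 2 := by
  have := (γ u).im_pos
  rw [speed, div_mul_cancel₀ _ this.ne', ← Complex.normSq_eq_norm_sq, Complex.normSq_apply]
  ring

/-- The geodesic curvature is the sum of the Euclidean one and the rotation of the horocycles. -/
lemma curvature_mul_speed (σ : ℝ) (hγ : ContDiff ℝ ∞ (fun u => (γ u : ℂ))) {u : ℝ}
    (hv : velocity γ u ≠ 0) :
    curvature σ γ u * speed γ u =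
      σ * (((velocity γ u).re * (deriv (velocity γ) u).im -
        (velocity γ u).im * (deriv (velocity γ) u).re) /
        ((velocity γ u).re ^ 2 + (velocity γ u).im ^ 2) + (velocity γ u).re / (γ u).im) := by
  have hvel : ContDiff ℝ ∞ (velocity γ) := (contDiff_infty_iff_deriv.1 hγ).2
  have hdv : HasDerivAt (velocity γ) (deriv (velocity γ) u) u :=
    (hvel.differentiable (by simp) u).hasDerivAt
  have hdz : HasDerivAt (fun u => (γ u : ℂ)) (velocity γ u) u :=
    (hγ.differentiable (by simp) u).hasDerivAt
  have hy := (γ u).im_pos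
  have hg := speed_pos hv
  have hgd : DifferentiableAt ℝ (speed γ) u := by
    have h1 : DifferentiableAt ℝ (fun u => ‖velocity γ u‖) u := hdv.differentiableAt.norm ℝ hv
    have h2 : DifferentiableAt ℝ (fun u => (γ u).im) u := (hasDerivAt_im hdz).differentiableAt
    exact h1.div h2 hy.ne'
  -- The derivative of the speed contributes only a tangential vector, which the product with the
  -- normal removes; its value is not needed.
  obtain ⟨g', hg'⟩ : ∃ g', HasDerivAt (speed γ) g' u := ⟨_, hgd.hasDerivAt⟩
  have hT : HasDerivAt (tangent γ) ((deriv (velocity γ) u * (speed γ u : ℂ) -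
      velocity γ u * (g' : ℂ)) / (speed γ u : ℂ) ^ 2) u :=
    hdv.div hg'.ofReal_comp (by exact_mod_cast hg.ne')
  have hq := speed_sq_mul (γ := γ) (u := u)
  have hq0 := normSq_velocity_pos hv
  rw [curvature, covDeriv, hT.deriv, normal, tangent]
  set v := velocity γ u
  set v' := deriv (velocity γ) u
  set g := speed γ u
  set y := (γ u).im
  have e : (starRingEnd ℂ ((σ : ℂ) * Complex.I * (v / (g : ℂ))) *
      (((v' * (g : ℂ) - v * (g' : ℂ)) / (g : ℂ) ^ 2 +
        Complex.I / (y : ℂ) * v * (v / (g : ℂ))) / (g : ℂ))).re =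
      σ * ((v.re * v'.im - v.im * v'.re) / g ^ 3 + (v.re ^ 2 + v.im ^ 2) * v.re / (y * g ^ 3)) := by
    have e1 : (starRingEnd ℂ ((σ : ℂ) * Complex.I * (v / (g : ℂ))) *
      (((v' * (g : ℂ) - v * (g' : ℂ)) / (g : ℂ) ^ 2 +
        Complex.I / (y : ℂ) * v * (v / (g : ℂ))) / (g : ℂ))) =
        ((σ / (y * g ^ 4) : ℝ) : ℂ) * (-Complex.I * starRingEnd ℂ v *
          ((v' * (g : ℂ) - v * (g' : ℂ)) * (y : ℂ) + Complex.I * v * v * (g : ℂ))) := by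
      have : (g : ℂ) ≠ 0 := by exact_mod_cast hg.ne'
      have : (y : ℂ) ≠ 0 := by exact_mod_cast hy.ne'
      simp only [map_mul, map_div₀, Complex.conj_ofReal, Complex.conj_I]
      push_cast
      field_simp
    rw [e1, Complex.re_ofReal_mul]
    simp only [Complex.mul_re, Complex.mul_im, Complex.add_re, Complex.add_im, Complex.sub_re,
      Complex.sub_im, Complex.neg_re, Complex.neg_im, Complex.I_re, Complex.I_im, Complex.conj_re,
      Complex.conj_im, Complex.ofReal_re, Complex.ofReal_im]
    field_simp
    ring
  rw [e, ← hq]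
  field_simp

end Curve

/-! ### The curvature-speed system; regularity and persistence of convexity -/

/-- The evolution of curvature and speed under a nonlocal flow by `κ ^ α`; `ρ` is the weight of the
average `φ`. -/
structure NormalFlow (α : ℝ) (ρ κ g : ℝ → ℝ → ℝ) (φ : ℝ → ℝ) : Prop where
  smooth_curv : SmoothFlow κ
  smooth_speed : SmoothFlow g
  periodic_curv : ∀ t, 0 ≤ t → Function.Periodic (κ t) (2 * Real.pi)
  periodic_speed : ∀ t, 0 ≤ t → Function.Periodic (g t) (2 * Real.pi)
  curv_pos : ∀ t, 0 ≤ t → ∀ u, 0 < κ t u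
  speed_pos : ∀ t, 0 ≤ t → ∀ u, 0 < g t u
  weight : (ρ = fun _ _ => 1) ∨ ρ = κ
  average : ∀ t, 0 ≤ t → φ t * (∫ u in (0 : ℝ)..(2 * Real.pi), ρ t u * g t u) =
    ∫ u in (0 : ℝ)..(2 * Real.pi), ρ t u * κ t u ^ α * g t u
  speed_evolution : ∀ t, 0 < t → ∀ u,
    HasDerivAt (fun τ => g τ u) (-(κ t u * (φ t - κ t u ^ α) * g t u)) t
  curv_evolution : ∀ t, 0 < t → ∀ u,
    HasDerivAt (fun τ => κ τ u)
      (-(deriv (fun v => deriv (fun z => κ t z ^ α) v / g t v) u / g t u) +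
        (κ t u ^ 2 - 1) * (φ t - κ t u ^ α)) t

section Flow

variable {k : Kind} {σ α : ℝ} {X₀ : ℝ → ℍ} {X : ℝ → ℝ → ℍ}

namespace IsGlobalFlow

lemma smooth_re (h : IsGlobalFlow k σ α X₀ X) : SmoothFlow (fun t u => (X t u : ℂ).re) :=
  Complex.reCLM.contDiff.comp_contDiffOn h.smooth

lemma smooth_im (h : IsGlobalFlow k σ α X₀ X) : SmoothFlow (fun t u => (X t u : ℂ).im) :=
  Complex.imCLM.contDiff.comp_contDiffOn h.smooth

lemma smooth_slice (h : IsGlobalFlow k σ α X₀ X) {t : ℝ} (ht : 0 ≤ t) :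
    ContDiff ℝ ∞ (fun u => (X t u : ℂ)) :=
  SmoothFlow.slice (f := fun t u => (X t u : ℂ)) h.smooth ht

lemma smooth_velocity (h : IsGlobalFlow k σ α X₀ X) : SmoothFlow (fun t => velocity (X t)) :=
  SmoothFlow.du (f := fun t u => (X t u : ℂ)) h.smooth

lemma velocity_re (h : IsGlobalFlow k σ α X₀ X) {t : ℝ} (ht : 0 ≤ t) (u : ℝ) :
    (velocity (X t) u).re = du (fun t u => (X t u : ℂ).re) t u :=
  (hasDerivAt_re (SmoothFlow.hasDerivAt_du (f := fun t u => (X t u : ℂ))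
    h.smooth ht u)).deriv.symm

lemma velocity_im (h : IsGlobalFlow k σ α X₀ X) {t : ℝ} (ht : 0 ≤ t) (u : ℝ) :
    (velocity (X t) u).im = du (fun t u => (X t u : ℂ).im) t u :=
  (hasDerivAt_im (SmoothFlow.hasDerivAt_du (f := fun t u => (X t u : ℂ))
    h.smooth ht u)).deriv.symm

lemma smooth_speed (h : IsGlobalFlow k σ α X₀ X) : SmoothFlow (fun t => speed (X t)) := by
  refine ContDiffOn.div ?_ h.smooth_im (fun p _ => (X p.1 p.2).im_pos.ne')
  exact ContDiffOn.norm ℝ h.smooth_velocity (fun p hp => h.regular p.1 hp.1 p.2)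

lemma periodic_coe (h : IsGlobalFlow k σ α X₀ X) {t : ℝ} (ht : 0 ≤ t) :
    Function.Periodic (fun u => (X t u : ℂ)) (2 * Real.pi) :=
  fun u => congrArg _ (h.periodic t ht u)

lemma periodic_velocity (h : IsGlobalFlow k σ α X₀ X) {t : ℝ} (ht : 0 ≤ t) :
    Function.Periodic (velocity (X t)) (2 * Real.pi) :=
  periodic_du (f := fun t u => (X t u : ℂ)) (h.periodic_coe ht)

lemma periodic_speed (h : IsGlobalFlow k σ α X₀ X) {t : ℝ} (ht : 0 ≤ t) :
    Function.Periodic (speed (X t)) (2 * Real.pi) := fun u => by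
  simp only [speed, h.periodic_velocity ht u, h.periodic t ht u]

/-- The curvature times the speed, in coordinates. -/
lemma curvature_mul_speed (h : IsGlobalFlow k σ α X₀ X) {t : ℝ} (ht : 0 ≤ t) (u : ℝ) :
    curvature σ (X t) u * speed (X t) u =
      σ * (((velocity (X t) u).re * (du (fun t => velocity (X t)) t u).im -
        (velocity (X t) u).im * (du (fun t => velocity (X t)) t u).re) /
        ((velocity (X t) u).re ^ 2 + (velocity (X t) u).im ^ 2) +
        (velocity (X t) u).re / (X t u).im) :=
  HypFlow.curvature_mul_speed σ (h.smooth_slice ht) (h.regular t ht u)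

lemma smooth_curvature (h : IsGlobalFlow k σ α X₀ X) :
    SmoothFlow (fun t => curvature σ (X t)) := by
  have hre : ContDiffOn ℝ ∞ (fun p : ℝ × ℝ => (velocity (X p.1) p.2).re) (Set.Ici 0 ×ˢ Set.univ) :=
    Complex.reCLM.contDiff.comp_contDiffOn h.smooth_velocity
  have him : ContDiffOn ℝ ∞ (fun p : ℝ × ℝ => (velocity (X p.1) p.2).im) (Set.Ici 0 ×ˢ Set.univ) :=
    Complex.imCLM.contDiff.comp_contDiffOn h.smooth_velocity
  have hre' : ContDiffOn ℝ ∞ (fun p : ℝ × ℝ => (du (fun t => velocity (X t)) p.1 p.2).re)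
      (Set.Ici 0 ×ˢ Set.univ) :=
    Complex.reCLM.contDiff.comp_contDiffOn h.smooth_velocity.du
  have him' : ContDiffOn ℝ ∞ (fun p : ℝ × ℝ => (du (fun t => velocity (X t)) p.1 p.2).im)
      (Set.Ici 0 ×ˢ Set.univ) :=
    Complex.imCLM.contDiff.comp_contDiffOn h.smooth_velocity.du
  have hy : ContDiffOn ℝ ∞ (fun p : ℝ × ℝ => (X p.1 p.2).im) (Set.Ici 0 ×ˢ Set.univ) := h.smooth_im
  have key : ContDiffOn ℝ ∞ (fun p : ℝ × ℝ => σ * (((velocity (X p.1) p.2).re *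
      (du (fun t => velocity (X t)) p.1 p.2).im - (velocity (X p.1) p.2).im *
      (du (fun t => velocity (X t)) p.1 p.2).re) / ((velocity (X p.1) p.2).re ^ 2 +
      (velocity (X p.1) p.2).im ^ 2) + (velocity (X p.1) p.2).re / (X p.1 p.2).im) /
      speed (X p.1) p.2) (Set.Ici 0 ×ˢ Set.univ) := by
    refine ContDiffOn.div (contDiffOn_const.mul (ContDiffOn.add (ContDiffOn.div
      ((hre.mul him').sub (him.mul hre')) ((hre.pow 2).add (him.pow 2)) ?_)
      (hre.div hy ?_))) h.smooth_speed ?_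
    · exact fun p hp => (normSq_velocity_pos (h.regular p.1 hp.1 p.2)).ne'
    · exact fun p _ => (X p.1 p.2).im_pos.ne'
    · exact fun p hp => (HypFlow.speed_pos (h.regular p.1 hp.1 p.2)).ne'
  refine ContDiffOn.congr key fun p hp => ?_
  rw [eq_div_iff (HypFlow.speed_pos (h.regular p.1 hp.1 p.2)).ne', h.curvature_mul_speed hp.1 p.2]

lemma periodic_curvature (h : IsGlobalFlow k σ α X₀ X) {t : ℝ} (ht : 0 ≤ t) :
    Function.Periodic (curvature σ (X t)) (2 * Real.pi) := fun u => by
  have hg := (HypFlow.speed_pos (h.regular t ht u)).ne'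
  have h1 := h.curvature_mul_speed ht u
  have h2 := h.curvature_mul_speed ht (u + 2 * Real.pi)
  simp only [h.periodic_velocity ht u, h.periodic t ht u, h.periodic_speed ht u,
    periodic_du (f := fun t => velocity (X t)) (h.periodic_velocity ht) u] at h2
  exact mul_right_cancel₀ hg (h2.trans h1.symm)

lemma norm_normal (hσ : σ = 1 ∨ σ = -1) {γ : ℝ → ℍ} {u : ℝ} (hv : velocity γ u ≠ 0) :
    ‖normal σ γ u‖ = (γ u).im := by
  have h1 : ‖(σ : ℂ)‖ = 1 := by rcases hσ with rfl | rfl <;> simp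
  have hg := HypFlow.speed_pos hv
  have : ‖velocity γ u‖ = speed γ u * (γ u).im := by
    rw [speed, div_mul_cancel₀ _ (γ u).im_pos.ne']
  rw [normal, tangent, norm_mul, norm_mul, h1, Complex.norm_I, norm_div, this, Complex.norm_real,
    Real.norm_of_nonneg hg.le]
  field_simp

/-- On a compact time interval the flow moves with bounded speed. -/
lemma exists_bound_motion (h : IsGlobalFlow k σ α X₀ X) (hσ : σ = 1 ∨ σ = -1) (T : ℝ) :
    ∃ B, ∀ t ∈ Set.Icc 0 T, ∀ u, |phi σ α (X t) k - curvature σ (X t) u ^ α| ≤ B := by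
  set Z := fun p : ℝ × ℝ => (X p.1 p.2 : ℂ)
  set Ω : Set (ℝ × ℝ) := Set.Ici 0 ×ˢ Set.univ
  -- This quotient is |F|, read off from ∂X/∂t. It is continuous by smoothness of X, although the
  -- sign of κ, and so the behaviour of κ^α, is not yet known.
  have hD : ContinuousOn (fun p => ‖fderivWithin ℝ Z Ω p (1, 0)‖ / (X p.1 p.2).im) Ω := by
    have h1 : ContinuousOn (fun p => fderivWithin ℝ Z Ω p) Ω :=
      h.smooth.continuousOn_fderivWithin uniqueDiffOn_halfPlane (by simp)
    exact (h1.clm_apply continuousOn_const).norm.div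
      (SmoothFlow.continuousOn h.smooth_im) (fun p _ => (X p.1 p.2).im_pos.ne')
  have heq : ∀ t, 0 ≤ t → ∀ u, |phi σ α (X t) k - curvature σ (X t) u ^ α| =
      ‖fderivWithin ℝ Z Ω (t, u) (1, 0)‖ / (X t u).im := by
    intro t ht u
    have h1 : HasFDerivWithinAt Z _ Ω (t, u) :=
      (h.smooth.differentiableOn (by simp) (t, u) ⟨ht, trivial⟩).hasFDerivWithinAt
    have h2 : HasDerivWithinAt (fun τ : ℝ => (τ, u)) ((1 : ℝ), (0 : ℝ)) (Set.Ici 0) t :=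
      (hasDerivWithinAt_id _ _).prodMk (hasDerivWithinAt_const _ _ _)
    have h3 := h1.comp_hasDerivWithinAt t h2
      (fun τ hτ => Set.mk_mem_prod hτ (Set.mem_univ u))
    have h4 := (uniqueDiffOn_Ici (0 : ℝ) t ht).eq_deriv _ h3 (h.evolution t ht u)
    rw [h4, norm_mul, norm_normal hσ (h.regular t ht u), Complex.norm_real, Real.norm_eq_abs,
      mul_div_cancel_right₀ _ (X t u).im_pos.ne']
  obtain ⟨B, hB⟩ := (isCompact_Icc (a := (0 : ℝ)) (b := T)).prod
    (isCompact_Icc (a := (0 : ℝ)) (b := 2 * Real.pi)) |>.exists_bound_of_continuousOn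
    (hD.mono (Set.prod_mono (fun t ht => ht.1) (Set.subset_univ _)))
  refine ⟨B, fun t ht u => ?_⟩
  obtain ⟨v, hv, huv⟩ := (h.periodic_curvature (t := t) ht.1).exists_mem_Ico₀ two_pi_pos u
  rw [huv, heq t ht.1 v]
  exact (le_abs_self _).trans (hB (t, v) ⟨ht, hv.1, hv.2.le⟩)

/-- A flow on which the curvature takes a fixed positive value at every time stays convex. -/
lemma curvature_pos (h : IsGlobalFlow k σ α X₀ X) (hσ : σ = 1 ∨ σ = -1) (hα : α < 0)
    (h0 : ∀ u, 0 < curvature σ X₀ u) {D : ℝ} (hD : 0 < D)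
    (hex : ∀ t, 0 ≤ t → ∃ u, 1 / curvature σ (X t) u = D) :
    ∀ t, 0 ≤ t → ∀ u, 0 < curvature σ (X t) u := by
  intro T hT u
  obtain ⟨B, hB⟩ := h.exists_bound_motion hσ T
  -- Comparing F at a given point with F at a point where κ = 1/D eliminates φ, so κ^α differs from
  -- D⁻¹ ^ α by at most 2|B|.
  set B' := 2 * |B| + D⁻¹ ^ α + 1 with hB'
  have hB'0 : 0 < B' := by positivity
  have hpow : ∀ t ∈ Set.Icc 0 T, ∀ v, |curvature σ (X t) v ^ α| ≤ B' := by
    intro t ht v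
    obtain ⟨w, hw⟩ := hex t ht.1
    have hκ : curvature σ (X t) w = D⁻¹ := by rw [← hw]; simp
    have h1 := abs_le.1 ((hB t ht v).trans (le_abs_self B))
    have h2 := abs_le.1 ((hB t ht w).trans (le_abs_self B))
    rw [hκ] at h2
    have : 0 < D⁻¹ ^ α := by positivity
    rw [abs_le]
    constructor <;> linarith
  have hδ : 0 < B' ^ α⁻¹ := by positivity
  -- Since α < 0, an upper bound for κ^α is a lower bound for κ wherever κ > 0.
  have hgap : ∀ t ∈ Set.Icc 0 T, ∀ v, 0 < curvature σ (X t) v →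
      B' ^ α⁻¹ ≤ curvature σ (X t) v := by
    intro t ht v hpos
    have h1 := (le_abs_self _).trans (hpow t ht v)
    have h2 := Real.rpow_le_rpow_of_nonpos (by positivity) h1 (inv_nonpos.2 hα.le)
    rwa [Real.rpow_rpow_inv hpos.le hα.ne] at h2
  have hconn : IsPreconnected (Set.Icc 0 T ×ˢ (Set.univ : Set ℝ)) :=
    isPreconnected_Icc.prod isPreconnected_univ
  have hcont : ContinuousOn (fun p : ℝ × ℝ => curvature σ (X p.1) p.2)
      (Set.Icc 0 T ×ˢ Set.univ) :=
    (SmoothFlow.continuousOn h.smooth_curvature).mono (Set.prod_mono (fun t ht => ht.1) le_rfl)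
  -- The values of κ on [0,T] × ℝ form an interval. If κ became nonpositive, the interval would
  -- contain half of the gap B' ^ α⁻¹, a positive value already excluded.
  have himg := (hconn.image _ hcont).ordConnected
  by_contra! hneg
  have m1 : curvature σ (X T) u ∈ (fun p : ℝ × ℝ => curvature σ (X p.1) p.2) ''
      (Set.Icc 0 T ×ˢ Set.univ) := ⟨(T, u), ⟨Set.right_mem_Icc.2 hT, trivial⟩, rfl⟩
  have m2 : curvature σ (X 0) u ∈ (fun p : ℝ × ℝ => curvature σ (X p.1) p.2) ''
      (Set.Icc 0 T ×ˢ Set.univ) := ⟨(0, u), ⟨Set.left_mem_Icc.2 hT, trivial⟩, rfl⟩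
  have hp0 : 0 < curvature σ (X 0) u := by rw [h.initial]; exact h0 u
  have hlow := hgap 0 (Set.left_mem_Icc.2 hT) u hp0
  obtain ⟨p, hp, hpe⟩ := himg.out m1 m2
    (show B' ^ α⁻¹ / 2 ∈ Set.Icc (curvature σ (X T) u) (curvature σ (X 0) u) from
      ⟨by linarith, by linarith⟩)
  have := hgap p.1 hp.1 p.2 (by simp only at hpe; rw [hpe]; linarith)
  simp only at hpe
  linarith

end IsGlobalFlow

end Flow

/-! ### Evolution equations of speed and curvature -/

section Flow

variable {k : Kind} {σ α : ℝ} {X₀ : ℝ → ℍ} {X : ℝ → ℝ → ℍ}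

namespace IsGlobalFlow

/-- The normal velocity per unit of parameter. -/
def rate (k : Kind) (σ α : ℝ) (X : ℝ → ℝ → ℍ) (t u : ℝ) : ℝ :=
  (phi σ α (X t) k - curvature σ (X t) u ^ α) / speed (X t) u

lemma dt_eq (h : IsGlobalFlow k σ α X₀ X) {t : ℝ} (ht : 0 < t) (u : ℝ) :
    HasDerivAt (fun τ => (X τ u : ℂ))
      (((σ * rate k σ α X t u : ℝ) : ℂ) * (Complex.I * velocity (X t) u)) t := by
  have h1 := (h.evolution t ht.le u).hasDerivAt (Ici_mem_nhds ht)
  refine h1.congr_deriv ?_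
  simp only [normal, tangent, rate]
  push_cast
  ring

lemma dt_re (h : IsGlobalFlow k σ α X₀ X) {t : ℝ} (ht : 0 < t) :
    dt (fun t u => (X t u : ℂ).re) t =
      fun u => -(σ * rate k σ α X t u * du (fun t u => (X t u : ℂ).im) t u) := by
  funext u
  have h1 := (hasDerivAt_re (h.dt_eq ht u)).deriv
  rw [← h.velocity_im ht.le]
  simpa [dt] using h1

lemma dt_im (h : IsGlobalFlow k σ α X₀ X) {t : ℝ} (ht : 0 < t) :
    dt (fun t u => (X t u : ℂ).im) t =
      fun u => σ * rate k σ α X t u * du (fun t u => (X t u : ℂ).re) t u := by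
  funext u
  have h1 := (hasDerivAt_im (h.dt_eq ht u)).deriv
  rw [← h.velocity_re ht.le]
  simpa [dt] using h1

lemma contDiff_rate (h : IsGlobalFlow k σ α X₀ X)
    (hpos : ∀ t, 0 ≤ t → ∀ u, 0 < curvature σ (X t) u) {t : ℝ} (ht : 0 ≤ t) :
    ContDiff ℝ ∞ (rate k σ α X t) :=
  ContDiff.div (contDiff_const.sub
    ((SmoothFlow.slice h.smooth_curvature ht).rpow_const_of_ne (fun u => (hpos t ht u).ne')))
    (SmoothFlow.slice h.smooth_speed ht) (fun u => (HypFlow.speed_pos (h.regular t ht u)).ne')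

lemma speed_eq (h : IsGlobalFlow k σ α X₀ X) {t : ℝ} (ht : 0 ≤ t) (u : ℝ) :
    speed (X t) u = √(du (fun t u => (X t u : ℂ).re) t u ^ 2 +
      du (fun t u => (X t u : ℂ).im) t u ^ 2) / (X t u : ℂ).im := by
  rw [speed_eq_sqrt, h.velocity_re ht, h.velocity_im ht]; rfl

lemma curvature_mul_speed' (h : IsGlobalFlow k σ α X₀ X) {t : ℝ} (ht : 0 ≤ t) (u : ℝ) :
    curvature σ (X t) u * speed (X t) u =
      σ * ((du (fun t u => (X t u : ℂ).re) t u * du (du (fun t u => (X t u : ℂ).im)) t u -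
        du (fun t u => (X t u : ℂ).im) t u * du (du (fun t u => (X t u : ℂ).re)) t u) /
        (du (fun t u => (X t u : ℂ).re) t u ^ 2 + du (fun t u => (X t u : ℂ).im) t u ^ 2) +
        du (fun t u => (X t u : ℂ).re) t u / (X t u : ℂ).im) := by
  have hd := SmoothFlow.hasDerivAt_du h.smooth_velocity ht u
  have e1 : (du (fun t => velocity (X t)) t u).re = du (du (fun t u => (X t u : ℂ).re)) t u := by
    rw [← (hasDerivAt_re hd).deriv]
    exact congrArg (fun f => deriv f u) (funext fun v => h.velocity_re ht v)
  have e2 : (du (fun t => velocity (X t)) t u).im = du (du (fun t u => (X t u : ℂ).im)) t u := by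
    rw [← (hasDerivAt_im hd).deriv]
    exact congrArg (fun f => deriv f u) (funext fun v => h.velocity_im ht v)
  rw [h.curvature_mul_speed ht u, e1, e2, h.velocity_re ht, h.velocity_im ht]
  rfl

end IsGlobalFlow

/-- The logarithmic derivative of `√(a² + b²) / y`. -/
lemma hasDerivAt_sqrt_div {a b y : ℝ → ℝ} {a' b' y' t : ℝ} (ha : HasDerivAt a a' t)
    (hb : HasDerivAt b b' t) (hy : HasDerivAt y y' t) (hq : 0 < a t ^ 2 + b t ^ 2)
    (hy0 : 0 < y t) :
    HasDerivAt (fun τ => √(a τ ^ 2 + b τ ^ 2) / y τ)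
      (√(a t ^ 2 + b t ^ 2) / y t *
        ((a t * a' + b t * b') / (a t ^ 2 + b t ^ 2) - y' / y t)) t := by
  have h1 : HasDerivAt (fun τ => a τ ^ 2 + b τ ^ 2) (2 * (a t * a' + b t * b')) t := by
    refine ((ha.pow 2).add (hb.pow 2)).congr_deriv ?_
    norm_num
    ring
  refine ((h1.sqrt hq.ne').div hy hy0.ne').congr_deriv ?_
  have hs : √(a t ^ 2 + b t ^ 2) ^ 2 = a t ^ 2 + b t ^ 2 := Real.sq_sqrt hq.le
  have hs0 : 0 < √(a t ^ 2 + b t ^ 2) := Real.sqrt_pos.2 hq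
  set s := √(a t ^ 2 + b t ^ 2)
  rw [← hs]
  field_simp

/-- The algebraic identity behind the evolution of the curvature. -/
lemma curvature_evolution_identity {s a b a1 b1 a2 b2 y f f1 f2 : ℝ} (hs : s ^ 2 = 1)
    (hq : a ^ 2 + b ^ 2 ≠ 0) (hy : y ≠ 0) :
    s * ((((-(s * (f1 * b + f * b1))) * b1 + a * (s * (f2 * a + f1 * a1 + (f1 * a1 + f * a2))) -
        (s * (f1 * a + f * a1) * a1 + b * (-(s * (f2 * b + f1 * b1 + (f1 * b1 + f * b2)))))) *
        (a ^ 2 + b ^ 2) - (a * b1 - b * a1) *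
        (2 * (a * (-(s * (f1 * b + f * b1))) + b * (s * (f1 * a + f * a1))))) /
        (a ^ 2 + b ^ 2) ^ 2 +
      ((-(s * (f1 * b + f * b1))) * y - a * (s * f * a)) / y ^ 2) =
    f2 + (f1 * ((a * a1 + b * b1) / (a ^ 2 + b ^ 2) - b / y) +
      f * (((a1 * a1 + a * a2 + (b1 * b1 + b * b2)) * (a ^ 2 + b ^ 2) -
        (a * a1 + b * b1) * (2 * (a * a1 + b * b1))) / (a ^ 2 + b ^ 2) ^ 2 -
        (b1 * y - b * b) / y ^ 2)) - f * (a ^ 2 + b ^ 2) / y ^ 2 := by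
  -- Every term on the left is of second order in the sign s, which therefore enters only through s²
  -- = 1.
  have e : s * ((((-(s * (f1 * b + f * b1))) * b1 +
        a * (s * (f2 * a + f1 * a1 + (f1 * a1 + f * a2))) -
        (s * (f1 * a + f * a1) * a1 + b * (-(s * (f2 * b + f1 * b1 + (f1 * b1 + f * b2)))))) *
        (a ^ 2 + b ^ 2) - (a * b1 - b * a1) *
        (2 * (a * (-(s * (f1 * b + f * b1))) + b * (s * (f1 * a + f * a1))))) /
        (a ^ 2 + b ^ 2) ^ 2 +
      ((-(s * (f1 * b + f * b1))) * y - a * (s * f * a)) / y ^ 2) = s ^ 2 *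
      ((((-((f1 * b + f * b1))) * b1 + a * ((f2 * a + f1 * a1 + (f1 * a1 + f * a2))) -
        ((f1 * a + f * a1) * a1 + b * (-((f2 * b + f1 * b1 + (f1 * b1 + f * b2)))))) *
        (a ^ 2 + b ^ 2) - (a * b1 - b * a1) *
        (2 * (a * (-((f1 * b + f * b1))) + b * ((f1 * a + f * a1))))) /
        (a ^ 2 + b ^ 2) ^ 2 +
      ((-((f1 * b + f * b1))) * y - a * (f * a)) / y ^ 2) := by ring
  rw [e, hs]
  field_simp
  ring

namespace IsGlobalFlow

/-- The evolution equations of speed and curvature. -/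
lemma evolution_speed_curvature (h : IsGlobalFlow k σ α X₀ X) (hσ : σ = 1 ∨ σ = -1)
    (hpos : ∀ t, 0 ≤ t → ∀ u, 0 < curvature σ (X t) u) {t : ℝ} (ht : 0 < t) (u : ℝ) :
    HasDerivAt (fun τ => speed (X τ) u) (-(curvature σ (X t) u *
      (phi σ α (X t) k - curvature σ (X t) u ^ α) * speed (X t) u)) t ∧
    HasDerivAt (fun τ => curvature σ (X τ) u)
      (-(deriv (fun v => deriv (fun z => curvature σ (X t) z ^ α) v / speed (X t) v) u /
        speed (X t) u) +
        (curvature σ (X t) u ^ 2 - 1) * (phi σ α (X t) k - curvature σ (X t) u ^ α)) t := by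
  have hσ2 : σ ^ 2 = 1 := by rcases hσ with rfl | rfl <;> norm_num
  set x : ℝ → ℝ → ℝ := fun t u => (X t u : ℂ).re with hx
  set y : ℝ → ℝ → ℝ := fun t u => (X t u : ℂ).im with hy
  have sx : SmoothFlow x := h.smooth_re
  have sy : SmoothFlow y := h.smooth_im
  set f := rate k σ α X t with hf
  have cf : ContDiff ℝ ∞ f := h.contDiff_rate hpos ht.le
  have df : ∀ v, HasDerivAt f (deriv f v) v := fun v =>
    (cf.differentiable (by simp) v).hasDerivAt
  have df' : ∀ v, HasDerivAt (deriv f) (deriv (deriv f) v) v := fun v =>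
    ((contDiff_infty_iff_deriv.1 cf).2.differentiable (by simp) v).hasDerivAt
  have da : ∀ v, HasDerivAt (du x t) (du (du x) t v) v := sx.du.hasDerivAt_du ht.le
  have db : ∀ v, HasDerivAt (du y t) (du (du y) t v) v := sy.du.hasDerivAt_du ht.le
  have da' : ∀ v, HasDerivAt (du (du x) t) (du (du (du x)) t v) v :=
    sx.du.du.hasDerivAt_du ht.le
  have db' : ∀ v, HasDerivAt (du (du y) t) (du (du (du y)) t v) v :=
    sy.du.du.hasDerivAt_du ht.le
  have dy : ∀ v, HasDerivAt (y t) (du y t v) v := sy.hasDerivAt_du ht.le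
  have hq : ∀ τ, 0 ≤ τ → ∀ v, 0 < du x τ v ^ 2 + du y τ v ^ 2 := fun τ hτ v => by
    rw [← h.velocity_re hτ, ← h.velocity_im hτ]
    exact normSq_velocity_pos (h.regular τ hτ v)
  have hy0 : ∀ τ v, 0 < y τ v := fun τ v => (X τ v).im_pos
  have hg0 : ∀ v, 0 < speed (X t) v := fun v => HypFlow.speed_pos (h.regular t ht.le v)
  have hft : ∀ v, f v * speed (X t) v = phi σ α (X t) k - curvature σ (X t) v ^ α := fun v => by
    rw [hf, rate, div_mul_cancel₀ _ (hg0 v).ne']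
  -- time derivatives of the coordinates of the velocity
  have yt : HasDerivAt (fun τ => y τ u) (σ * f u * du x t u) t := by
    have := sy.hasDerivAt_dt ht u
    rwa [h.dt_im ht] at this
  have at1 : ∀ v, du (dt x) t v = -(σ * (deriv f v * du y t v + f v * du (du y) t v)) := by
    intro v
    have : HasDerivAt (dt x t) (-(σ * (deriv f v * du y t v + f v * du (du y) t v))) v := by
      rw [h.dt_re ht]
      exact ((((df v).const_mul σ).mul (db v)).neg).congr_deriv (by ring)
    exact this.deriv
  have bt1 : ∀ v, du (dt y) t v = σ * (deriv f v * du x t v + f v * du (du x) t v) := by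
    intro v
    have : HasDerivAt (dt y t) (σ * (deriv f v * du x t v + f v * du (du x) t v)) v := by
      rw [h.dt_im ht]
      exact (((df v).const_mul σ).mul (da v)).congr_deriv (by ring)
    exact this.deriv
  have at' : HasDerivAt (fun τ => du x τ u)
      (-(σ * (deriv f u * du y t u + f u * du (du y) t u))) t := by
    rw [← at1]; exact sx.hasDerivAt_du_time ht u
  have bt' : HasDerivAt (fun τ => du y τ u)
      (σ * (deriv f u * du x t u + f u * du (du x) t u)) t := by
    rw [← bt1]; exact sy.hasDerivAt_du_time ht u
  have at2 : HasDerivAt (fun τ => du (du x) τ u)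
      (-(σ * (deriv (deriv f) u * du y t u + deriv f u * du (du y) t u +
        (deriv f u * du (du y) t u + f u * du (du (du y)) t u)))) t := by
    have h1 := sx.du.hasDerivAt_du_time ht u
    have h2 : du (dt (du x)) t u = -(σ * (deriv (deriv f) u * du y t u +
        deriv f u * du (du y) t u +
        (deriv f u * du (du y) t u + f u * du (du (du y)) t u))) := by
      have : HasDerivAt (dt (du x) t) (-(σ * (deriv (deriv f) u * du y t u +
          deriv f u * du (du y) t u +
          (deriv f u * du (du y) t u + f u * du (du (du y)) t u)))) u := by
        rw [sx.dt_du ht, funext at1]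
        exact (((((df' u).mul (db u)).add ((df u).mul (db' u))).const_mul σ).neg)
      exact this.deriv
    rwa [h2] at h1
  have bt2 : HasDerivAt (fun τ => du (du y) τ u)
      (σ * (deriv (deriv f) u * du x t u + deriv f u * du (du x) t u +
        (deriv f u * du (du x) t u + f u * du (du (du x)) t u))) t := by
    have h1 := sy.du.hasDerivAt_du_time ht u
    have h2 : du (dt (du y)) t u = σ * (deriv (deriv f) u * du x t u +
        deriv f u * du (du x) t u +
        (deriv f u * du (du x) t u + f u * du (du (du x)) t u)) := by
      have : HasDerivAt (dt (du y) t) (σ * (deriv (deriv f) u * du x t u +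
          deriv f u * du (du x) t u +
          (deriv f u * du (du x) t u + f u * du (du (du x)) t u))) u := by
        rw [sy.dt_du ht, funext bt1]
        exact ((((df' u).mul (da u)).add ((df u).mul (da' u))).const_mul σ)
      exact this.deriv
    rwa [h2] at h1
  have hm : ∀ τ, 0 ≤ τ → curvature σ (X τ) u * speed (X τ) u =
      σ * ((du x τ u * du (du y) τ u - du y τ u * du (du x) τ u) /
        (du x τ u ^ 2 + du y τ u ^ 2) + du x τ u / y τ u) := fun τ hτ =>
    h.curvature_mul_speed' hτ u
  have hqt : HasDerivAt (fun τ => du x τ u ^ 2 + du y τ u ^ 2)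
      (2 * (du x t u * (-(σ * (deriv f u * du y t u + f u * du (du y) t u))) +
        du y t u * (σ * (deriv f u * du x t u + f u * du (du x) t u)))) t := by
    refine ((at'.pow 2).add (bt'.pow 2)).congr_deriv ?_
    norm_num
    ring
  have hmt := ((((at'.mul bt2).sub (bt'.mul at2)).div hqt (hq t ht.le u).ne').add
    (at'.div yt (hy0 t u).ne')).const_mul σ
  have hgt := hasDerivAt_sqrt_div at' bt' yt (hq t ht.le u) (hy0 t u)
  have hnear : ∀ᶠ τ in 𝓝 t, 0 ≤ τ := by
    filter_upwards [Ioi_mem_nhds ht] with τ hτ using le_of_lt hτ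
  -- speed
  have hspeed : HasDerivAt (fun τ => speed (X τ) u)
      (-(curvature σ (X t) u * f u * speed (X t) u * speed (X t) u)) t := by
    have e : (fun τ => speed (X τ) u) =ᶠ[𝓝 t]
        fun τ => √(du x τ u ^ 2 + du y τ u ^ 2) / y τ u :=
      hnear.mono fun τ hτ => h.speed_eq hτ u
    refine (hgt.congr_of_eventuallyEq e).congr_deriv ?_
    have e2 : curvature σ (X t) u * f u * speed (X t) u * speed (X t) u =
      (curvature σ (X t) u * speed (X t) u) * f u * speed (X t) u := by ring
    rw [e2, hm t ht.le, ← h.speed_eq ht.le u]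
    have := (hq t ht.le u).ne'
    have := (hy0 t u).ne'
    field_simp
    ring
  refine ⟨hspeed.congr_deriv (by rw [← hft]; ring), ?_⟩
  -- curvature
  have hcurv : HasDerivAt (fun τ => curvature σ (X τ) u * speed (X τ) u) _ t :=
    hmt.congr_of_eventuallyEq (hnear.mono fun τ hτ => hm τ hτ)
  -- With f = F/g this says (κg)_t = (F_u/g)_u - Fg; the last term carries the Gaussian curvature
  -- -1.
  have hid := curvature_evolution_identity (f := f u) (f1 := deriv f u) (f2 := deriv (deriv f) u)
    (a2 := du (du (du x)) t u) (b2 := du (du (du y)) t u) (a1 := du (du x) t u)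
    (b1 := du (du y) t u) hσ2 (hq t ht.le u).ne' (hy0 t u).ne'
  -- the flux in the parameter
  have dspeed : ∀ v, HasDerivAt (speed (X t)) (speed (X t) v *
      ((du x t v * du (du x) t v + du y t v * du (du y) t v) / (du x t v ^ 2 + du y t v ^ 2) -
        du y t v / y t v)) v := fun v => by
    have e := hasDerivAt_sqrt_div (da v) (db v) (dy v) (hq t ht.le v) (hy0 t v)
    rw [← h.speed_eq ht.le v] at e
    exact e.congr_of_eventuallyEq (Filter.Eventually.of_forall fun w => h.speed_eq ht.le w)
  have hflux : ∀ v, deriv (fun z => curvature σ (X t) z ^ α) v / speed (X t) v =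
      -(deriv f v + f v * ((du x t v * du (du x) t v + du y t v * du (du y) t v) /
        (du x t v ^ 2 + du y t v ^ 2) - du y t v / y t v)) := fun v => by
    have e : (fun z => curvature σ (X t) z ^ α) =
        fun z => phi σ α (X t) k - f z * speed (X t) z := by
      funext z; rw [hft]; ring
    have e' : HasDerivAt (fun z => phi σ α (X t) k - f z * speed (X t) z) _ v :=
      ((df v).mul (dspeed v)).const_sub _
    rw [e, e'.deriv]
    have := (hg0 v).ne'
    field_simp
  have hdq : HasDerivAt (fun v => du x t v ^ 2 + du y t v ^ 2)
      (2 * (du x t u * du (du x) t u + du y t u * du (du y) t u)) u := by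
    refine (((da u).pow 2).add ((db u).pow 2)).congr_deriv ?_
    norm_num
    ring
  have hdflux := (((df' u).add ((df u).mul (((((da u).mul (da' u)).add
    ((db u).mul (db' u))).div hdq (hq t ht.le u).ne').sub
    ((db u).div (dy u) (hy0 t u).ne')))).neg)
  have hdflux' := (hdflux.congr_of_eventuallyEq (Filter.Eventually.of_forall hflux)).deriv
  have hquot := hcurv.div hspeed (hg0 u).ne'
  have e3 : (fun τ => curvature σ (X τ) u) =ᶠ[𝓝 t]
      fun τ => curvature σ (X τ) u * speed (X τ) u / speed (X τ) u := by
    filter_upwards [hnear] with τ hτ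
    rw [mul_div_cancel_right₀ _ (HypFlow.speed_pos (h.regular τ hτ u)).ne']
  refine (hquot.congr_of_eventuallyEq e3).congr_deriv ?_
  rw [hdflux']
  have hsq : (speed (X t) u * y t u) ^ 2 = du x t u ^ 2 + du y t u ^ 2 := by
    rw [← h.velocity_re ht.le, ← h.velocity_im ht.le]
    exact speed_sq_mul
  rw [← hft u]
  have hsq' : f u * (du x t u ^ 2 + du y t u ^ 2) / y t u ^ 2 = f u * speed (X t) u ^ 2 := by
    rw [← hsq]
    have := (hy0 t u).ne'
    field_simp
  rw [hsq'] at hid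
  simp only [Pi.mul_apply, Pi.add_apply, Pi.sub_apply, Pi.div_apply] at hid ⊢
  rw [hid]
  have := (hg0 u).ne'
  generalize hQ : deriv (deriv f) u + _ = Q
  field_simp
  ring

end IsGlobalFlow

end Flow

/-! ### Reduction to the system; the area functional -/

section Flow

variable {k : Kind} {σ α : ℝ} {X₀ : ℝ → ℍ} {X : ℝ → ℝ → ℍ}

/-- The weight of the average `φ`. -/
def Kind.weight (κ : ℝ → ℝ → ℝ) : Kind → ℝ → ℝ → ℝ
  | .areaPreserving => fun _ _ => 1
  | .lengthPreserving => κ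

namespace IsGlobalFlow

/-- The later estimates need only this system and the area functional; the position of the curve can
be forgotten. -/
lemma normalFlow (h : IsGlobalFlow k σ α X₀ X) (hσ : σ = 1 ∨ σ = -1)
    (hpos : ∀ t, 0 ≤ t → ∀ u, 0 < curvature σ (X t) u) :
    NormalFlow α (k.weight fun t => curvature σ (X t)) (fun t => curvature σ (X t))
      (fun t => speed (X t)) (fun t => phi σ α (X t) k) where
  smooth_curv := h.smooth_curvature
  smooth_speed := h.smooth_speed
  periodic_curv := fun _ => h.periodic_curvature
  periodic_speed := fun _ => h.periodic_speed
  curv_pos := hpos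
  speed_pos := fun t ht u => HypFlow.speed_pos (h.regular t ht u)
  weight := by
    cases k
    · exact Or.inl rfl
    · exact Or.inr rfl
  average := by
    intro t ht
    have hg : ∀ u, 0 < speed (X t) u := fun u => HypFlow.speed_pos (h.regular t ht u)
    have cg : Continuous (speed (X t)) := h.smooth_speed.continuous_slice ht
    have cκ : Continuous (curvature σ (X t)) := h.smooth_curvature.continuous_slice ht
    cases k
    · have : 0 < length (X t) :=
        intervalIntegral.intervalIntegral_pos_of_pos (by
          simp only [one_mul]
          exact cg.intervalIntegrable _ _) (fun u => by simpa using hg u) two_pi_pos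
      have e : ∫ u in (0 : ℝ)..(2 * Real.pi), speed (X t) u = length (X t) := by
        simp only [length, arcIntegral, one_mul]
      simp only [phi, Kind.weight, e, arcIntegral, one_mul]
      rw [div_mul_eq_mul_div, one_mul, div_mul_cancel₀ _ this.ne']
    · have : 0 < arcIntegral (X t) (curvature σ (X t)) :=
        intervalIntegral.intervalIntegral_pos_of_pos
          ((cκ.mul cg).intervalIntegrable _ _) (fun u => mul_pos (hpos t ht u) (hg u)) two_pi_pos
      have e : ∫ u in (0 : ℝ)..(2 * Real.pi), curvature σ (X t) u * speed (X t) u =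
        arcIntegral (X t) (curvature σ (X t)) := rfl
      simp only [phi, Kind.weight, e]
      rw [div_mul_eq_mul_div, one_mul, div_mul_cancel₀ _ this.ne']
      refine intervalIntegral.integral_congr fun u _ => ?_
      simp only [Real.rpow_add_one (hpos t ht u).ne']
      ring
  speed_evolution := fun _ ht u => (h.evolution_speed_curvature hσ hpos ht u).1
  curv_evolution := fun _ ht u => (h.evolution_speed_curvature hσ hpos ht u).2

/-- The enclosed area `± ∫ dx / y` and its first variation. -/
lemma exists_area_functional (h : IsGlobalFlow k σ α X₀ X) (hσ : σ = 1 ∨ σ = -1)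
    (hpos : ∀ t, 0 ≤ t → ∀ u, 0 < curvature σ (X t) u) :
    ∃ A : ℝ → ℝ, ContinuousOn A (Set.Ici 0) ∧
      (∀ t, 0 < t → HasDerivAt A (-∫ u in (0 : ℝ)..(2 * Real.pi),
        (phi σ α (X t) k - curvature σ (X t) u ^ α) * speed (X t) u) t) ∧
      ∀ t, 0 ≤ t → A t ≤ ∫ u in (0 : ℝ)..(2 * Real.pi), speed (X t) u := by
  have hσ2 : σ ^ 2 = 1 := by rcases hσ with rfl | rfl <;> norm_num
  have hσ1 : |σ| = 1 := by rcases hσ with rfl | rfl <;> norm_num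
  set x : ℝ → ℝ → ℝ := fun t u => (X t u : ℂ).re with hx
  set y : ℝ → ℝ → ℝ := fun t u => (X t u : ℂ).im with hy
  have sx : SmoothFlow x := h.smooth_re
  have sy : SmoothFlow y := h.smooth_im
  have hy0 : ∀ τ v, 0 < y τ v := fun τ v => (X τ v).im_pos
  -- As d(dx/y) = dx∧dy/y², Stokes' theorem suggests σ∮dx/y as the enclosed area. Only its variation
  -- -∫F ds and the bound |dx/y| ≤ ds matter, so it need not be identified with the area.
  set θ : ℝ → ℝ → ℝ := fun t u => σ * (du x t u / y t u) with hθ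
  have sθ : SmoothFlow θ :=
    contDiffOn_const.mul (ContDiffOn.div sx.du sy (fun p _ => (hy0 p.1 p.2).ne'))
  have cont : ∀ t, 0 ≤ t → Continuous (speed (X t)) := fun t ht =>
    h.smooth_speed.continuous_slice ht
  refine ⟨fun t => ∫ u in (0 : ℝ)..(2 * Real.pi), θ t u, sθ.continuousOn_integral _ _,
    fun t ht => (sθ.hasDerivAt_integral two_pi_pos.le ht).congr_deriv ?_, fun t ht => ?_⟩
  · set f := rate k σ α X t with hf
    have cf : ContDiff ℝ ∞ f := h.contDiff_rate hpos ht.le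
    have hg0 : ∀ v, 0 < speed (X t) v := fun v => HypFlow.speed_pos (h.regular t ht.le v)
    have hft : ∀ v, (phi σ α (X t) k - curvature σ (X t) v ^ α) = f v * speed (X t) v :=
      fun v => by rw [hf, rate, div_mul_cancel₀ _ (hg0 v).ne']
    have hperf : Function.Periodic f (2 * Real.pi) := fun u => by
      simp only [hf, rate, h.periodic_curvature ht.le u, h.periodic_speed ht.le u]
    have pery : Function.Periodic (y t) (2 * Real.pi) := fun u =>
      congrArg Complex.im (h.periodic_coe ht.le u)
    -- the exact part of the variation
    have cp : ContDiff ℝ ∞ (fun u => f u * du y t u / y t u) :=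
      (cf.mul (sy.du.slice ht.le)).div (sy.slice ht.le) (fun u => (hy0 t u).ne')
    have hp : ∀ u, HasDerivAt (fun u => f u * du y t u / y t u)
        (deriv (fun u => f u * du y t u / y t u) u) u := fun u =>
      (cp.differentiable (by simp) u).hasDerivAt
    have hzero : ∫ u in (0 : ℝ)..(2 * Real.pi), deriv (fun u => f u * du y t u / y t u) u = 0 :=
      integral_deriv_of_periodic hp (cp.continuous_deriv (by simp)) (fun u => by
        simp only [hperf u, periodic_du pery u, pery u])
    have hdt : ∀ u, dt θ t u = -deriv (fun u => f u * du y t u / y t u) u -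
        (phi σ α (X t) k - curvature σ (X t) u ^ α) * speed (X t) u := fun u => by
      have df : HasDerivAt f (deriv f u) u := (cf.differentiable (by simp) u).hasDerivAt
      have db := sy.du.hasDerivAt_du ht.le u
      have dy := sy.hasDerivAt_du ht.le u
      have at1 : du (dt x) t u = -(σ * (deriv f u * du y t u + f u * du (du y) t u)) := by
        have : HasDerivAt (dt x t) (-(σ * (deriv f u * du y t u + f u * du (du y) t u))) u := by
          rw [h.dt_re ht]
          exact (((df.const_mul σ).mul db).neg).congr_deriv (by ring)
        exact this.deriv
      have yt : HasDerivAt (fun τ => y τ u) (σ * f u * du x t u) t := by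
        have := sy.hasDerivAt_dt ht u
        rwa [h.dt_im ht] at this
      have e1 : HasDerivAt (fun τ => θ τ u) _ t :=
        ((sx.hasDerivAt_du_time ht u).div yt (hy0 t u).ne').const_mul σ
      have e2 : HasDerivAt (fun u => f u * du y t u / y t u) _ u :=
        (df.mul db).div dy (hy0 t u).ne'
      have hsq : (speed (X t) u * y t u) ^ 2 = du x t u ^ 2 + du y t u ^ 2 := by
        rw [← h.velocity_re ht.le, ← h.velocity_im ht.le]
        exact speed_sq_mul
      have e3 : (phi σ α (X t) k - curvature σ (X t) u ^ α) * speed (X t) u =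
          f u * (du x t u ^ 2 + du y t u ^ 2) / y t u ^ 2 := by
        rw [hft, ← hsq]
        have := (hy0 t u).ne'
        field_simp
      rw [e3, e2.deriv, dt, e1.deriv, at1]
      simp only [Pi.mul_apply]
      have := (hy0 t u).ne'
      field_simp
      ring_nf
      simp only [hσ2]
      ring
    rw [intervalIntegral.integral_congr (fun u _ => hdt u), intervalIntegral.integral_sub,
      intervalIntegral.integral_neg, hzero]
    · ring
    · exact ((cp.continuous_deriv (by simp)).neg).intervalIntegrable _ _
    · simp only [hft]
      exact ((cf.continuous.mul (cont t ht.le)).mul (cont t ht.le)).intervalIntegrable _ _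
  · refine intervalIntegral.integral_mono_on two_pi_pos.le
      ((sθ.continuous_slice ht).intervalIntegrable _ _)
      ((cont t ht).intervalIntegrable _ _) (fun u _ => ?_)
    refine (le_abs_self _).trans ?_
    rw [hθ, abs_mul, hσ1, one_mul, abs_div, abs_of_pos (hy0 t u), ← h.velocity_re ht, speed]
    exact div_le_div_of_nonneg_right (Complex.abs_re_le_norm _) (hy0 t u).le

end IsGlobalFlow

end Flow

/-! ### Inequalities for powers; the second derivative at an extremum -/

/-- Bernoulli's inequality, homogeneous form. -/
lemma rpow_sub_le_mul {p U V : ℝ} (hp : 1 ≤ p) (hU : 0 < U) (hUV : U ≤ V) :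
    V ^ p - U ^ p ≤ p * V ^ (p - 1) * (V - U) := by
  have hV : 0 < V := hU.trans_le hUV
  have h := one_add_mul_self_le_rpow_one_add (s := U / V - 1) (by
    have : 0 < U / V := by positivity
    linarith) hp
  rw [add_sub_cancel, Real.div_rpow hU.le hV.le] at h
  have hVp : 0 < V ^ p := by positivity
  have e : V ^ (p - 1) = V ^ p / V := Real.rpow_sub_one hV.ne' p
  rw [le_div_iff₀ hVp] at h
  rw [e]
  have : p * (V ^ p / V) * (V - U) = -(p * (U / V - 1)) * V ^ p := by field_simp; ring
  rw [this]; linarith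

/-- With x = U/V in (0,1] this reads min(1,b)(1-x) ≤ 1 - x^b: for b ≥ 1 because x^b ≤ x, for b ≤ 1
by Bernoulli's inequality. -/
lemma mul_sub_le_rpow_sub {b U V : ℝ} (hb : 0 < b) (hU : 0 < U) (hUV : U ≤ V) :
    min 1 b * V ^ (b - 1) * (V - U) ≤ V ^ b - U ^ b := by
  have hV : 0 < V := hU.trans_le hUV
  have hVp : 0 < V ^ b := by positivity
  have hx : 0 < U / V := by positivity
  have hx1 : U / V ≤ 1 := (div_le_one hV).2 hUV
  have key : (U / V) ^ b ≤ 1 - min 1 b * (1 - U / V) := by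
    rcases le_total 1 b with h | h
    · rw [min_eq_left h]
      have := Real.rpow_le_rpow_of_exponent_ge hx hx1 h
      rw [Real.rpow_one] at this
      linarith
    · rw [min_eq_right h]
      have := rpow_one_add_le_one_add_mul_self (s := U / V - 1) (by linarith) hb.le h
      rw [add_sub_cancel] at this
      linarith
  rw [Real.div_rpow hU.le hV.le, div_le_iff₀ hVp] at key
  have : min 1 b * V ^ (b - 1) * (V - U) = min 1 b * (1 - U / V) * V ^ b := by
    rw [Real.rpow_sub_one hV.ne']; field_simp
  rw [this]; linarith

/-- Up to constants, the left side is at most (V^(b/2)(V-U))² and the product on the right at least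
V^(b-1)(V-U)². They differ by one factor V ≤ M. -/
lemma sq_rpow_sub_le {b M U V : ℝ} (hb : 0 < b) (hU : 0 < U) (hV : 0 < V) (hUM : U ≤ M)
    (hVM : V ≤ M) :
    (V ^ (b / 2 + 1) - U ^ (b / 2 + 1)) ^ 2 ≤
      (b / 2 + 1) ^ 2 * M / min 1 b * ((V ^ b - U ^ b) * (V - U)) := by
  wlog hUV : U ≤ V generalizing U V
  · have := this hV hU hVM hUM (le_of_not_ge hUV)
    calc _ = (U ^ (b / 2 + 1) - V ^ (b / 2 + 1)) ^ 2 := by ring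
      _ ≤ _ := this
      _ = _ := by ring
  have hm : 0 < min 1 b := lt_min one_pos hb
  have h1 := rpow_sub_le_mul (p := b / 2 + 1) (by linarith) hU hUV
  have h2 := mul_sub_le_rpow_sub hb hU hUV
  have h0 : 0 ≤ V ^ (b / 2 + 1) - U ^ (b / 2 + 1) :=
    sub_nonneg.2 (Real.rpow_le_rpow hU.le hUV (by linarith))
  have hd : 0 ≤ V - U := sub_nonneg.2 hUV
  rw [add_sub_cancel_right] at h1
  have e : V ^ (b - 1) * V = V ^ (b / 2) * V ^ (b / 2) := by
    rw [← Real.rpow_add hV, ← Real.rpow_add_one hV.ne']; congr 1; ring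
  have hVb : 0 < V ^ (b - 1) := by positivity
  have hM : 0 < M := hU.trans_le hUM
  calc (V ^ (b / 2 + 1) - U ^ (b / 2 + 1)) ^ 2
      ≤ ((b / 2 + 1) * V ^ (b / 2) * (V - U)) ^ 2 := pow_le_pow_left₀ h0 h1 2
    _ = (b / 2 + 1) ^ 2 * V / min 1 b * (min 1 b * V ^ (b - 1) * (V - U) * (V - U)) := by
        have : (b / 2 + 1) ^ 2 * V / min 1 b * (min 1 b * V ^ (b - 1) * (V - U) * (V - U)) =
          (b / 2 + 1) ^ 2 * (V ^ (b - 1) * V) * (V - U) ^ 2 := by field_simp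
        rw [this, e]; ring
    _ ≤ (b / 2 + 1) ^ 2 * M / min 1 b * ((V ^ b - U ^ b) * (V - U)) := by
        gcongr

/-- At a maximum the weighted second derivative is nonpositive. -/
lemma deriv_flux_nonpos_of_max {h g : ℝ → ℝ} (hh : ContDiff ℝ ∞ h) (hg : Differentiable ℝ g)
    {u : ℝ} (hgu : 0 < g u) (hmax : ∀ v, h v ≤ h u) :
    deriv (fun v => deriv h v / g v) u ≤ 0 := by
  have hmax' : IsLocalMax h u := Filter.Eventually.of_forall hmax
  have h1 : deriv h u = 0 := hmax'.deriv_eq_zero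
  have hd : HasDerivAt (deriv h) (deriv (deriv h) u) u :=
    ((contDiff_infty_iff_deriv.1 hh).2.differentiable (by simp) u).hasDerivAt
  have e : HasDerivAt (fun v => deriv h v / g v) _ u := hd.div (hg u).hasDerivAt hgu.ne'
  rw [e.deriv, h1, zero_mul, sub_zero]
  -- Were it positive, u would also be a local minimum, so h would be locally constant and its
  -- second derivative zero.
  have h2 : deriv (deriv h) u ≤ 0 := by
    by_contra! hpos
    have hmin := isLocalMin_of_deriv_deriv_pos hpos h1 hh.continuous.continuousAt
    have hconst : h =ᶠ[𝓝 u] fun _ => h u := hmin.mono fun v hv => le_antisymm (hmax v) hv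
    have h3 : deriv h =ᶠ[𝓝 u] fun _ => 0 := by
      have := hconst.deriv
      simpa using this
    have h4 := h3.deriv_eq
    simp only [deriv_const] at h4
    linarith
  exact div_nonpos_of_nonpos_of_nonneg (mul_nonpos_of_nonpos_of_nonneg h2 hgu.le) (sq_nonneg _)

lemma deriv_flux_nonneg_of_min {h g : ℝ → ℝ} (hh : ContDiff ℝ ∞ h) (hg : Differentiable ℝ g)
    {u : ℝ} (hgu : 0 < g u) (hmin : ∀ v, h u ≤ h v) :
    0 ≤ deriv (fun v => deriv h v / g v) u := by
  have := deriv_flux_nonpos_of_max hh.neg hg hgu (fun v => neg_le_neg (hmin v))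
  have e : (fun v => deriv (fun w => -h w) v / g v) = fun v => -(deriv h v / g v) := by
    funext v; rw [deriv.fun_neg, neg_div]
  rw [e, deriv.fun_neg] at this
  linarith

/-! ### Maximum principle bounds for the system -/

namespace NormalFlow

variable {α : ℝ} {ρ κ g : ℝ → ℝ → ℝ} {φ : ℝ → ℝ}

lemma smooth_rpow (N : NormalFlow α ρ κ g φ) (r : ℝ) : SmoothFlow (fun t u => κ t u ^ r) :=
  ContDiffOn.rpow_const_of_ne N.smooth_curv (fun p hp => (N.curv_pos p.1 hp.1 p.2).ne')

lemma periodic_rpow (N : NormalFlow α ρ κ g φ) (r : ℝ) {t : ℝ} (ht : 0 ≤ t) :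
    Function.Periodic (fun u => κ t u ^ r) (2 * Real.pi) := fun u => by
  simp only [N.periodic_curv t ht u]

lemma continuous_curv (N : NormalFlow α ρ κ g φ) {t : ℝ} (ht : 0 ≤ t) : Continuous (κ t) :=
  N.smooth_curv.continuous_slice ht

lemma continuous_speed (N : NormalFlow α ρ κ g φ) {t : ℝ} (ht : 0 ≤ t) : Continuous (g t) :=
  N.smooth_speed.continuous_slice ht

lemma continuous_rpow (N : NormalFlow α ρ κ g φ) (r : ℝ) {t : ℝ} (ht : 0 ≤ t) :
    Continuous (fun u => κ t u ^ r) :=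
  (N.smooth_rpow r).continuous_slice ht

lemma weight_pos (N : NormalFlow α ρ κ g φ) {t : ℝ} (ht : 0 ≤ t) (u : ℝ) : 0 < ρ t u := by
  rcases N.weight with rfl | rfl
  · exact one_pos
  · exact N.curv_pos t ht u

lemma continuous_weight (N : NormalFlow α ρ κ g φ) {t : ℝ} (ht : 0 ≤ t) : Continuous (ρ t) := by
  rcases N.weight with h | h
  · rw [h]; exact continuous_const
  · rw [h]; exact N.continuous_curv ht

/-- The normal velocity has weighted mean zero. -/
lemma integral_weight_velocity (N : NormalFlow α ρ κ g φ) {t : ℝ} (ht : 0 ≤ t) :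
    ∫ u in (0 : ℝ)..(2 * Real.pi), ρ t u * (φ t - κ t u ^ α) * g t u = 0 := by
  have c1 : Continuous fun u => ρ t u * g t u :=
    (N.continuous_weight ht).mul (N.continuous_speed ht)
  have c2 : Continuous fun u => ρ t u * κ t u ^ α * g t u :=
    ((N.continuous_weight ht).mul (N.continuous_rpow α ht)).mul (N.continuous_speed ht)
  have e : ∀ u, ρ t u * (φ t - κ t u ^ α) * g t u =
      φ t * (ρ t u * g t u) - ρ t u * κ t u ^ α * g t u := fun u => by ring
  simp only [e]
  rw [intervalIntegral.integral_sub ((c1.const_mul _).intervalIntegrable _ _)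
    (c2.intervalIntegrable _ _), intervalIntegral.integral_const_mul, N.average t ht, sub_self]

/-- The average is attained. -/
lemma exists_rpow_eq_average (N : NormalFlow α ρ κ g φ) {t : ℝ} (ht : 0 ≤ t) :
    ∃ u, κ t u ^ α = φ t := by
  have h0 := N.integral_weight_velocity ht
  have hc : Continuous fun u => ρ t u * (φ t - κ t u ^ α) * g t u :=
    ((N.continuous_weight ht).mul (continuous_const.sub (N.continuous_rpow α ht))).mul
      (N.continuous_speed ht)
  have hw : ∀ u, 0 < ρ t u * g t u := fun u => mul_pos (N.weight_pos ht u) (N.speed_pos t ht u)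
  refine mem_range_of_exists_le_of_exists_ge (N.continuous_rpow α ht) ?_ ?_
  · by_contra! hlt
    have : 0 < ∫ u in (0 : ℝ)..(2 * Real.pi), -(ρ t u * (φ t - κ t u ^ α) * g t u) :=
      intervalIntegral.intervalIntegral_pos_of_pos (hc.neg.intervalIntegrable _ _)
        (fun u => by nlinarith [hw u, hlt u]) two_pi_pos
    rw [intervalIntegral.integral_neg, h0] at this
    linarith
  · by_contra! hlt
    have : 0 < ∫ u in (0 : ℝ)..(2 * Real.pi), (ρ t u * (φ t - κ t u ^ α) * g t u) :=
      intervalIntegral.intervalIntegral_pos_of_pos (hc.intervalIntegrable _ _)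
        (fun u => by nlinarith [hw u, hlt u]) two_pi_pos
    linarith

/-- The curvature stays bounded away from zero. -/
lemma exists_curv_ge (N : NormalFlow α ρ κ g φ) (hα : α < 0) :
    ∃ c, 0 < c ∧ c ≤ 1 ∧ ∀ t, 0 ≤ t → ∀ u, c ≤ κ t u := by
  obtain ⟨m, hm, hmin⟩ : ∃ m, 0 < m ∧ ∀ u, m ≤ κ 0 u := by
    obtain ⟨v, -, hv⟩ := (isCompact_Icc (a := (0 : ℝ)) (b := 2 * Real.pi)).exists_isMinOn
      ⟨0, le_rfl, two_pi_pos.le⟩ (N.continuous_curv le_rfl).continuousOn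
    refine ⟨κ 0 v, N.curv_pos 0 le_rfl v, fun u => ?_⟩
    obtain ⟨w, hw, huw⟩ := (N.periodic_curv 0 le_rfl).exists_mem_Ico₀ two_pi_pos u
    rw [huw]
    exact hv (Set.Ico_subset_Icc_self hw)
  -- At a spatial minimum of κ below 1 the curvature cannot decrease: κ^α is maximal, so F_ss ≥ 0
  -- and F ≤ 0, and κ² - 1 ≤ 0 makes the reaction term nonnegative. Hence the level min(1, m).
  refine ⟨min 1 m, lt_min one_pos hm, min_le_left _ _, fun t ht u => ?_⟩
  have := min_principle (f := κ) (c := 0) (ℓ := min 1 m) two_pi_pos ht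
    (N.smooth_curv.continuousOn.mono (Set.prod_mono (fun s hs => hs.1) le_rfl))
    (fun s hs => N.periodic_curv s hs.1) (fun v => (min_le_right _ _).trans (hmin v))
    (fun s hs v hv hlt => ⟨_, N.curv_evolution s hs.1 v, ?_⟩) le_rfl u
  · simpa using this
  have hs0 : 0 ≤ s := hs.1.le
  have hwmax : ∀ z, κ s z ^ α ≤ κ s v ^ α := fun z =>
    Real.rpow_le_rpow_of_nonpos (N.curv_pos s hs0 v) (hv z) hα.le
  have hJ := deriv_flux_nonpos_of_max ((N.smooth_rpow α).slice hs0)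
    ((N.smooth_speed.slice hs0).differentiable (by simp)) (N.speed_pos s hs0 v) hwmax
  obtain ⟨z, hz⟩ := N.exists_rpow_eq_average hs0
  have hφ : φ s - κ s v ^ α ≤ 0 := by rw [← hz]; linarith [hwmax z]
  have hκ1 : κ s v ^ 2 - 1 ≤ 0 := by
    have : κ s v < 1 := hlt.trans_le (min_le_left _ _)
    nlinarith [N.curv_pos s hs0 v]
  have hdiv := div_nonpos_of_nonpos_of_nonneg hJ (N.speed_pos s hs0 v).le
  have := mul_nonneg_of_nonpos_of_nonpos hκ1 hφ
  linarith

section Bounds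

variable {c : ℝ}

lemma average_pos (N : NormalFlow α ρ κ g φ) {t : ℝ} (ht : 0 ≤ t) : 0 < φ t := by
  obtain ⟨z, hz⟩ := N.exists_rpow_eq_average ht
  rw [← hz]; exact Real.rpow_pos_of_pos (N.curv_pos t ht z) _

lemma average_le (N : NormalFlow α ρ κ g φ) (hα : α < 0) (hc : 0 < c)
    (hκ : ∀ t, 0 ≤ t → ∀ u, c ≤ κ t u) {t : ℝ} (ht : 0 ≤ t) : φ t ≤ c ^ α := by
  obtain ⟨z, hz⟩ := N.exists_rpow_eq_average ht
  rw [← hz]; exact Real.rpow_le_rpow_of_nonpos hc (hκ t ht z) hα.le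

/-- The minimum of the radius of curvature decreases at a bounded rate. -/
lemma inv_curv_ge (N : NormalFlow α ρ κ g φ) (hα : α < 0) (hc : 0 < c)
    (hκ : ∀ t, 0 ≤ t → ∀ u, c ≤ κ t u) {a b ℓ : ℝ} (ha : 0 ≤ a) (hab : a ≤ b)
    (hℓ : ∀ u, ℓ ≤ (κ a u)⁻¹) (u : ℝ) : ℓ - c ^ α * (b - a) ≤ (κ b u)⁻¹ := by
  have sV : SmoothFlow (fun t u => (κ t u)⁻¹) :=
    ContDiffOn.inv N.smooth_curv (fun p hp => (N.curv_pos p.1 hp.1 p.2).ne')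
  refine min_principle (f := fun t u => (κ t u)⁻¹) two_pi_pos hab
    (sV.continuousOn.mono (Set.prod_mono (fun s hs => ha.trans hs.1) le_rfl))
    (fun s hs v => by simp only [N.periodic_curv s (ha.trans hs.1) v]) hℓ
    (fun s hs v hv _ => ?_) (by positivity) u
  have hs : 0 < s := ha.trans_lt hs.1
  have hk := N.curv_pos s hs.le v
  refine ⟨_, (N.curv_evolution s hs v).inv hk.ne', ?_⟩
  have hκmax : ∀ z, κ s z ≤ κ s v := fun z =>
    (inv_le_inv₀ hk (N.curv_pos s hs.le z)).1 (hv z)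
  have hwmin : ∀ z, κ s v ^ α ≤ κ s z ^ α := fun z =>
    Real.rpow_le_rpow_of_nonpos (N.curv_pos s hs.le z) (hκmax z) hα.le
  have hJ := deriv_flux_nonneg_of_min ((N.smooth_rpow α).slice hs.le)
    ((N.smooth_speed.slice hs.le).differentiable (by simp)) (N.speed_pos s hs.le v) hwmin
  obtain ⟨z, hz⟩ := N.exists_rpow_eq_average hs.le
  -- At a minimum of V the average exceeds κ^α, so 0 ≤ F ≤ c^α; there V_t ≥ -(1 - κ⁻²)F ≥ -F.
  have hF : 0 ≤ φ s - κ s v ^ α := by rw [← hz]; linarith [hwmin z]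
  have hF' : φ s - κ s v ^ α ≤ c ^ α := by
    linarith [N.average_le hα hc hκ hs.le, Real.rpow_pos_of_pos hk α]
  have hdiv := div_nonneg hJ (N.speed_pos s hs.le v).le
  rw [le_div_iff₀ (by positivity)]
  nlinarith [mul_nonneg (sq_nonneg (κ s v)) (sub_nonneg.2 hF')]

lemma hasDerivAt_length (N : NormalFlow α ρ κ g φ) {t : ℝ} (ht : 0 < t) :
    HasDerivAt (fun τ => ∫ u in (0 : ℝ)..(2 * Real.pi), g τ u)
      (-∫ u in (0 : ℝ)..(2 * Real.pi), κ t u * (φ t - κ t u ^ α) * g t u) t := by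
  refine (N.smooth_speed.hasDerivAt_integral two_pi_pos.le ht).congr_deriv ?_
  rw [← intervalIntegral.integral_neg]
  exact intervalIntegral.integral_congr fun u _ => (N.speed_evolution t ht u).deriv

/-- The pointwise dissipation dominates the oscillation of a power of the curvature. -/
lemma sq_rpow_sub_le_dissipation (hα : α < 0) (hc : 0 < c) {p q : ℝ}
    (hp : c ≤ p) (hq : c ≤ q) :
    (p ^ (α / 2 - 1) - q ^ (α / 2 - 1)) ^ 2 ≤
      (-α / 2 + 1) ^ 2 * c⁻¹ / min 1 (-α) * ((p ^ α - q ^ α) * (p⁻¹ - q⁻¹)) := by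
  have hp0 := hc.trans_le hp
  have hq0 := hc.trans_le hq
  -- Applied to the radii of curvature, which are at most 1/c, with b = -α.
  have h := sq_rpow_sub_le (b := -α) (M := c⁻¹) (U := q⁻¹) (V := p⁻¹) (by linarith)
    (inv_pos.2 hq0) (inv_pos.2 hp0) (inv_anti₀ hc hq) (inv_anti₀ hc hp)
  have e : ∀ r : ℝ, 0 < r → (r⁻¹ ^ (-α / 2 + 1) = r ^ (α / 2 - 1)) ∧ r⁻¹ ^ (-α) = r ^ α := by
    intro r hr
    rw [Real.inv_rpow hr.le, Real.inv_rpow hr.le, ← Real.rpow_neg hr.le, ← Real.rpow_neg hr.le]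
    constructor <;> congr 1 <;> ring
  rwa [(e p hp0).1, (e q hq0).1, (e p hp0).2, (e q hq0).2] at h

end Bounds

end NormalFlow

/-! ### Interpolation, dissipation and energy -/

/-- An interpolation inequality on a closed curve. -/
lemma sq_sub_le_of_periodic {f f' g : ℝ → ℝ} {P l : ℝ} (hP : 0 < P) (hl : 0 < l)
    (hf : ∀ u, HasDerivAt f (f' u) u) (cf' : Continuous f') (cg : Continuous g)
    (hg : ∀ u, 0 < g u) (pf : Function.Periodic f P) (pf' : Function.Periodic f' P)
    (pg : Function.Periodic g P) (x y : ℝ) :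
    (f x - f y) ^ 2 ≤ l⁻¹ * (∫ u in (0 : ℝ)..P, (f u - f y) ^ 2 * g u) +
      l * ∫ u in (0 : ℝ)..P, f' u ^ 2 / g u := by
  have cf : Continuous f := continuous_iff_continuousAt.2 fun u => (hf u).continuousAt
  -- (f - f y)² vanishes at y, so its value at x is the integral of its derivative over part of a
  -- period. The arithmetic-geometric mean inequality with weight l bounds that derivative.
  obtain ⟨z, hz, hxz⟩ := pf.exists_mem_Ico hP x y
  have c1 : Continuous fun u => (f u - f y) ^ 2 * g u := by fun_prop
  have c2 : Continuous fun u => f' u ^ 2 / g u := (cf'.pow 2).div cg fun u => (hg u).ne'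
  set b : ℝ → ℝ := fun u => l⁻¹ * ((f u - f y) ^ 2 * g u) + l * (f' u ^ 2 / g u) with hb
  have cb : Continuous b := (c1.const_mul _).add (c2.const_mul _)
  have hb0 : ∀ u, 0 ≤ b u := fun u => by have := hg u; positivity
  have pb : Function.Periodic b P := fun u => by simp only [hb, pf u, pf' u, pg u]
  have hd : ∀ u, HasDerivAt (fun u => (f u - f y) ^ 2) (2 * (f u - f y) * f' u) u := fun u => by
    refine (((hf u).sub_const (f y)).pow 2).congr_deriv ?_
    norm_num
  have hint : ∫ u in y..z, 2 * (f u - f y) * f' u = (f z - f y) ^ 2 := by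
    rw [intervalIntegral.integral_eq_sub_of_hasDerivAt (fun u _ => hd u)
      (Continuous.intervalIntegrable (by fun_prop) _ _)]
    ring
  have hpt : ∀ u, 2 * (f u - f y) * f' u ≤ b u := fun u => by
    have hgu := hg u
    have e : b u - 2 * (f u - f y) * f' u =
        l⁻¹ * g u * ((f u - f y) - l * f' u / g u) ^ 2 := by
      simp only [hb]; field_simp; ring
    have : 0 ≤ l⁻¹ * g u * ((f u - f y) - l * f' u / g u) ^ 2 := by positivity
    linarith
  calc (f x - f y) ^ 2 = ∫ u in y..z, 2 * (f u - f y) * f' u := by rw [hint, hxz]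
    _ ≤ ∫ u in y..z, b u := intervalIntegral.integral_mono_on hz.1
        (Continuous.intervalIntegrable (by fun_prop) _ _) (cb.intervalIntegrable _ _)
        (fun u _ => hpt u)
    _ ≤ ∫ u in y..(y + P), b u := intervalIntegral.integral_mono_interval le_rfl hz.1 hz.2.le
        (Filter.Eventually.of_forall hb0) (cb.intervalIntegrable _ _)
    _ = ∫ u in (0 : ℝ)..P, b u := by
        have := pb.intervalIntegral_add_eq y 0
        rwa [zero_add] at this
    _ = _ := by
        rw [intervalIntegral.integral_add ((c1.const_mul _).intervalIntegrable _ _)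
          ((c2.const_mul _).intervalIntegrable _ _), intervalIntegral.integral_const_mul,
          intervalIntegral.integral_const_mul]

namespace NormalFlow

variable {α c : ℝ} {ρ κ g : ℝ → ℝ → ℝ} {φ : ℝ → ℝ}

/-- The pointwise dissipation relative to the point `z`. -/
def dissipation (α : ℝ) (κ : ℝ → ℝ → ℝ) (t z u : ℝ) : ℝ :=
  (κ t u ^ α - κ t z ^ α) * ((κ t u)⁻¹ - (κ t z)⁻¹)

/-- Both κ^α and κ⁻¹ decrease in κ, so the two factors have the same sign. -/
lemma dissipation_nonneg (N : NormalFlow α ρ κ g φ) (hα : α < 0) {t : ℝ} (ht : 0 ≤ t) (z u : ℝ) :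
    0 ≤ dissipation α κ t z u := by
  have hu := N.curv_pos t ht u
  have hz := N.curv_pos t ht z
  rcases le_total (κ t u) (κ t z) with h | h
  · exact mul_nonneg (sub_nonneg.2 (Real.rpow_le_rpow_of_nonpos hu h hα.le))
      (sub_nonneg.2 (inv_anti₀ hu h))
  · exact mul_nonneg_of_nonpos_of_nonpos
      (sub_nonpos.2 (Real.rpow_le_rpow_of_nonpos hz h hα.le)) (sub_nonpos.2 (inv_anti₀ hz h))

lemma continuous_dissipation (N : NormalFlow α ρ κ g φ) {t : ℝ} (ht : 0 ≤ t) (z : ℝ) :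
    Continuous (dissipation α κ t z) :=
  ((N.continuous_rpow α ht).sub continuous_const).mul
    (((N.continuous_curv ht).inv₀ fun u => (N.curv_pos t ht u).ne').sub continuous_const)

/-- The rate of decrease of length for the unweighted average. -/
lemma dissipation_le_of_weight_one (N : NormalFlow α ρ κ g φ) (hα : α < 0) (hc : 0 < c)
    (hκ : ∀ t, 0 ≤ t → ∀ u, c ≤ κ t u) (hρ : ρ = fun _ _ => 1) {t : ℝ} (ht : 0 ≤ t) {z : ℝ}
    (hz : κ t z ^ α = φ t) :
    c ^ 2 * (∫ u in (0 : ℝ)..(2 * Real.pi), dissipation α κ t z u * g t u) ≤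
      ∫ u in (0 : ℝ)..(2 * Real.pi), κ t u * (φ t - κ t u ^ α) * g t u := by
  have h0 := N.integral_weight_velocity ht
  simp only [hρ, one_mul] at h0
  have cκ := N.continuous_curv ht
  have cg := N.continuous_speed ht
  have cw := N.continuous_rpow α ht
  have cd := N.continuous_dissipation ht z
  -- F has mean zero, so the constant κ(z) may be subtracted from κ; the factors then vanish
  -- together at z.
  have e : ∫ u in (0 : ℝ)..(2 * Real.pi), κ t u * (φ t - κ t u ^ α) * g t u =
      ∫ u in (0 : ℝ)..(2 * Real.pi), (κ t u - κ t z) * (φ t - κ t u ^ α) * g t u := by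
    have e1 : ∀ u, (κ t u - κ t z) * (φ t - κ t u ^ α) * g t u =
      κ t u * (φ t - κ t u ^ α) * g t u - κ t z * ((φ t - κ t u ^ α) * g t u) := fun u => by ring
    simp only [e1]
    rw [intervalIntegral.integral_sub (Continuous.intervalIntegrable (by fun_prop) _ _)
      (Continuous.intervalIntegrable (by fun_prop) _ _), intervalIntegral.integral_const_mul, h0]
    ring
  rw [e, ← intervalIntegral.integral_const_mul]
  refine intervalIntegral.integral_mono_on two_pi_pos.le
    (Continuous.intervalIntegrable (by fun_prop) _ _)
    (Continuous.intervalIntegrable (by fun_prop) _ _) fun u _ => ?_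
  have hu := N.curv_pos t ht u
  have hz0 := N.curv_pos t ht z
  have hd := N.dissipation_nonneg hα ht z u
  have hle : c ^ 2 ≤ κ t u * κ t z := by
    rw [sq]; exact mul_le_mul (hκ t ht u) (hκ t ht z) hc.le hu.le
  have e2 : (κ t u - κ t z) * (φ t - κ t u ^ α) = κ t u * κ t z * dissipation α κ t z u := by
    rw [dissipation, ← hz]; field_simp; ring
  rw [e2, ← mul_assoc]
  have := N.speed_pos t ht u
  gcongr

/-- The rate of increase of the area for the average weighted by curvature. -/
lemma dissipation_le_of_weight_curv (N : NormalFlow α ρ κ g φ) (hα : α < 0) (hc : 0 < c)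
    (hc1 : c ≤ 1) (hκ : ∀ t, 0 ≤ t → ∀ u, c ≤ κ t u) (hρ : ρ = κ) {t : ℝ} (ht : 0 ≤ t) {z : ℝ}
    (hz : κ t z ^ α = φ t) :
    c ^ 2 * (∫ u in (0 : ℝ)..(2 * Real.pi), dissipation α κ t z u * g t u) ≤
      -∫ u in (0 : ℝ)..(2 * Real.pi), (φ t - κ t u ^ α) * g t u := by
  have h0 := N.integral_weight_velocity ht
  simp only [hρ] at h0
  have cκ := N.continuous_curv ht
  have cg := N.continuous_speed ht
  have cw := N.continuous_rpow α ht
  have cd := N.continuous_dissipation ht z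
  have hz0 := N.curv_pos t ht z
  -- Now κF has mean zero, so the multiple κF/κ(z) may be added.
  have e : -∫ u in (0 : ℝ)..(2 * Real.pi), (φ t - κ t u ^ α) * g t u =
      ∫ u in (0 : ℝ)..(2 * Real.pi), ((κ t z)⁻¹ * κ t u - 1) * (φ t - κ t u ^ α) * g t u := by
    have e1 : ∀ u, ((κ t z)⁻¹ * κ t u - 1) * (φ t - κ t u ^ α) * g t u =
      (κ t z)⁻¹ * (κ t u * (φ t - κ t u ^ α) * g t u) - (φ t - κ t u ^ α) * g t u :=
        fun u => by ring
    simp only [e1]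
    rw [intervalIntegral.integral_sub (Continuous.intervalIntegrable (by fun_prop) _ _)
      (Continuous.intervalIntegrable (by fun_prop) _ _), intervalIntegral.integral_const_mul, h0]
    ring
  rw [e, ← intervalIntegral.integral_const_mul]
  refine intervalIntegral.integral_mono_on two_pi_pos.le
    (Continuous.intervalIntegrable (by fun_prop) _ _)
    (Continuous.intervalIntegrable (by fun_prop) _ _) fun u _ => ?_
  have hu := N.curv_pos t ht u
  have hd := N.dissipation_nonneg hα ht z u
  have hle : c ^ 2 ≤ κ t u := by nlinarith [hκ t ht u]
  have e2 : ((κ t z)⁻¹ * κ t u - 1) * (φ t - κ t u ^ α) = κ t u * dissipation α κ t z u := by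
    rw [dissipation, ← hz]; field_simp; ring
  rw [e2, ← mul_assoc]
  have := N.speed_pos t ht u
  gcongr

/-- For the unweighted average the length decreases by the dissipation; for the weighted one its
derivative is the weighted mean of F, which is zero. -/
lemma length_le (N : NormalFlow α ρ κ g φ) (hα : α < 0) {t : ℝ} (ht : 0 ≤ t) :
    ∫ u in (0 : ℝ)..(2 * Real.pi), g t u ≤ ∫ u in (0 : ℝ)..(2 * Real.pi), g 0 u := by
  obtain ⟨c, hc, -, hκ⟩ := N.exists_curv_ge hα
  have hanti : AntitoneOn (fun τ => ∫ u in (0 : ℝ)..(2 * Real.pi), g τ u) (Set.Ici 0) := by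
    refine antitoneOn_of_deriv_nonpos (convex_Ici 0) (N.smooth_speed.continuousOn_integral _ _)
      ?_ ?_
    all_goals
      rw [interior_Ici]
      intro s hs
    · exact (N.hasDerivAt_length hs).differentiableAt.differentiableWithinAt
    · rw [(N.hasDerivAt_length hs).deriv, neg_nonpos]
      have hs0 : (0 : ℝ) ≤ s := le_of_lt hs
      rcases N.weight with hρ | hρ
      · obtain ⟨z, hz⟩ := N.exists_rpow_eq_average hs0
        refine le_trans ?_ (N.dissipation_le_of_weight_one hα hc hκ hρ hs0 hz)
        exact mul_nonneg (sq_nonneg _) (intervalIntegral.integral_nonneg two_pi_pos.le fun u _ =>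
          mul_nonneg (N.dissipation_nonneg hα hs0 z u) (N.speed_pos s hs0 u).le)
      · have := N.integral_weight_velocity hs0
        rw [hρ] at this
        exact this.ge
  exact hanti Set.self_mem_Ici ht ht

/-- A bounded functional whose derivative controls the oscillation of a power of the curvature. -/
lemma exists_functional (N : NormalFlow α ρ κ g φ) (hα : α < 0) {A : ℝ → ℝ}
    (cA : ContinuousOn A (Set.Ici 0))
    (dA : ∀ t, 0 < t → HasDerivAt A
      (-∫ u in (0 : ℝ)..(2 * Real.pi), (φ t - κ t u ^ α) * g t u) t)
    (bA : ∀ t, 0 ≤ t → A t ≤ ∫ u in (0 : ℝ)..(2 * Real.pi), g t u) :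
    ∃ (E : ℝ → ℝ) (B d : ℝ), 0 < d ∧ ContinuousOn E (Set.Ici 0) ∧ (∀ t, 0 ≤ t → E t ≤ B) ∧
      ∀ t, 0 < t → ∃ e', HasDerivAt E e' t ∧ ∀ z, κ t z ^ α = φ t →
        d * (∫ u in (0 : ℝ)..(2 * Real.pi),
          (κ t u ^ (α / 2 - 1) - κ t z ^ (α / 2 - 1)) ^ 2 * g t u) ≤ e' := by
  obtain ⟨c, hc, hc1, hκ⟩ := N.exists_curv_ge hα
  set C := (-α / 2 + 1) ^ 2 * c⁻¹ / min 1 (-α) with hC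
  have hC0 : 0 < C := by
    have h1 : 0 < min 1 (-α) := lt_min one_pos (by linarith)
    have h2 : 0 < -α / 2 + 1 := by linarith
    positivity
  have key : ∀ t, 0 ≤ t → ∀ z, c ^ 2 / C * (∫ u in (0 : ℝ)..(2 * Real.pi),
      (κ t u ^ (α / 2 - 1) - κ t z ^ (α / 2 - 1)) ^ 2 * g t u) ≤
      c ^ 2 * (∫ u in (0 : ℝ)..(2 * Real.pi), dissipation α κ t z u * g t u) := by
    intro t ht z
    rw [div_mul_eq_mul_div, mul_div_assoc]
    refine mul_le_mul_of_nonneg_left ?_ (sq_nonneg c)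
    rw [div_le_iff₀' hC0, ← intervalIntegral.integral_const_mul]
    have cg := N.continuous_speed ht
    have cw := N.continuous_rpow (α / 2 - 1) ht
    have cd := N.continuous_dissipation ht z
    refine intervalIntegral.integral_mono_on two_pi_pos.le
      (Continuous.intervalIntegrable (by fun_prop) _ _)
      (Continuous.intervalIntegrable (by fun_prop) _ _) fun u _ => ?_
    rw [← mul_assoc]
    exact mul_le_mul_of_nonneg_right
      (sq_rpow_sub_le_dissipation hα hc (hκ t ht u) (hκ t ht z)) (N.speed_pos t ht u).le
  -- The functional is minus the length for the unweighted average, bounded by 0, and the area for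
  -- the weighted one, bounded by the initial length.
  rcases N.weight with hρ | hρ
  · refine ⟨fun t => -∫ u in (0 : ℝ)..(2 * Real.pi), g t u, 0, c ^ 2 / C, by positivity,
      (N.smooth_speed.continuousOn_integral _ _).neg, fun t ht => neg_nonpos.2 ?_,
      fun t ht => ⟨_, (N.hasDerivAt_length ht).neg, fun z hz => ?_⟩⟩
    · exact intervalIntegral.integral_nonneg two_pi_pos.le fun u _ => (N.speed_pos t ht u).le
    · rw [neg_neg]
      exact (key t ht.le z).trans (N.dissipation_le_of_weight_one hα hc hκ hρ ht.le hz)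
  · exact ⟨A, ∫ u in (0 : ℝ)..(2 * Real.pi), g 0 u, c ^ 2 / C, by positivity, cA,
      fun t ht => (bA t ht).trans (N.length_le hα ht), fun t ht => ⟨_, dA t ht, fun z hz =>
        (key t ht.le z).trans (N.dissipation_le_of_weight_curv hα hc hc1 hκ hρ ht.le hz)⟩⟩

/-- The derivative of `∫ κ⁻¹ ds` controls the Dirichlet energy of a power of the curvature. -/
lemma exists_energy_bound (N : NormalFlow α ρ κ g φ) (hα : α < 0) :
    ∃ d K, 0 < d ∧ 0 ≤ K ∧ ∀ t, 0 < t → ∃ s',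
      HasDerivAt (fun τ => ∫ u in (0 : ℝ)..(2 * Real.pi), (κ τ u)⁻¹ * g τ u) s' t ∧
      d * (∫ u in (0 : ℝ)..(2 * Real.pi),
        du (fun t u => κ t u ^ (α / 2 - 1)) t u ^ 2 / g t u) ≤ -s' + K := by
  obtain ⟨c, hc, -, hκ⟩ := N.exists_curv_ge hα
  have hα2 : 0 < (α / 2 - 1) ^ 2 := by nlinarith
  set B := (2 + (c ^ 2)⁻¹) * c ^ α with hB
  have hB0 : 0 < B := by positivity
  have hL0 : 0 ≤ ∫ u in (0 : ℝ)..(2 * Real.pi), g 0 u :=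
    intervalIntegral.integral_nonneg two_pi_pos.le fun u _ => (N.speed_pos 0 le_rfl u).le
  have sh : SmoothFlow (fun t u => (κ t u)⁻¹ * g t u) :=
    (ContDiffOn.inv N.smooth_curv (fun p hp => (N.curv_pos p.1 hp.1 p.2).ne')).mul N.smooth_speed
  refine ⟨2 * -α / (α / 2 - 1) ^ 2, B * ∫ u in (0 : ℝ)..(2 * Real.pi), g 0 u,
    div_pos (by linarith) hα2, mul_nonneg hB0.le hL0,
    fun t ht => ⟨_, sh.hasDerivAt_integral two_pi_pos.le ht, ?_⟩⟩
  have ht0 := ht.le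
  have hk := N.curv_pos t ht0
  have hg := N.speed_pos t ht0
  have cκ := N.continuous_curv ht0
  have cg := N.continuous_speed ht0
  have cw := N.continuous_rpow α ht0
  have dκ : ∀ u, HasDerivAt (κ t) (du κ t u) u := N.smooth_curv.hasDerivAt_du ht0
  have cdκ : Continuous (du κ t) := N.smooth_curv.du.continuous_slice ht0
  -- the flux
  have cJ : ContDiff ℝ ∞ (fun v => deriv (fun z => κ t z ^ α) v / g t v) :=
    ContDiff.div ((contDiff_infty_iff_deriv.1 ((N.smooth_rpow α).slice ht0)).2)
      (N.smooth_speed.slice ht0) (fun u => (hg u).ne')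
  set J : ℝ → ℝ := fun v => deriv (fun z => κ t z ^ α) v / g t v with hJ
  have dJ : ∀ u, HasDerivAt J (deriv J u) u := fun u =>
    (cJ.differentiable (by simp) u).hasDerivAt
  have cdJ : Continuous (deriv J) := cJ.continuous_deriv (by simp)
  have pJ : Function.Periodic J (2 * Real.pi) := fun u => by
    have := periodic_du (f := fun t u => κ t u ^ α) (N.periodic_rpow α ht0) u
    simp only [du] at this
    simp only [hJ, this, N.periodic_speed t ht0 u]
  have hw : ∀ u, deriv (fun z => κ t z ^ α) u = du κ t u * α * κ t u ^ (α - 1) := fun u =>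
    ((dκ u).rpow_const (Or.inl (hk u).ne')).deriv
  have hf : ∀ u, du (fun t u => κ t u ^ (α / 2 - 1)) t u =
      du κ t u * (α / 2 - 1) * κ t u ^ (α / 2 - 1 - 1) := fun u =>
    ((dκ u).rpow_const (Or.inl (hk u).ne')).deriv
  have dp : ∀ u, HasDerivAt (fun u => (κ t u ^ 2)⁻¹)
      (-(2 * κ t u * du κ t u) / (κ t u ^ 2) ^ 2) u := fun u => by
    refine ((dκ u).pow 2).inv (pow_ne_zero 2 (hk u).ne') |>.congr_deriv ?_
    norm_num
  -- The diffusion part of the derivative is ∫κ⁻²(κ^α)_ss ds = 2α∫κ^(α-4)κ_s² ds, a negative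
  -- multiple of ∫f_s² ds. This is why the power α/2 - 1 is the right one.
  have hibp := integral_mul_deriv_of_periodic dp dJ
    (by
      refine Continuous.div (by fun_prop) (by fun_prop) fun u => ?_
      have := (hk u).ne'
      positivity) cdJ (fun u => by simp only [N.periodic_curv t ht0 u]) pJ
  have hdt : ∀ u, dt (fun t u => (κ t u)⁻¹ * g t u) t u =
      (κ t u ^ 2)⁻¹ * deriv J u +
        -(2 - (κ t u ^ 2)⁻¹) * (φ t - κ t u ^ α) * g t u := fun u => by
    have e : HasDerivAt (fun τ => (κ τ u)⁻¹ * g τ u) _ t :=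
      ((N.curv_evolution t ht u).inv (hk u).ne').mul (N.speed_evolution t ht u)
    rw [dt, e.deriv]
    have := (hk u).ne'
    have := (hg u).ne'
    simp only [Pi.inv_apply]
    field_simp
    ring
  have ck2 : Continuous fun u => (κ t u ^ 2)⁻¹ :=
    (cκ.pow 2).inv₀ fun u => pow_ne_zero 2 (hk u).ne'
  have i1 : Continuous fun u => (κ t u ^ 2)⁻¹ * deriv J u := ck2.mul cdJ
  have i2 : Continuous fun u => -(2 - (κ t u ^ 2)⁻¹) * (φ t - κ t u ^ α) * g t u := by fun_prop
  rw [intervalIntegral.integral_congr (fun u _ => hdt u), intervalIntegral.integral_add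
    (i1.intervalIntegrable _ _) (i2.intervalIntegrable _ _), hibp,
    ← intervalIntegral.integral_const_mul]
  have hmain : ∀ u, 2 * -α / (α / 2 - 1) ^ 2 *
      (du (fun t u => κ t u ^ (α / 2 - 1)) t u ^ 2 / g t u) =
      -(2 * κ t u * du κ t u) / (κ t u ^ 2) ^ 2 * J u := fun u => by
    have hk' := hk u
    have := (hg u).ne'
    have e : κ t u ^ (α - 1) = κ t u ^ (α / 2 - 1 - 1) * κ t u ^ (α / 2 - 1 - 1) * κ t u ^ 3 := by
      rw [← Real.rpow_add hk', ← Real.rpow_natCast, ← Real.rpow_add hk']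
      congr 1; push_cast; ring
    simp only [hJ, hw, hf, e]
    have : α / 2 - 1 ≠ 0 := by linarith
    generalize κ t u ^ (α / 2 - 1 - 1) = r
    generalize α / 2 - 1 = q at *
    field_simp
  rw [intervalIntegral.integral_congr (fun u _ => hmain u)]
  -- The reaction part is bounded by B times the length, because |F| ≤ c^α and κ ≥ c.
  have hrest : -(∫ u in (0 : ℝ)..(2 * Real.pi),
      -(2 - (κ t u ^ 2)⁻¹) * (φ t - κ t u ^ α) * g t u) ≥
      -(B * ∫ u in (0 : ℝ)..(2 * Real.pi), g 0 u) := by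
    rw [ge_iff_le, neg_le_neg_iff]
    refine le_trans ?_ (mul_le_mul_of_nonneg_left (N.length_le hα ht0) hB0.le)
    rw [← intervalIntegral.integral_const_mul]
    refine intervalIntegral.integral_mono_on two_pi_pos.le (i2.intervalIntegrable _ _)
      ((cg.const_mul _).intervalIntegrable _ _) fun u _ => ?_
    refine mul_le_mul_of_nonneg_right ?_ (hg u).le
    have hF : |φ t - κ t u ^ α| ≤ c ^ α := by
      have h1 := N.average_pos ht0
      have h2 := N.average_le hα hc hκ ht0
      have h3 : 0 < κ t u ^ α := Real.rpow_pos_of_pos (hk u) _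
      have h4 : κ t u ^ α ≤ c ^ α := Real.rpow_le_rpow_of_nonpos hc (hκ t ht0 u) hα.le
      rw [abs_le]; constructor <;> linarith
    have hV : |-(2 - (κ t u ^ 2)⁻¹)| ≤ 2 + (c ^ 2)⁻¹ := by
      have h1 : (κ t u ^ 2)⁻¹ ≤ (c ^ 2)⁻¹ :=
        inv_anti₀ (by positivity) (pow_le_pow_left₀ hc.le (hκ t ht0 u) 2)
      have h2 : 0 < (κ t u ^ 2)⁻¹ := by have := hk u; positivity
      rw [abs_le]; constructor <;> linarith
    calc _ ≤ |-(2 - (κ t u ^ 2)⁻¹) * (φ t - κ t u ^ α)| := le_abs_self _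
      _ = |-(2 - (κ t u ^ 2)⁻¹)| * |φ t - κ t u ^ α| := abs_mul _ _
      _ ≤ _ := mul_le_mul hV hF (abs_nonneg _) (by positivity)
  linarith

end NormalFlow

/-! ### The upper curvature bound for one solution -/

/-- The increments of a monotone bounded function over a fixed time are eventually small. -/
lemma exists_increment_lt {E : ℝ → ℝ} {B τ ε : ℝ} (hE : MonotoneOn E (Set.Ici 0))
    (hB : ∀ t, 0 ≤ t → E t ≤ B) (hτ : 0 ≤ τ) (hε : 0 < ε) :
    ∃ T, 0 ≤ T ∧ ∀ t, T ≤ t → E (t + τ) - E t < ε := by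
  have hne : (E '' Set.Ici 0).Nonempty := ⟨E 0, 0, Set.self_mem_Ici, rfl⟩
  have hbdd : BddAbove (E '' Set.Ici 0) := ⟨B, by rintro _ ⟨t, ht, rfl⟩; exact hB t ht⟩
  obtain ⟨_, ⟨T, hT, rfl⟩, hlt⟩ := exists_lt_of_lt_csSup hne (sub_lt_self _ hε)
  refine ⟨T, hT, fun t ht => ?_⟩
  have hT0 : (0 : ℝ) ≤ T := hT
  have h1 := hE hT (hT0.trans ht) ht
  have h2 : E (t + τ) ≤ sSup (E '' Set.Ici 0) :=
    le_csSup hbdd ⟨t + τ, add_nonneg (hT0.trans ht) hτ, rfl⟩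
  linarith

namespace NormalFlow

variable {α : ℝ} {ρ κ g : ℝ → ℝ → ℝ} {φ : ℝ → ℝ}

/-- The curvature of a global convex flow on which some value of the curvature persists is bounded
above. -/
theorem exists_curv_le (N : NormalFlow α ρ κ g φ) (hα : α < 0) {A : ℝ → ℝ}
    (cA : ContinuousOn A (Set.Ici 0))
    (dA : ∀ t, 0 < t → HasDerivAt A
      (-∫ u in (0 : ℝ)..(2 * Real.pi), (φ t - κ t u ^ α) * g t u) t)
    (bA : ∀ t, 0 ≤ t → A t ≤ ∫ u in (0 : ℝ)..(2 * Real.pi), g t u) {D : ℝ} (hD : 0 < D)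
    (hex : ∀ t, 0 ≤ t → ∃ u, (κ t u)⁻¹ = D) :
    ∃ C, 0 < C ∧ ∀ t, 0 ≤ t → ∀ u, κ t u ≤ C := by
  obtain ⟨c, hc, hc1, hκ⟩ := N.exists_curv_ge hα
  obtain ⟨E, B, d, hd, cE, bE, dE⟩ := N.exists_functional hα cA dA bA
  obtain ⟨b, K, hb, hK, dS⟩ := N.exists_energy_bound hα
  set S : ℝ → ℝ := fun t => ∫ u in (0 : ℝ)..(2 * Real.pi), (κ t u)⁻¹ * g t u with hS
  set L := ∫ u in (0 : ℝ)..(2 * Real.pi), g 0 u with hL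
  have sh : SmoothFlow (fun t u => (κ t u)⁻¹ * g t u) :=
    (ContDiffOn.inv N.smooth_curv (fun p hp => (N.curv_pos p.1 hp.1 p.2).ne')).mul N.smooth_speed
  have cS : ContinuousOn S (Set.Ici 0) := sh.continuousOn_integral _ _
  have hS0 : ∀ t, 0 ≤ t → 0 ≤ S t := fun t ht =>
    intervalIntegral.integral_nonneg two_pi_pos.le fun u _ =>
      mul_nonneg (inv_nonneg.2 (N.curv_pos t ht u).le) (N.speed_pos t ht u).le
  have hSL : ∀ t, 0 ≤ t → S t ≤ c⁻¹ * L := fun t ht => by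
    refine le_trans ?_ (mul_le_mul_of_nonneg_left (N.length_le hα ht) (inv_nonneg.2 hc.le))
    rw [← intervalIntegral.integral_const_mul]
    exact intervalIntegral.integral_mono_on two_pi_pos.le
      ((sh.continuous_slice ht).intervalIntegrable _ _)
      (((N.continuous_speed ht).const_mul _).intervalIntegrable _ _) fun u _ =>
      mul_le_mul_of_nonneg_right (inv_anti₀ hc (hκ t ht u)) (N.speed_pos t ht u).le
  have hL0 : 0 ≤ L := intervalIntegral.integral_nonneg two_pi_pos.le fun u _ =>
    (N.speed_pos 0 le_rfl u).le
  have mE : MonotoneOn E (Set.Ici 0) := by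
    refine monotoneOn_of_deriv_nonneg (convex_Ici 0) cE ?_ ?_
    all_goals
      rw [interior_Ici]
      intro s hs
      obtain ⟨e', he', hle⟩ := dE s hs
    · exact he'.differentiableAt.differentiableWithinAt
    · rw [he'.deriv]
      obtain ⟨z, hz⟩ := N.exists_rpow_eq_average (le_of_lt hs)
      refine le_trans ?_ (hle z hz)
      exact mul_nonneg hd.le (intervalIntegral.integral_nonneg two_pi_pos.le fun u _ =>
        mul_nonneg (sq_nonneg _) (N.speed_pos s (le_of_lt hs) u).le)
  -- constants
  have hγ : α / 2 - 1 < 0 := by linarith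
  -- The drop of f between radius of curvature D and D/2.
  set δ := D⁻¹ ^ (α / 2 - 1) - (D / 2)⁻¹ ^ (α / 2 - 1) with hδ
  have hδ0 : 0 < δ := by
    refine sub_pos.2 (Real.rpow_lt_rpow_of_neg (inv_pos.2 hD) ?_ hγ)
    exact inv_strictAnti₀ (by positivity) (by linarith)
  have hΦ : 0 < c ^ α := by positivity
  -- During a time τ the minimum of V loses at most D/8.
  set τ := D / (8 * c ^ α) with hτ
  have hτ0 : 0 < τ := by positivity
  have hΦτ : c ^ α * τ = D / 8 := by rw [hτ]; field_simp
  -- Q bounds the energy budget over a time τ. The choice of l makes lQ = δ²τ/16, and ε makes the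
  -- contribution of E at most δ²τ/16; the sum stays below the δ²τ/4 forced by the oscillation.
  set Q := b⁻¹ * (c⁻¹ * L + K * τ) + 1 with hQ
  have hQ0 : 0 < Q := by positivity
  set l := δ ^ 2 * τ / (16 * Q) with hl
  have hl0 : 0 < l := by positivity
  set ε := δ ^ 2 * τ / 16 * (l * d) with hε
  have hε0 : 0 < ε := by positivity
  obtain ⟨T, hT, hinc⟩ := exists_increment_lt mE bE hτ0.le hε0
  -- large times
  have hlarge : ∀ t, T + τ ≤ t → ∀ u, D / 4 ≤ (κ t u)⁻¹ := by
    intro t₁ ht₁ u₁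
    by_contra! hlt
    set t₀ := t₁ - τ with ht₀
    have ht₀T : T ≤ t₀ := by linarith
    have ht₀0 : 0 ≤ t₀ := hT.trans ht₀T
    -- If V ≥ D/2 everywhere at time t, then V would still be at least 3D/8 at time t₁.
    have hsmall : ∀ t ∈ Set.Icc t₀ t₁, ∃ u, (κ t u)⁻¹ < D / 2 := by
      intro t ht
      by_contra! hbig
      have := N.inv_curv_ge hα hc hκ (ht₀0.trans ht.1) ht.2 hbig u₁
      have h2 : c ^ α * (t₁ - t) ≤ c ^ α * τ :=
        mul_le_mul_of_nonneg_left (by linarith [ht.1]) hΦ.le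
      linarith
    -- Monotonicity of Ψ is the interpolation inequality integrated in time, without any
    -- integrability question for the derivatives of E and S.
    set Ψ : ℝ → ℝ := fun t => l⁻¹ * d⁻¹ * E t - l * b⁻¹ * S t +
      (l * b⁻¹ * K - δ ^ 2 / 4) * t with hΨ
    have mΨ : MonotoneOn Ψ (Set.Icc t₀ t₁) := by
      have hsub : Set.Icc t₀ t₁ ⊆ Set.Ici 0 := fun t ht => ht₀0.trans ht.1
      have hder : ∀ t ∈ Set.Ioo t₀ t₁, ∃ p, HasDerivAt Ψ p t ∧ 0 ≤ p := by
        intro t ht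
        have ht0 : 0 < t := ht₀0.trans_lt ht.1
        obtain ⟨e', he', hle⟩ := dE t ht0
        obtain ⟨s', hs', hsle⟩ := dS t ht0
        refine ⟨l⁻¹ * d⁻¹ * e' - l * b⁻¹ * s' + (l * b⁻¹ * K - δ ^ 2 / 4), ?_, ?_⟩
        · have h3 : HasDerivAt (fun t : ℝ => (l * b⁻¹ * K - δ ^ 2 / 4) * t)
            (l * b⁻¹ * K - δ ^ 2 / 4) t := by
            simpa using (hasDerivAt_id t).const_mul (l * b⁻¹ * K - δ ^ 2 / 4)
          exact ((he'.const_mul _).sub (hs'.const_mul _)).add h3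
        obtain ⟨z, hz⟩ := N.exists_rpow_eq_average ht0.le
        have hz' := hle z hz
        obtain ⟨u₂, hu₂⟩ := hex t ht0.le
        obtain ⟨u₃, hu₃⟩ := hsmall t ⟨ht.1.le, ht.2.le⟩
        have sf := N.smooth_rpow (α / 2 - 1)
        have hint := fun x => sq_sub_le_of_periodic two_pi_pos hl0
          (sf.hasDerivAt_du ht0.le) (sf.du.continuous_slice ht0.le) (N.continuous_speed ht0.le)
          (N.speed_pos t ht0.le) (N.periodic_rpow _ ht0.le)
          (periodic_du (N.periodic_rpow (α / 2 - 1) ht0.le)) (N.periodic_speed t ht0.le) x z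
        -- The values of f at u₂ and u₃ are at least δ apart, so one of them is at least δ/2 away
        -- from f(z).
        have hosc : δ ^ 2 / 4 ≤ l⁻¹ * (∫ u in (0 : ℝ)..(2 * Real.pi),
            (κ t u ^ (α / 2 - 1) - κ t z ^ (α / 2 - 1)) ^ 2 * g t u) +
            l * ∫ u in (0 : ℝ)..(2 * Real.pi),
              du (fun t u => κ t u ^ (α / 2 - 1)) t u ^ 2 / g t u := by
          have e2 : κ t u₂ ^ (α / 2 - 1) = D⁻¹ ^ (α / 2 - 1) := by rw [← hu₂, inv_inv]
          have e3 : κ t u₃ ^ (α / 2 - 1) ≤ (D / 2)⁻¹ ^ (α / 2 - 1) := by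
            refine Real.rpow_le_rpow_of_nonpos (by positivity) ?_ hγ.le
            rw [inv_le_comm₀ (by positivity) (N.curv_pos t ht0.le u₃)]
            exact hu₃.le
          have h2 := hint u₂
          have h3 := hint u₃
          have hgap : δ ≤ κ t u₂ ^ (α / 2 - 1) - κ t u₃ ^ (α / 2 - 1) := by
            rw [e2]; linarith
          by_contra! hcon
          have g2 := abs_lt_of_sq_lt_sq (show (κ t u₂ ^ (α / 2 - 1) - κ t z ^ (α / 2 - 1)) ^ 2 <
            (δ / 2) ^ 2 by linarith) (by positivity)
          have g3 := abs_lt_of_sq_lt_sq (show (κ t u₃ ^ (α / 2 - 1) - κ t z ^ (α / 2 - 1)) ^ 2 <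
            (δ / 2) ^ 2 by linarith) (by positivity)
          linarith [(abs_lt.1 g2).2, (abs_lt.1 g3).1]
        have k1 : l⁻¹ * (∫ u in (0 : ℝ)..(2 * Real.pi),
            (κ t u ^ (α / 2 - 1) - κ t z ^ (α / 2 - 1)) ^ 2 * g t u) ≤ l⁻¹ * d⁻¹ * e' := by
          rw [mul_assoc]
          refine mul_le_mul_of_nonneg_left ?_ (inv_nonneg.2 hl0.le)
          rwa [inv_mul_eq_div, le_div_iff₀' hd]
        have k2 : l * (∫ u in (0 : ℝ)..(2 * Real.pi),
            du (fun t u => κ t u ^ (α / 2 - 1)) t u ^ 2 / g t u) ≤ l * b⁻¹ * (-s' + K) := by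
          rw [mul_assoc]
          refine mul_le_mul_of_nonneg_left ?_ hl0.le
          rwa [inv_mul_eq_div, le_div_iff₀' hb]
        linarith
      refine monotoneOn_of_deriv_nonneg (convex_Icc t₀ t₁) ?_ ?_ ?_
      · exact ((continuousOn_const.mul (cE.mono hsub)).sub
          (continuousOn_const.mul (cS.mono hsub))).add (by fun_prop)
      · rw [interior_Icc]
        intro t ht
        obtain ⟨p, hp, -⟩ := hder t ht
        exact hp.differentiableAt.differentiableWithinAt
      · rw [interior_Icc]
        intro t ht
        obtain ⟨p, hp, hp0⟩ := hder t ht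
        rwa [hp.deriv]
    have ht₀₁ : t₀ ≤ t₁ := by linarith
    have hm := mΨ ⟨le_rfl, ht₀₁⟩ ⟨ht₀₁, le_rfl⟩ ht₀₁
    simp only [hΨ] at hm
    have hE1 : E t₁ - E t₀ < ε := by
      have := hinc t₀ ht₀T
      rwa [ht₀, sub_add_cancel, ← ht₀] at this
    have hS1 : S t₀ - S t₁ ≤ c⁻¹ * L := by linarith [hSL t₀ ht₀0, hS0 t₁ (ht₀0.trans ht₀₁)]
    have j1 : l⁻¹ * d⁻¹ * (E t₁ - E t₀) ≤ δ ^ 2 * τ / 16 := by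
      calc l⁻¹ * d⁻¹ * (E t₁ - E t₀) ≤ l⁻¹ * d⁻¹ * ε :=
            mul_le_mul_of_nonneg_left hE1.le (by positivity)
        _ = δ ^ 2 * τ / 16 := by rw [hε]; field_simp
    have j2 : l * (b⁻¹ * (S t₀ - S t₁ + K * τ)) ≤ δ ^ 2 * τ / 16 := by
      calc l * (b⁻¹ * (S t₀ - S t₁ + K * τ)) ≤ l * Q := by
            refine mul_le_mul_of_nonneg_left ?_ hl0.le
            have : b⁻¹ * (S t₀ - S t₁ + K * τ) ≤ b⁻¹ * (c⁻¹ * L + K * τ) :=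
              mul_le_mul_of_nonneg_left (by linarith) (inv_nonneg.2 hb.le)
            linarith
        _ = δ ^ 2 * τ / 16 := by rw [hl]; field_simp
    have hττ : t₁ - t₀ = τ := by rw [ht₀]; ring
    have hpos : 0 < δ ^ 2 * τ := by positivity
    have e : l⁻¹ * d⁻¹ * (E t₁ - E t₀) + l * (b⁻¹ * (S t₀ - S t₁ + K * τ)) -
        δ ^ 2 * τ / 4 = (l⁻¹ * d⁻¹ * E t₁ - l * b⁻¹ * S t₁ + (l * b⁻¹ * K - δ ^ 2 / 4) * t₁) -
        (l⁻¹ * d⁻¹ * E t₀ - l * b⁻¹ * S t₀ + (l * b⁻¹ * K - δ ^ 2 / 4) * t₀) := by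
      rw [← hττ]; ring
    linarith
  -- T comes from the convergence of E without a rate, so this constant depends on the solution.
  obtain ⟨C, hC, hbound⟩ := N.smooth_curv.exists_bound two_pi_pos N.periodic_curv (T + τ)
  refine ⟨max C (4 / D), lt_max_of_lt_left hC, fun t ht u => ?_⟩
  rcases le_total t (T + τ) with h | h
  · exact (le_abs_self _).trans ((hbound t ⟨ht, h⟩ u).trans (le_max_left _ _))
  · refine le_trans ?_ (le_max_right _ _)
    have h1 := hlarge t h u
    have h2 := N.curv_pos t ht u
    rw [le_inv_comm₀ (by positivity) h2] at h1
    rwa [inv_div] at h1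

end NormalFlow

/-! ### Uniqueness: Lipschitz calculus and compactness bounds -/

/-- Two functions are bounded and differ by at most a multiple of `s` on `[0,T]`. -/
def LipPair (T : ℝ) (s f₁ f₂ : ℝ → ℝ → ℝ) : Prop :=
  ∃ M, ∀ t ∈ Set.Icc 0 T, ∀ u, |f₁ t u| ≤ M ∧ |f₂ t u| ≤ M ∧ |f₁ t u - f₂ t u| ≤ M * s t u

namespace LipPair

variable {T : ℝ} {s f₁ f₂ h₁ h₂ : ℝ → ℝ → ℝ}

lemma sub (hf : LipPair T s f₁ f₂) (hh : LipPair T s h₁ h₂) :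
    LipPair T s (fun t u => f₁ t u - h₁ t u) (fun t u => f₂ t u - h₂ t u) := by
  obtain ⟨M, hM⟩ := hf
  obtain ⟨K, hK⟩ := hh
  refine ⟨M + K, fun t ht u => ?_⟩
  obtain ⟨a, b, c⟩ := hM t ht u
  obtain ⟨d, e, f⟩ := hK t ht u
  refine ⟨(abs_sub _ _).trans (add_le_add a d), (abs_sub _ _).trans (add_le_add b e), ?_⟩
  calc |f₁ t u - h₁ t u - (f₂ t u - h₂ t u)| = |(f₁ t u - f₂ t u) - (h₁ t u - h₂ t u)| := by
        ring_nf
    _ ≤ _ := (abs_sub _ _).trans (add_le_add c f)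
    _ = _ := by ring

lemma mul (hf : LipPair T s f₁ f₂) (hh : LipPair T s h₁ h₂) :
    LipPair T s (fun t u => f₁ t u * h₁ t u) (fun t u => f₂ t u * h₂ t u) := by
  obtain ⟨M, hM⟩ := hf
  obtain ⟨K, hK⟩ := hh
  refine ⟨2 * (|M| * |K|), fun t ht u => ?_⟩
  obtain ⟨a, b, c⟩ := hM t ht u
  obtain ⟨d, e, f⟩ := hK t ht u
  have hM0 : 0 ≤ M := (abs_nonneg _).trans a
  have hK0 : 0 ≤ K := (abs_nonneg _).trans d
  have hMK : 0 ≤ M * K := mul_nonneg hM0 hK0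
  rw [abs_of_nonneg hM0, abs_of_nonneg hK0]
  refine ⟨?_, ?_, ?_⟩
  · rw [abs_mul]; linarith [mul_le_mul a d (abs_nonneg _) hM0]
  · rw [abs_mul]; linarith [mul_le_mul b e (abs_nonneg _) hM0]
  · calc |f₁ t u * h₁ t u - f₂ t u * h₂ t u|
        = |f₁ t u * (h₁ t u - h₂ t u) + h₂ t u * (f₁ t u - f₂ t u)| := by ring_nf
      _ ≤ |f₁ t u| * |h₁ t u - h₂ t u| + |h₂ t u| * |f₁ t u - f₂ t u| := by
        rw [← abs_mul, ← abs_mul]; exact abs_add_le _ _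
      _ ≤ M * (K * s t u) + K * (M * s t u) :=
        add_le_add (mul_le_mul a f (abs_nonneg _) hM0) (mul_le_mul e c (abs_nonneg _) hK0)
      _ = _ := by ring

lemma const (hs : ∀ t u, 0 ≤ s t u) (r : ℝ) : LipPair T s (fun _ _ => r) (fun _ _ => r) :=
  ⟨|r|, fun t _ u => ⟨le_rfl, le_rfl, by
    simpa using mul_nonneg (abs_nonneg r) (hs t u)⟩⟩

lemma of_abs_sub_le {B : ℝ} (hs : ∀ t u, 0 ≤ s t u)
    (h₁ : ∀ t ∈ Set.Icc 0 T, ∀ u, |f₁ t u| ≤ B)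
    (h₂ : ∀ t ∈ Set.Icc 0 T, ∀ u, |f₂ t u| ≤ B)
    (h : ∀ t ∈ Set.Icc 0 T, ∀ u, |f₁ t u - f₂ t u| ≤ s t u) : LipPair T s f₁ f₂ :=
  ⟨max B 1, fun t ht u => ⟨(h₁ t ht u).trans (le_max_left _ _),
    (h₂ t ht u).trans (le_max_left _ _),
    (h t ht u).trans (le_mul_of_one_le_left (hs t u) (le_max_right _ _))⟩⟩

lemma rpow {b B : ℝ} (r : ℝ) (hb : 0 < b) (h₁ : ∀ t ∈ Set.Icc 0 T, ∀ u, f₁ t u ∈ Set.Icc b B)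
    (h₂ : ∀ t ∈ Set.Icc 0 T, ∀ u, f₂ t u ∈ Set.Icc b B)
    (h : ∀ t ∈ Set.Icc 0 T, ∀ u, |f₁ t u - f₂ t u| ≤ s t u) :
    LipPair T s (fun t u => f₁ t u ^ r) (fun t u => f₂ t u ^ r) := by
  have hc : ∀ p : ℝ, ContinuousOn (fun x : ℝ => x ^ p) (Set.Icc b B) := fun p x hx =>
    (Real.continuousAt_rpow_const x p (Or.inl (hb.trans_le hx.1).ne')).continuousWithinAt
  obtain ⟨M, hM⟩ := (isCompact_Icc (a := b) (b := B)).exists_bound_of_continuousOn (hc r)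
  obtain ⟨K, hK⟩ := (isCompact_Icc (a := b) (b := B)).exists_bound_of_continuousOn
    ((hc (r - 1)).const_mul r)
  refine ⟨max M K, fun t ht u => ⟨(hM _ (h₁ t ht u)).trans (le_max_left _ _),
    (hM _ (h₂ t ht u)).trans (le_max_left _ _), ?_⟩⟩
  have hd : ∀ x ∈ Set.Icc b B, HasDerivWithinAt (fun x : ℝ => x ^ r) (r * x ^ (r - 1))
      (Set.Icc b B) x := fun x hx =>
    (Real.hasDerivAt_rpow_const (Or.inl (hb.trans_le hx.1).ne')).hasDerivWithinAt
  have := (convex_Icc b B).norm_image_sub_le_of_norm_hasDerivWithin_le hd hK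
    (h₂ t ht u) (h₁ t ht u)
  simp only [Real.norm_eq_abs] at this
  have hK0 : 0 ≤ K := (norm_nonneg _).trans (hK _ (h₁ t ht u))
  exact this.trans (mul_le_mul (le_max_right _ _) (h t ht u) (abs_nonneg _)
    (hK0.trans (le_max_right _ _)))

end LipPair

/-- The pointwise estimate of the energy density of the difference of two solutions. -/
lemma energy_density_le {M c A a Γ k j x p y η ζ P Q s : ℝ} (hM : 0 ≤ M) (hc : 0 < c)
    (hs : 0 ≤ s) (hx : |x| ≤ s) (hy : |y| ≤ s) (hAa : A * a ≤ -c) (hA : |A| ≤ M) (ha : |a| ≤ M)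
    (hΓ : |Γ| ≤ M) (hk : |k| ≤ M) (hj : |j| ≤ M) (hη : |η| ≤ M * s) (hζ : |ζ| ≤ M * s)
    (hP : |P| ≤ M * s) (hQ : |Q| ≤ M * s) :
    2 * ((A * p - Γ * x) * (a * p + k * η)) - 2 * x * (j * ζ) + 2 * x * P + 2 * y * Q ≤
      ((M ^ 3 + M ^ 2) ^ 2 / (2 * c) + 2 * M ^ 3 + 2 * M ^ 2 + 4 * M) * s ^ 2 := by
  -- In the application x and y are the differences of κ and g, p = x_u, A p - Γ x is the derivative
  -- of x/g₁, and a p + k η is the difference of the fluxes.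
  have hms : 0 ≤ M * s := mul_nonneg hM hs
  have e1 : |A * k * η| ≤ M * M * (M * s) := by
    rw [abs_mul, abs_mul]
    exact mul_le_mul (mul_le_mul hA hk (abs_nonneg _) hM) hη (abs_nonneg _) (by positivity)
  have e2 : |Γ * x * a| ≤ M * s * M := by
    rw [abs_mul, abs_mul]
    exact mul_le_mul (mul_le_mul hΓ hx (abs_nonneg _) hM) ha (abs_nonneg _) (by positivity)
  have e3 : |Γ * x * (k * η)| ≤ M * s * (M * (M * s)) := by
    rw [abs_mul, abs_mul, abs_mul]
    exact mul_le_mul (mul_le_mul hΓ hx (abs_nonneg _) hM)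
      (mul_le_mul hk hη (abs_nonneg _) hM) (by positivity) (by positivity)
  have e4 : |x * (j * ζ)| ≤ s * (M * (M * s)) := by
    rw [abs_mul, abs_mul]
    exact mul_le_mul hx (mul_le_mul hj hζ (abs_nonneg _) hM) (by positivity) hs
  have e5 : |x * P| ≤ s * (M * s) := by
    rw [abs_mul]; exact mul_le_mul hx hP (abs_nonneg _) hs
  have e6 : |y * Q| ≤ s * (M * s) := by
    rw [abs_mul]; exact mul_le_mul hy hQ (abs_nonneg _) hs
  have e7 : (A * k * η - Γ * x * a) * p ≤ (M ^ 3 + M ^ 2) * s * |p| := by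
    refine (le_abs_self _).trans ?_
    rw [abs_mul]
    refine mul_le_mul_of_nonneg_right ((abs_sub _ _).trans ((add_le_add e1 e2).trans ?_))
      (abs_nonneg _)
    nlinarith
  have e8 : A * a * p ^ 2 ≤ -c * p ^ 2 := mul_le_mul_of_nonneg_right hAa (sq_nonneg p)
  -- Young's inequality: the parabolic term -2cp² absorbs the terms linear in p.
  have e9 : 2 * ((M ^ 3 + M ^ 2) * s * |p|) ≤
      2 * c * p ^ 2 + (M ^ 3 + M ^ 2) ^ 2 / (2 * c) * s ^ 2 := by
    have : 0 ≤ 2 * c * (|p| - (M ^ 3 + M ^ 2) * s / (2 * c)) ^ 2 := by positivity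
    have e : 2 * c * (|p| - (M ^ 3 + M ^ 2) * s / (2 * c)) ^ 2 =
        2 * c * |p| ^ 2 - 2 * ((M ^ 3 + M ^ 2) * s * |p|) +
          (M ^ 3 + M ^ 2) ^ 2 / (2 * c) * s ^ 2 := by field_simp; ring
    rw [e, sq_abs] at this
    linarith
  have f3 := neg_le_of_abs_le e3
  have f4 := neg_le_of_abs_le e4
  have f5 := le_of_abs_le e5
  have f6 := le_of_abs_le e6
  nlinarith

/-- The Cauchy–Schwarz inequality, as nonnegativity of the integral of (Pq - m)². -/
lemma sq_integral_le {q : ℝ → ℝ} (hq : Continuous q) {P : ℝ} (hP : 0 < P) :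
    (∫ u in (0 : ℝ)..P, q u) ^ 2 ≤ P * ∫ u in (0 : ℝ)..P, q u ^ 2 := by
  set m := ∫ u in (0 : ℝ)..P, q u with hm
  have h0 : 0 ≤ ∫ u in (0 : ℝ)..P, (P * q u - m) ^ 2 :=
    intervalIntegral.integral_nonneg hP.le fun u _ => sq_nonneg _
  have e : ∀ u, (P * q u - m) ^ 2 = P ^ 2 * q u ^ 2 - 2 * P * m * q u + m ^ 2 := fun u => by ring
  simp only [e] at h0
  rw [intervalIntegral.integral_add (Continuous.intervalIntegrable (by fun_prop) _ _)
    (Continuous.intervalIntegrable (by fun_prop) _ _),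
    intervalIntegral.integral_sub (Continuous.intervalIntegrable (by fun_prop) _ _)
    (Continuous.intervalIntegrable (by fun_prop) _ _), intervalIntegral.integral_const_mul,
    intervalIntegral.integral_const_mul, intervalIntegral.integral_const, ← hm] at h0
  simp only [sub_zero, smul_eq_mul] at h0
  nlinarith

namespace NormalFlow

variable {α : ℝ} {ρ κ g : ℝ → ℝ → ℝ} {φ : ℝ → ℝ}

/-- The flux of `κ ^ α`. -/
def flux (α : ℝ) (κ g : ℝ → ℝ → ℝ) (t u : ℝ) : ℝ := du (fun t u => κ t u ^ α) t u / g t u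

lemma smooth_flux (N : NormalFlow α ρ κ g φ) : SmoothFlow (flux α κ g) :=
  ContDiffOn.div (N.smooth_rpow α).du N.smooth_speed (fun p hp => (N.speed_pos p.1 hp.1 p.2).ne')

lemma periodic_flux (N : NormalFlow α ρ κ g φ) {t : ℝ} (ht : 0 ≤ t) :
    Function.Periodic (flux α κ g t) (2 * Real.pi) := fun u => by
  simp only [flux, periodic_du (f := fun t u => κ t u ^ α) (N.periodic_rpow α ht) u,
    N.periodic_speed t ht u]

lemma flux_eq (N : NormalFlow α ρ κ g φ) {t : ℝ} (ht : 0 ≤ t) (u : ℝ) :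
    flux α κ g t u = α * κ t u ^ (α - 1) * (g t u)⁻¹ * du κ t u := by
  have := ((N.smooth_curv.hasDerivAt_du ht u).rpow_const (p := α)
    (Or.inl (N.curv_pos t ht u).ne')).deriv
  rw [flux, du, this]
  ring

/-- Bounds of a solution on a compact time interval. -/
structure BoundedBy (α : ℝ) (κ g : ℝ → ℝ → ℝ) (φ : ℝ → ℝ) (T b B : ℝ) : Prop where
  pos : 0 < b
  curv : ∀ t ∈ Set.Icc 0 T, ∀ u, κ t u ∈ Set.Icc b B
  speed : ∀ t ∈ Set.Icc 0 T, ∀ u, g t u ∈ Set.Icc b B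
  du_curv : ∀ t ∈ Set.Icc 0 T, ∀ u, |du κ t u| ≤ B
  du_speed : ∀ t ∈ Set.Icc 0 T, ∀ u, |du g t u| ≤ B
  du_flux : ∀ t ∈ Set.Icc 0 T, ∀ u, |du (flux α κ g) t u| ≤ B
  average : ∀ t ∈ Set.Icc 0 T, |φ t| ≤ B

lemma BoundedBy.mono {T b B b' B' : ℝ} (h : BoundedBy α κ g φ T b B) (hb : 0 < b')
    (hbb : b' ≤ b) (hBB : B ≤ B') : BoundedBy α κ g φ T b' B' where
  pos := hb
  curv t ht u := Set.Icc_subset_Icc hbb hBB (h.curv t ht u)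
  speed t ht u := Set.Icc_subset_Icc hbb hBB (h.speed t ht u)
  du_curv t ht u := (h.du_curv t ht u).trans hBB
  du_speed t ht u := (h.du_speed t ht u).trans hBB
  du_flux t ht u := (h.du_flux t ht u).trans hBB
  average t ht := (h.average t ht).trans hBB

lemma exists_boundedBy (N : NormalFlow α ρ κ g φ) (T : ℝ) :
    ∃ b B, BoundedBy α κ g φ T b B := by
  -- A lower bound for a positive function is an upper bound for its inverse, which is again smooth
  -- and periodic.
  have hinv : ∀ {f : ℝ → ℝ → ℝ}, SmoothFlow f → (∀ t, 0 ≤ t → ∀ u, 0 < f t u) →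
      (∀ t, 0 ≤ t → Function.Periodic (f t) (2 * Real.pi)) →
      ∃ b, 0 < b ∧ ∀ t ∈ Set.Icc 0 T, ∀ u, b ≤ f t u := by
    intro f sf pf perf
    have si : SmoothFlow (fun t u => (f t u)⁻¹) :=
      ContDiffOn.inv sf (fun p hp => (pf p.1 hp.1 p.2).ne')
    obtain ⟨K, hK, hb⟩ := si.exists_bound two_pi_pos
      (fun t ht u => by simp only [perf t ht u]) T
    refine ⟨K⁻¹, inv_pos.2 hK, fun t ht u => ?_⟩
    rw [inv_le_comm₀ hK (pf t ht.1 u)]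
    exact (le_abs_self _).trans (hb t ht u)
  obtain ⟨b₁, hb₁, hκ⟩ := hinv N.smooth_curv N.curv_pos N.periodic_curv
  obtain ⟨b₂, hb₂, hg⟩ := hinv N.smooth_speed N.speed_pos N.periodic_speed
  obtain ⟨B₁, -, h₁⟩ := N.smooth_curv.exists_bound two_pi_pos N.periodic_curv T
  obtain ⟨B₂, -, h₂⟩ := N.smooth_speed.exists_bound two_pi_pos N.periodic_speed T
  obtain ⟨B₃, -, h₃⟩ := N.smooth_curv.du.exists_bound two_pi_pos
    (fun t ht => periodic_du (N.periodic_curv t ht)) T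
  obtain ⟨B₄, -, h₄⟩ := N.smooth_speed.du.exists_bound two_pi_pos
    (fun t ht => periodic_du (N.periodic_speed t ht)) T
  obtain ⟨B₅, -, h₅⟩ := N.smooth_flux.du.exists_bound two_pi_pos
    (fun t ht => periodic_du (N.periodic_flux ht)) T
  obtain ⟨B₆, -, h₆⟩ := (N.smooth_rpow α).exists_bound two_pi_pos
    (fun t ht => N.periodic_rpow α ht) T
  have hmax : ∀ i ∈ [B₁, B₂, B₃, B₄, B₅, B₆],
      i ≤ max B₁ (max B₂ (max B₃ (max B₄ (max B₅ B₆)))) := by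
    simp
  refine ⟨min b₁ b₂, max B₁ (max B₂ (max B₃ (max B₄ (max B₅ B₆)))), lt_min hb₁ hb₂,
    fun t ht u => ⟨(min_le_left _ _).trans (hκ t ht u), ?_⟩,
    fun t ht u => ⟨(min_le_right _ _).trans (hg t ht u), ?_⟩,
    fun t ht u => (h₃ t ht u).trans (hmax _ (by simp)),
    fun t ht u => (h₄ t ht u).trans (hmax _ (by simp)),
    fun t ht u => (h₅ t ht u).trans (hmax _ (by simp)), fun t ht => ?_⟩
  · exact (le_abs_self _).trans ((h₁ t ht u).trans (hmax _ (by simp)))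
  · exact (le_abs_self _).trans ((h₂ t ht u).trans (hmax _ (by simp)))
  · obtain ⟨z, hz⟩ := N.exists_rpow_eq_average ht.1
    rw [← hz]
    exact (h₆ t ht z).trans (hmax _ (by simp))

end NormalFlow

lemma sq_add_abs_le (a b c : ℝ) :
    (|a| + |b| + |c|) ^ 2 ≤ 3 * (a ^ 2 + b ^ 2 + c ^ 2) := by
  rw [← sq_abs a, ← sq_abs b, ← sq_abs c]
  nlinarith [sq_nonneg (|a| - |b|), sq_nonneg (|a| - |c|), sq_nonneg (|b| - |c|)]

/-! ### Uniqueness: the energy estimate for two solutions -/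

namespace NormalFlow

variable {α : ℝ} {ρ₁ ρ₂ κ₁ κ₂ g₁ g₂ : ℝ → ℝ → ℝ} {φ₁ φ₂ : ℝ → ℝ}

/-- The averages of two solutions differ at most by the mean difference of the solutions. -/
lemma exists_average_sub_le (N₁ : NormalFlow α ρ₁ κ₁ g₁ φ₁) (N₂ : NormalFlow α ρ₂ κ₂ g₂ φ₂)
    (hρ : ((ρ₁ = fun _ _ => 1) ∧ (ρ₂ = fun _ _ => 1)) ∨ (ρ₁ = κ₁ ∧ ρ₂ = κ₂)) {T b B : ℝ}
    (b₁ : BoundedBy α κ₁ g₁ φ₁ T b B) (b₂ : BoundedBy α κ₂ g₂ φ₂ T b B) :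
    ∃ H, 0 ≤ H ∧ ∀ t ∈ Set.Icc 0 T, |φ₁ t - φ₂ t| ≤ H * ∫ u in (0 : ℝ)..(2 * Real.pi),
      (|κ₁ t u - κ₂ t u| + |g₁ t u - g₂ t u|) := by
  set q : ℝ → ℝ → ℝ := fun t u => |κ₁ t u - κ₂ t u| + |g₁ t u - g₂ t u| with hq
  have hq0 : ∀ t u, 0 ≤ q t u := fun t u => by positivity
  have hb := b₁.pos
  have habs : ∀ {x : ℝ}, x ∈ Set.Icc b B → |x| ≤ B := fun hx => by
    rw [abs_of_pos (hb.trans_le hx.1)]; exact hx.2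
  have qκ : ∀ t ∈ Set.Icc 0 T, ∀ u, |κ₁ t u - κ₂ t u| ≤ q t u := fun t _ u =>
    le_add_of_nonneg_right (abs_nonneg _)
  have qg : ∀ t ∈ Set.Icc 0 T, ∀ u, |g₁ t u - g₂ t u| ≤ q t u := fun t _ u =>
    le_add_of_nonneg_left (abs_nonneg _)
  have lκ : LipPair T q κ₁ κ₂ := LipPair.of_abs_sub_le hq0
    (fun t ht u => habs (b₁.curv t ht u)) (fun t ht u => habs (b₂.curv t ht u)) qκ
  have lg : LipPair T q g₁ g₂ := LipPair.of_abs_sub_le hq0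
    (fun t ht u => habs (b₁.speed t ht u)) (fun t ht u => habs (b₂.speed t ht u)) qg
  have lw : LipPair T q (fun t u => κ₁ t u ^ α) (fun t u => κ₂ t u ^ α) :=
    LipPair.rpow α hb b₁.curv b₂.curv qκ
  have lφ : LipPair T q (fun t _ => φ₂ t) (fun t _ => φ₂ t) :=
    LipPair.of_abs_sub_le hq0 (fun t ht _ => b₂.average t ht) (fun t ht _ => b₂.average t ht)
      (fun t _ u => by simpa using hq0 t u)
  have lρ : LipPair T q ρ₁ ρ₂ := by
    rcases hρ with ⟨h1, h2⟩ | ⟨h1, h2⟩ <;> rw [h1, h2]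
    · exact LipPair.const hq0 1
    · exact lκ
  have ρlow : ∀ t ∈ Set.Icc 0 T, ∀ u, min 1 b ≤ ρ₁ t u := fun t ht u => by
    rcases hρ with ⟨h1, -⟩ | ⟨h1, -⟩ <;> rw [h1]
    · exact min_le_left _ _
    · exact (min_le_right _ _).trans (b₁.curv t ht u).1
  obtain ⟨M, hM⟩ := (lρ.mul (lφ.sub lw)).mul lg
  have hmb : 0 < min 1 b := lt_min one_pos hb
  have hden : 0 < min 1 b * b * (2 * Real.pi) := by have := two_pi_pos; positivity
  refine ⟨|M| / (min 1 b * b * (2 * Real.pi)), by positivity, fun t ht => ?_⟩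
  have ht0 : 0 ≤ t := ht.1
  have cκ₁ := N₁.continuous_curv ht0
  have cκ₂ := N₂.continuous_curv ht0
  have cg₁ := N₁.continuous_speed ht0
  have cg₂ := N₂.continuous_speed ht0
  have cw₁ := N₁.continuous_rpow α ht0
  have cw₂ := N₂.continuous_rpow α ht0
  have cρ₁ := N₁.continuous_weight ht0
  have cρ₂ := N₂.continuous_weight ht0
  have cq : Continuous (q t) := by fun_prop
  -- With φ₂ in place of φ₁ the weighted mean for the first solution becomes φ₂ - φ₁ times a
  -- positive weight. The corresponding mean for the second solution is zero, and the two integrands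
  -- differ by O(|κ₁-κ₂| + |g₁-g₂|).
  have i1 : ∫ u in (0 : ℝ)..(2 * Real.pi), ρ₁ t u * (φ₂ t - κ₁ t u ^ α) * g₁ t u =
      (φ₂ t - φ₁ t) * ∫ u in (0 : ℝ)..(2 * Real.pi), ρ₁ t u * g₁ t u := by
    have e : ∀ u, ρ₁ t u * (φ₂ t - κ₁ t u ^ α) * g₁ t u =
        (φ₂ t - φ₁ t) * (ρ₁ t u * g₁ t u) + ρ₁ t u * (φ₁ t - κ₁ t u ^ α) * g₁ t u :=
      fun u => by ring
    simp only [e]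
    rw [intervalIntegral.integral_add (Continuous.intervalIntegrable (by fun_prop) _ _)
      (Continuous.intervalIntegrable (by fun_prop) _ _), intervalIntegral.integral_const_mul,
      N₁.integral_weight_velocity ht0, add_zero]
  have i2 := N₂.integral_weight_velocity ht0
  have low : min 1 b * b * (2 * Real.pi) ≤ ∫ u in (0 : ℝ)..(2 * Real.pi), ρ₁ t u * g₁ t u := by
    have : ∫ _ in (0 : ℝ)..(2 * Real.pi), min 1 b * b = min 1 b * b * (2 * Real.pi) := by
      rw [intervalIntegral.integral_const, sub_zero, smul_eq_mul, mul_comm]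
    rw [← this]
    exact intervalIntegral.integral_mono_on two_pi_pos.le intervalIntegrable_const
      (Continuous.intervalIntegrable (by fun_prop) _ _) fun u _ =>
      mul_le_mul (ρlow t ht u) (b₁.speed t ht u).1 hb.le (hmb.le.trans (ρlow t ht u))
  have up : |(φ₂ t - φ₁ t) * ∫ u in (0 : ℝ)..(2 * Real.pi), ρ₁ t u * g₁ t u| ≤
      |M| * ∫ u in (0 : ℝ)..(2 * Real.pi), q t u := by
    have i3 : (φ₂ t - φ₁ t) * ∫ u in (0 : ℝ)..(2 * Real.pi), ρ₁ t u * g₁ t u =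
        (∫ u in (0 : ℝ)..(2 * Real.pi), ρ₁ t u * (φ₂ t - κ₁ t u ^ α) * g₁ t u) -
        ∫ u in (0 : ℝ)..(2 * Real.pi), ρ₂ t u * (φ₂ t - κ₂ t u ^ α) * g₂ t u := by
      rw [i1, i2, sub_zero]
    rw [i3, ← intervalIntegral.integral_sub (Continuous.intervalIntegrable (by fun_prop) _ _)
      (Continuous.intervalIntegrable (by fun_prop) _ _), ← intervalIntegral.integral_const_mul]
    refine (intervalIntegral.abs_integral_le_integral_abs two_pi_pos.le).trans ?_
    refine intervalIntegral.integral_mono_on two_pi_pos.le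
      (Continuous.intervalIntegrable (by fun_prop) _ _)
      (Continuous.intervalIntegrable (by fun_prop) _ _) fun u _ => ?_
    exact (hM t ht u).2.2.trans (mul_le_mul_of_nonneg_right (le_abs_self _) (hq0 t u))
  rw [div_mul_eq_mul_div, le_div_iff₀ hden]
  refine le_trans ?_ up
  rw [abs_mul, abs_sub_comm (φ₁ t)]
  exact mul_le_mul_of_nonneg_left (low.trans (le_abs_self _)) (abs_nonneg _)

/-- The evolution of the curvature in terms of the flux. -/
lemma curv_evolution_flux {ρ κ g : ℝ → ℝ → ℝ} {φ : ℝ → ℝ} (N : NormalFlow α ρ κ g φ) {t : ℝ}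
    (ht : 0 < t) (u : ℝ) :
    HasDerivAt (fun τ => κ τ u) (-((g t u)⁻¹ * du (flux α κ g) t u) +
      (κ t u * κ t u - 1) * (φ t - κ t u ^ α)) t := by
  refine (N.curv_evolution t ht u).congr_deriv ?_
  have : du (flux α κ g) t u = deriv (fun v => deriv (fun z => κ t z ^ α) v / g t v) u := rfl
  rw [this]
  ring

/-- The density of the energy dissipation of the difference of two solutions. -/
def differenceDensity (α : ℝ) (κ₁ κ₂ g₁ g₂ : ℝ → ℝ → ℝ) (φ₁ φ₂ : ℝ → ℝ) (t u : ℝ) : ℝ :=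
  (2 * (((g₁ t u)⁻¹ * (du κ₁ t u - du κ₂ t u) -
          du g₁ t u * ((g₁ t u)⁻¹ * (g₁ t u)⁻¹) * (κ₁ t u - κ₂ t u)) *
        (α * κ₁ t u ^ (α - 1) * (g₁ t u)⁻¹ * (du κ₁ t u - du κ₂ t u) + du κ₂ t u *
          (α * κ₁ t u ^ (α - 1) * (g₁ t u)⁻¹ - α * κ₂ t u ^ (α - 1) * (g₂ t u)⁻¹))) -
      2 * (κ₁ t u - κ₂ t u) * (du (flux α κ₂ g₂) t u * ((g₁ t u)⁻¹ - (g₂ t u)⁻¹)) +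
      2 * (κ₁ t u - κ₂ t u) * ((κ₁ t u * κ₁ t u - 1) * (φ₁ t - κ₁ t u ^ α) -
        (κ₂ t u * κ₂ t u - 1) * (φ₂ t - κ₂ t u ^ α)) +
      2 * (g₁ t u - g₂ t u) * (κ₂ t u * (φ₂ t - κ₂ t u ^ α) * g₂ t u -
        κ₁ t u * (φ₁ t - κ₁ t u ^ α) * g₁ t u))

/-- The integrated evolution of the difference of two solutions. -/
lemma integral_difference_evolution (N₁ : NormalFlow α ρ₁ κ₁ g₁ φ₁)
    (N₂ : NormalFlow α ρ₂ κ₂ g₂ φ₂) {t : ℝ} (ht : 0 < t) :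
    ∫ u in (0 : ℝ)..(2 * Real.pi),
        dt (fun t u => (κ₁ t u - κ₂ t u) ^ 2 + (g₁ t u - g₂ t u) ^ 2) t u =
      ∫ u in (0 : ℝ)..(2 * Real.pi), differenceDensity α κ₁ κ₂ g₁ g₂ φ₁ φ₂ t u := by
  have ht0 := ht.le
  have hg₁ : ∀ u, g₁ t u ≠ 0 := fun u => (N₁.speed_pos t ht0 u).ne'
  have hg₂ : ∀ u, g₂ t u ≠ 0 := fun u => (N₂.speed_pos t ht0 u).ne'
  have cκ₁ := N₁.continuous_curv ht0
  have cκ₂ := N₂.continuous_curv ht0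
  have cg₁ := N₁.continuous_speed ht0
  have cg₂ := N₂.continuous_speed ht0
  have cw₁ := N₁.continuous_rpow α ht0
  have cw₂ := N₂.continuous_rpow α ht0
  have ci₁ : Continuous fun u => (g₁ t u)⁻¹ := cg₁.inv₀ hg₁
  have ci₂ : Continuous fun u => (g₂ t u)⁻¹ := cg₂.inv₀ hg₂
  have cκ₁' : Continuous (du κ₁ t) := N₁.smooth_curv.du.continuous_slice ht0
  have cκ₂' : Continuous (du κ₂ t) := N₂.smooth_curv.du.continuous_slice ht0
  have cg₁' : Continuous (du g₁ t) := N₁.smooth_speed.du.continuous_slice ht0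
  have cJ₁ : Continuous (flux α κ₁ g₁ t) := N₁.smooth_flux.continuous_slice ht0
  have cJ₂ : Continuous (flux α κ₂ g₂ t) := N₂.smooth_flux.continuous_slice ht0
  have cJ₁' : Continuous (du (flux α κ₁ g₁) t) := N₁.smooth_flux.du.continuous_slice ht0
  have cJ₂' : Continuous (du (flux α κ₂ g₂) t) := N₂.smooth_flux.du.continuous_slice ht0
  -- R collects the terms without derivatives of the differences. Replacing 1/g₂ by 1/g₁ before the
  -- second flux leaves its first term.
  set R : ℝ → ℝ := fun u =>
    -(2 * (κ₁ t u - κ₂ t u) * (du (flux α κ₂ g₂) t u * ((g₁ t u)⁻¹ - (g₂ t u)⁻¹))) +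
        2 * (κ₁ t u - κ₂ t u) * ((κ₁ t u * κ₁ t u - 1) * (φ₁ t - κ₁ t u ^ α) -
          (κ₂ t u * κ₂ t u - 1) * (φ₂ t - κ₂ t u ^ α)) +
        2 * (g₁ t u - g₂ t u) * (κ₂ t u * (φ₂ t - κ₂ t u ^ α) * g₂ t u -
          κ₁ t u * (φ₁ t - κ₁ t u ^ α) * g₁ t u) with hR
  have cR : Continuous R := by fun_prop
  have hdt : ∀ u, dt (fun t u => (κ₁ t u - κ₂ t u) ^ 2 + (g₁ t u - g₂ t u) ^ 2) t u =
      -2 * ((κ₁ t u - κ₂ t u) * (g₁ t u)⁻¹ *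
        (du (flux α κ₁ g₁) t u - du (flux α κ₂ g₂) t u)) + R u := fun u => by
    have e : HasDerivAt (fun τ => (κ₁ τ u - κ₂ τ u) ^ 2 + (g₁ τ u - g₂ τ u) ^ 2) _ t :=
      (((N₁.curv_evolution_flux ht u).sub (N₂.curv_evolution_flux ht u)).pow 2).add
        (((N₁.speed_evolution t ht u).sub (N₂.speed_evolution t ht u)).pow 2)
    rw [dt, e.deriv, hR]
    simp only [Pi.sub_apply]
    norm_num
    ring
  have dp : ∀ u, HasDerivAt (fun u => (κ₁ t u - κ₂ t u) * (g₁ t u)⁻¹)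
      ((g₁ t u)⁻¹ * (du κ₁ t u - du κ₂ t u) -
        du g₁ t u * ((g₁ t u)⁻¹ * (g₁ t u)⁻¹) * (κ₁ t u - κ₂ t u)) u := fun u => by
    refine ((((N₁.smooth_curv.hasDerivAt_du ht0 u).sub (N₂.smooth_curv.hasDerivAt_du ht0 u)).mul
      ((N₁.smooth_speed.hasDerivAt_du ht0 u).inv (hg₁ u)))).congr_deriv ?_
    have := hg₁ u
    simp only [Pi.sub_apply, Pi.inv_apply]
    field_simp
    ring
  have dq : ∀ u, HasDerivAt (fun u => flux α κ₁ g₁ t u - flux α κ₂ g₂ t u)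
      (du (flux α κ₁ g₁) t u - du (flux α κ₂ g₂) t u) u := fun u =>
    (N₁.smooth_flux.hasDerivAt_du ht0 u).sub (N₂.smooth_flux.hasDerivAt_du ht0 u)
  have hibp := integral_mul_deriv_of_periodic dp dq (by fun_prop) (by fun_prop)
    (c := 2 * Real.pi)
    (fun u => by simp only [N₁.periodic_curv t ht0 u, N₂.periodic_curv t ht0 u,
      N₁.periodic_speed t ht0 u])
    (fun u => by simp only [N₁.periodic_flux ht0 u, N₂.periodic_flux ht0 u])
  rw [intervalIntegral.integral_congr (fun u _ => hdt u),
    intervalIntegral.integral_add (Continuous.intervalIntegrable (by fun_prop) _ _)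
    (cR.intervalIntegrable _ _), intervalIntegral.integral_const_mul, hibp, neg_mul_neg,
    ← intervalIntegral.integral_const_mul, ← intervalIntegral.integral_add
    (Continuous.intervalIntegrable (by fun_prop) _ _) (cR.intervalIntegrable _ _)]
  refine intervalIntegral.integral_congr fun u _ => ?_
  simp only [hR, N₁.flux_eq ht0, N₂.flux_eq ht0, differenceDensity]
  ring

lemma continuous_differenceDensity (N₁ : NormalFlow α ρ₁ κ₁ g₁ φ₁)
    (N₂ : NormalFlow α ρ₂ κ₂ g₂ φ₂) {t : ℝ} (ht0 : 0 ≤ t) :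
    Continuous (differenceDensity α κ₁ κ₂ g₁ g₂ φ₁ φ₂ t) := by
  have cκ₁ := N₁.continuous_curv ht0
  have cκ₂ := N₂.continuous_curv ht0
  have cg₁ := N₁.continuous_speed ht0
  have cg₂ := N₂.continuous_speed ht0
  have cw₁ := N₁.continuous_rpow α ht0
  have cw₂ := N₂.continuous_rpow α ht0
  have cw₁' := N₁.continuous_rpow (α - 1) ht0
  have cw₂' := N₂.continuous_rpow (α - 1) ht0
  have ci₁ : Continuous fun u => (g₁ t u)⁻¹ := cg₁.inv₀ fun u => (N₁.speed_pos t ht0 u).ne'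
  have ci₂ : Continuous fun u => (g₂ t u)⁻¹ := cg₂.inv₀ fun u => (N₂.speed_pos t ht0 u).ne'
  have cκ₁' : Continuous (du κ₁ t) := N₁.smooth_curv.du.continuous_slice ht0
  have cκ₂' : Continuous (du κ₂ t) := N₂.smooth_curv.du.continuous_slice ht0
  have cg₁' : Continuous (du g₁ t) := N₁.smooth_speed.du.continuous_slice ht0
  have cJ₂' : Continuous (du (flux α κ₂ g₂) t) := N₂.smooth_flux.du.continuous_slice ht0
  unfold differenceDensity
  fun_prop

/-- The density is controlled by the difference of the solutions. -/
lemma exists_differenceDensity_le (hα : α < 0) (N₁ : NormalFlow α ρ₁ κ₁ g₁ φ₁)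
    {T b B : ℝ} (hB : 0 < B)
    (b₁ : BoundedBy α κ₁ g₁ φ₁ T b B) (b₂ : BoundedBy α κ₂ g₂ φ₂ T b B) :
    ∃ K, 0 ≤ K ∧ ∀ t ∈ Set.Icc 0 T, ∀ u, differenceDensity α κ₁ κ₂ g₁ g₂ φ₁ φ₂ t u ≤
      3 * K * ((κ₁ t u - κ₂ t u) ^ 2 + (g₁ t u - g₂ t u) ^ 2 + (φ₁ t - φ₂ t) ^ 2) := by
  have hb := b₁.pos
  set s : ℝ → ℝ → ℝ := fun t u => |κ₁ t u - κ₂ t u| + |g₁ t u - g₂ t u| + |φ₁ t - φ₂ t| with hs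
  have hs0 : ∀ t u, 0 ≤ s t u := fun t u => by positivity
  have habs : ∀ {x : ℝ}, x ∈ Set.Icc b B → |x| ≤ B := fun hx => by
    rw [abs_of_pos (hb.trans_le hx.1)]; exact hx.2
  have sκ : ∀ t ∈ Set.Icc 0 T, ∀ u, |κ₁ t u - κ₂ t u| ≤ s t u := fun t _ u => by
    simp only [hs]; linarith [abs_nonneg (g₁ t u - g₂ t u), abs_nonneg (φ₁ t - φ₂ t)]
  have sg : ∀ t ∈ Set.Icc 0 T, ∀ u, |g₁ t u - g₂ t u| ≤ s t u := fun t _ u => by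
    simp only [hs]; linarith [abs_nonneg (κ₁ t u - κ₂ t u), abs_nonneg (φ₁ t - φ₂ t)]
  have lκ : LipPair T s κ₁ κ₂ := LipPair.of_abs_sub_le hs0
    (fun t ht u => habs (b₁.curv t ht u)) (fun t ht u => habs (b₂.curv t ht u)) sκ
  have lg : LipPair T s g₁ g₂ := LipPair.of_abs_sub_le hs0
    (fun t ht u => habs (b₁.speed t ht u)) (fun t ht u => habs (b₂.speed t ht u)) sg
  have lφ : LipPair T s (fun t _ => φ₁ t) (fun t _ => φ₂ t) :=
    LipPair.of_abs_sub_le hs0 (fun t ht _ => b₁.average t ht) (fun t ht _ => b₂.average t ht)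
      (fun t _ u => by
        simp only [hs]; linarith [abs_nonneg (κ₁ t u - κ₂ t u), abs_nonneg (g₁ t u - g₂ t u)])
  have lw : LipPair T s (fun t u => κ₁ t u ^ α) (fun t u => κ₂ t u ^ α) :=
    LipPair.rpow α hb b₁.curv b₂.curv sκ
  have lw' : LipPair T s (fun t u => κ₁ t u ^ (α - 1)) (fun t u => κ₂ t u ^ (α - 1)) :=
    LipPair.rpow (α - 1) hb b₁.curv b₂.curv sκ
  have li : LipPair T s (fun t u => (g₁ t u)⁻¹) (fun t u => (g₂ t u)⁻¹) := by
    simpa only [Real.rpow_neg_one] using LipPair.rpow (-1) hb b₁.speed b₂.speed sg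
  have lF := lφ.sub lw
  have la := ((LipPair.const hs0 α).mul lw').mul li
  have lP := ((lκ.mul lκ).sub (LipPair.const hs0 1)).mul lF
  have lQ := (lκ.mul lF).mul lg
  obtain ⟨M₁, h₁⟩ := li
  obtain ⟨M₂, h₂⟩ := la
  obtain ⟨M₃, h₃⟩ := lP
  obtain ⟨M₄, h₄⟩ := lQ
  set M := |M₁| + |M₂| + |M₃| + |M₄| + B + B * (|M₁| * |M₁|) with hM
  have hM0 : 0 ≤ M := by positivity
  have n₁ := abs_nonneg M₁
  have n₂ := abs_nonneg M₂
  have n₃ := abs_nonneg M₃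
  have n₄ := abs_nonneg M₄
  have n₅ : 0 ≤ B * (|M₁| * |M₁|) := by positivity
  have m₁ : M₁ ≤ M := by linarith [le_abs_self M₁]
  have m₂ : M₂ ≤ M := by linarith [le_abs_self M₂]
  have m₃ : M₃ ≤ M := by linarith [le_abs_self M₃]
  have m₄ : M₄ ≤ M := by linarith [le_abs_self M₄]
  have m₅ : B ≤ M := by linarith
  -- The ellipticity constant: κ₁ and g₁ are at most B and enter with negative exponents.
  set c := -α * B ^ (α - 1) * (B⁻¹ * B⁻¹) with hc
  have hc0 : 0 < c := by
    have : 0 < -α := by linarith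
    positivity
  set K := (M ^ 3 + M ^ 2) ^ 2 / (2 * c) + 2 * M ^ 3 + 2 * M ^ 2 + 4 * M with hK
  have hK0 : 0 ≤ K := by positivity
  refine ⟨K, hK0, fun t ht u => ?_⟩
  obtain ⟨i1, i2, i3⟩ := h₁ t ht u
  obtain ⟨a1, a2, a3⟩ := h₂ t ht u
  obtain ⟨-, -, p3⟩ := h₃ t ht u
  obtain ⟨-, -, q3⟩ := h₄ t ht u
  have hsm : ∀ {m : ℝ}, m ≤ M → m * s t u ≤ M * s t u := fun hm =>
    mul_le_mul_of_nonneg_right hm (hs0 t u)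
  have ht0 : 0 ≤ t := ht.1
  have hk₁ := N₁.curv_pos t ht0 u
  have hg₁ := N₁.speed_pos t ht0 u
  have hAa : (g₁ t u)⁻¹ * (α * κ₁ t u ^ (α - 1) * (g₁ t u)⁻¹) ≤ -c := by
    have r1 : B ^ (α - 1) ≤ κ₁ t u ^ (α - 1) :=
      Real.rpow_le_rpow_of_nonpos hk₁ (b₁.curv t ht u).2 (by linarith)
    have r2 : B⁻¹ ≤ (g₁ t u)⁻¹ := inv_anti₀ hg₁ (b₁.speed t ht u).2
    have r3 : B⁻¹ * B⁻¹ ≤ (g₁ t u)⁻¹ * (g₁ t u)⁻¹ :=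
      mul_le_mul r2 r2 (by positivity) (by positivity)
    have r4 : B ^ (α - 1) * (B⁻¹ * B⁻¹) ≤ κ₁ t u ^ (α - 1) * ((g₁ t u)⁻¹ * (g₁ t u)⁻¹) :=
      mul_le_mul r1 r3 (by positivity) (by positivity)
    have r5 := mul_le_mul_of_nonneg_left r4 (show 0 ≤ -α by linarith)
    rw [hc]
    linarith
  have hΓ : |du g₁ t u * ((g₁ t u)⁻¹ * (g₁ t u)⁻¹)| ≤ M := by
    rw [abs_mul, abs_mul]
    have j1 : |(g₁ t u)⁻¹| ≤ |M₁| := i1.trans (le_abs_self _)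
    have j2 : |du g₁ t u| * (|(g₁ t u)⁻¹| * |(g₁ t u)⁻¹|) ≤ B * (|M₁| * |M₁|) :=
      mul_le_mul (b₁.du_speed t ht u) (mul_le_mul j1 j1 (abs_nonneg _) n₁)
        (by positivity) hB.le
    linarith
  have q4 : |κ₂ t u * (φ₂ t - κ₂ t u ^ α) * g₂ t u - κ₁ t u * (φ₁ t - κ₁ t u ^ α) * g₁ t u| ≤
      M₄ * s t u := by
    rw [abs_sub_comm]; exact q3
  have hsq : s t u ^ 2 ≤
      3 * ((κ₁ t u - κ₂ t u) ^ 2 + (g₁ t u - g₂ t u) ^ 2 + (φ₁ t - φ₂ t) ^ 2) :=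
    sq_add_abs_le _ _ _
  have main : differenceDensity α κ₁ κ₂ g₁ g₂ φ₁ φ₂ t u ≤ K * s t u ^ 2 := by
    unfold differenceDensity
    exact energy_density_le (p := du κ₁ t u - du κ₂ t u) hM0 hc0 (hs0 t u)
      (sκ t ht u) (sg t ht u) hAa (i1.trans m₁) (a1.trans m₂) hΓ
      ((b₂.du_curv t ht u).trans m₅) ((b₂.du_flux t ht u).trans m₅) (a3.trans (hsm m₂))
      (i3.trans (hsm m₁)) (p3.trans (hsm m₃)) (q4.trans (hsm m₄))
  clear_value K s
  refine main.trans ((mul_le_mul_of_nonneg_left hsq hK0).trans_eq ?_)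
  ring

/-- Solutions with the same initial curvature and speed agree. -/
theorem curv_eq_of_initial (hα : α < 0) (N₁ : NormalFlow α ρ₁ κ₁ g₁ φ₁)
    (N₂ : NormalFlow α ρ₂ κ₂ g₂ φ₂)
    (hρ : ((ρ₁ = fun _ _ => 1) ∧ (ρ₂ = fun _ _ => 1)) ∨ (ρ₁ = κ₁ ∧ ρ₂ = κ₂))
    (hκ : κ₁ 0 = κ₂ 0) (hg : g₁ 0 = g₂ 0) {T : ℝ} (hT : 0 ≤ T) : κ₁ T = κ₂ T := by
  obtain ⟨b', B', hb'⟩ := N₁.exists_boundedBy T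
  obtain ⟨b'', B'', hb''⟩ := N₂.exists_boundedBy T
  set b := min b' b''
  set B := max B' B''
  have hb : 0 < b := lt_min hb'.pos hb''.pos
  have b₁ : BoundedBy α κ₁ g₁ φ₁ T b B := hb'.mono hb (min_le_left _ _) (le_max_left _ _)
  have b₂ : BoundedBy α κ₂ g₂ φ₂ T b B := hb''.mono hb (min_le_right _ _) (le_max_right _ _)
  have hB : 0 < B := by
    have := b₁.curv 0 (Set.left_mem_Icc.2 hT) 0
    exact hb.trans_le (this.1.trans this.2)
  obtain ⟨H, hH0, hH⟩ := exists_average_sub_le N₁ N₂ hρ b₁ b₂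
  obtain ⟨K, hK0, hdens⟩ := exists_differenceDensity_le hα N₁ hB b₁ b₂
  set e : ℝ → ℝ → ℝ := fun t u => (κ₁ t u - κ₂ t u) ^ 2 + (g₁ t u - g₂ t u) ^ 2 with he
  have se : SmoothFlow e :=
    ((ContDiffOn.sub N₁.smooth_curv N₂.smooth_curv).pow 2).add
      ((ContDiffOn.sub N₁.smooth_speed N₂.smooth_speed).pow 2)
  set G : ℝ → ℝ := fun t => ∫ u in (0 : ℝ)..(2 * Real.pi), e t u with hG
  have hG0 : ∀ t ∈ Set.Icc 0 T, G t = 0 := by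
    refine eq_zero_of_deriv_le_mul
      (C := 3 * K * (1 + 2 * Real.pi * (H ^ 2 * (2 * Real.pi) * 2)))
      ((se.continuousOn_integral _ _).mono fun t ht => ht.1) ?_
      (fun t _ => intervalIntegral.integral_nonneg two_pi_pos.le fun u _ => by
        simp only [he]; positivity) (fun t ht => ?_)
    · simp [hG, he, hκ, hg]
    have ht0 : 0 ≤ t := ht.1.le
    have htT : t ∈ Set.Icc 0 T := ⟨ht.1.le, ht.2.le⟩
    refine ⟨_, se.hasDerivAt_integral two_pi_pos.le ht.1, ?_⟩
    have cκ₁ := N₁.continuous_curv ht0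
    have cκ₂ := N₂.continuous_curv ht0
    have cg₁ := N₁.continuous_speed ht0
    have cg₂ := N₂.continuous_speed ht0
    have ce : Continuous (e t) := se.continuous_slice ht0
    set h := |φ₁ t - φ₂ t| with hh
    -- The nonlocal term is controlled by G through Cauchy–Schwarz. No derivative of g₁ - g₂ occurs
    -- in the system, so the estimate closes.
    have hφ : h ^ 2 ≤ H ^ 2 * (2 * Real.pi) * 2 * G t := by
      set q : ℝ → ℝ := fun u => |κ₁ t u - κ₂ t u| + |g₁ t u - g₂ t u| with hq
      have cq : Continuous q := by fun_prop
      have h1 : h ^ 2 ≤ (H * ∫ u in (0 : ℝ)..(2 * Real.pi), q u) ^ 2 :=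
        pow_le_pow_left₀ (abs_nonneg _) (hH t htT) 2
      have h2 := sq_integral_le cq two_pi_pos
      have h3 : ∫ u in (0 : ℝ)..(2 * Real.pi), q u ^ 2 ≤ 2 * G t := by
        rw [hG, ← intervalIntegral.integral_const_mul]
        refine intervalIntegral.integral_mono_on two_pi_pos.le
          ((cq.pow 2).intervalIntegrable _ _) ((ce.const_mul 2).intervalIntegrable _ _)
          fun u _ => ?_
        simp only [hq, he, ← sq_abs (κ₁ t u - κ₂ t u), ← sq_abs (g₁ t u - g₂ t u)]
        nlinarith [sq_nonneg (|κ₁ t u - κ₂ t u| - |g₁ t u - g₂ t u|)]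
      calc h ^ 2 ≤ H ^ 2 * (∫ u in (0 : ℝ)..(2 * Real.pi), q u) ^ 2 := by rwa [← mul_pow]
        _ ≤ H ^ 2 * (2 * Real.pi * (2 * G t)) := by
          refine mul_le_mul_of_nonneg_left (h2.trans ?_) (sq_nonneg H)
          exact mul_le_mul_of_nonneg_left h3 two_pi_pos.le
        _ = _ := by ring
    have hbound : ∫ u in (0 : ℝ)..(2 * Real.pi), dt e t u ≤
        ∫ u in (0 : ℝ)..(2 * Real.pi), 3 * K * (e t u + h ^ 2) := by
      rw [integral_difference_evolution N₁ N₂ ht.1]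
      refine intervalIntegral.integral_mono_on two_pi_pos.le
        ((N₁.continuous_differenceDensity N₂ ht0).intervalIntegrable _ _)
        (((ce.add continuous_const).const_mul _).intervalIntegrable _ _) fun u _ => ?_
      refine (hdens t htT u).trans_eq ?_
      simp only [he, hh, sq_abs]
    refine hbound.trans ?_
    rw [intervalIntegral.integral_const_mul, intervalIntegral.integral_add
      (ce.intervalIntegrable _ _) intervalIntegrable_const, intervalIntegral.integral_const,
      sub_zero, smul_eq_mul, mul_assoc (3 * K)]
    refine mul_le_mul_of_nonneg_left ?_ (by positivity)
    have := mul_le_mul_of_nonneg_left hφ two_pi_pos.le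
    change G t + _ ≤ _ * G t
    linarith
  have hGT := hG0 T ⟨hT, le_rfl⟩
  have ce : Continuous (e T) := se.continuous_slice hT
  have hzero : ∀ u ∈ Set.Icc 0 (2 * Real.pi), e T u = 0 := by
    intro u hu
    by_contra hne
    have hpos : 0 < e T u := lt_of_le_of_ne (by simp only [he]; positivity) (Ne.symm hne)
    have := intervalIntegral.integral_pos two_pi_pos ce.continuousOn
      (fun v _ => by simp only [he]; positivity) ⟨u, hu, hpos⟩
    exact this.ne' hGT
  funext u
  have pe : Function.Periodic (e T) (2 * Real.pi) := fun u => by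
    simp only [he, N₁.periodic_curv T hT u, N₂.periodic_curv T hT u, N₁.periodic_speed T hT u,
      N₂.periodic_speed T hT u]
  obtain ⟨v, hv, huv⟩ := pe.exists_mem_Ico₀ two_pi_pos u
  have h0 : e T u = 0 := huv.trans (hzero v (Set.Ico_subset_Icc_self hv))
  simp only [he] at h0
  have : (κ₁ T u - κ₂ T u) ^ 2 = 0 := by
    nlinarith [sq_nonneg (κ₁ T u - κ₂ T u), sq_nonneg (g₁ T u - g₂ T u)]
  exact sub_eq_zero.1 (pow_eq_zero_iff two_ne_zero |>.1 this)

end NormalFlow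

/-! ### A constant independent of the solution -/

/-- The curvature bound for the flows of a given kind. -/
lemma exists_curvature_bound (k : Kind) {α : ℝ} (hα : α < 0) {X₀ : ℝ → ℍ} {σ : ℝ}
    (hσ : σ = 1 ∨ σ = -1) (hconv : ∀ u, 0 < curvature σ X₀ u) :
    ∃ C : ℝ, 0 < C ∧ ∀ X : ℝ → ℝ → ℍ, IsGlobalFlow k σ α X₀ X → ∀ D : ℝ,
      (∀ t, 0 ≤ t → ∃ u, 1 / curvature σ (X t) u = D) →
      ∀ t, 0 ≤ t → ∀ u, 0 < curvature σ (X t) u ∧ curvature σ (X t) u ≤ C := by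
  have hDpos : ∀ X : ℝ → ℝ → ℍ, IsGlobalFlow k σ α X₀ X → ∀ D : ℝ,
      (∀ t, 0 ≤ t → ∃ u, 1 / curvature σ (X t) u = D) → 0 < D := fun X h D hex => by
    obtain ⟨u, hu⟩ := hex 0 le_rfl
    rw [h.initial] at hu
    rw [← hu]
    exact one_div_pos.2 (hconv u)
  -- The bound of one admissible solution serves all of them, since the curvature is determined by
  -- the initial data. If there is none, any constant will do.
  by_cases hY : ∃ (Y : ℝ → ℝ → ℍ) (D : ℝ), IsGlobalFlow k σ α X₀ Y ∧
      ∀ t, 0 ≤ t → ∃ u, 1 / curvature σ (Y t) u = D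
  · obtain ⟨Y, D, hflow, hex⟩ := hY
    have hD := hDpos Y hflow D hex
    have hpos := hflow.curvature_pos hσ hα hconv hD hex
    have N := hflow.normalFlow hσ hpos
    obtain ⟨A, cA, dA, bA⟩ := hflow.exists_area_functional hσ hpos
    obtain ⟨C, hC, hle⟩ := N.exists_curv_le hα cA dA bA hD
      (fun t ht => by simpa only [one_div] using hex t ht)
    refine ⟨C, hC, fun X h D' hex' t ht u => ?_⟩
    have hpos' := h.curvature_pos hσ hα hconv (hDpos X h D' hex') hex'
    refine ⟨hpos' t ht u, ?_⟩
    have heq := NormalFlow.curv_eq_of_initial hα (h.normalFlow hσ hpos') N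
      (by
        cases k
        · exact Or.inl ⟨rfl, rfl⟩
        · exact Or.inr ⟨rfl, rfl⟩)
      (by rw [h.initial, hflow.initial]) (by rw [h.initial, hflow.initial]) ht
    exact (congrFun heq u).le.trans (hle t ht u)
  · exact ⟨1, one_pos, fun X h D hex => absurd ⟨X, D, h, hex⟩ hY⟩

end HypFlow

end

theorem lemma4p1 (α : ℝ) (hα : α < 0)
    (X₀ : ℝ → UpperHalfPlane) (hX₀ : HypFlow.IsSimpleClosedCurve X₀)
    (σ : ℝ) (hσ : σ = 1 ∨ σ = -1) (hin : HypFlow.IsInner σ X₀)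
    (hconv : ∀ u, 0 < HypFlow.curvature σ X₀ u) :
    ∃ C : ℝ, 0 < C ∧
      ∀ (k : HypFlow.Kind) (X : ℝ → ℝ → UpperHalfPlane),
        HypFlow.IsGlobalFlow k σ α X₀ X →
        ∀ D : ℝ,
          (D = HypFlow.circleRadius X₀ k ∨ D = Real.tanh (HypFlow.circleRadius X₀ k)) →
          (∀ t, 0 ≤ t → ∃ u, 1 / HypFlow.curvature σ (X t) u = D) →
          ∀ t, 0 ≤ t → ∀ u,
            0 < HypFlow.curvature σ (X t) u ∧ HypFlow.curvature σ (X t) u ≤ C ∧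
              C⁻¹ ≤ 1 / HypFlow.curvature σ (X t) u := by
  obtain ⟨C₁, hC₁, h₁⟩ := HypFlow.exists_curvature_bound .areaPreserving hα hσ hconv
  obtain ⟨C₂, hC₂, h₂⟩ := HypFlow.exists_curvature_bound .lengthPreserving hα hσ hconv
  refine ⟨max C₁ C₂, lt_max_of_lt_left hC₁, fun k X h D _ hex t ht u => ?_⟩
  have key : 0 < HypFlow.curvature σ (X t) u ∧ HypFlow.curvature σ (X t) u ≤ max C₁ C₂ := by
    cases k
    · exact ⟨(h₁ X h D hex t ht u).1, (h₁ X h D hex t ht u).2.trans (le_max_left _ _)⟩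
    · exact ⟨(h₂ X h D hex t ht u).1, (h₂ X h D hex t ht u).2.trans (le_max_right _ _)⟩
  refine ⟨key.1, key.2, ?_⟩
  rw [one_div]
  exact inv_anti₀ key.1 key.2
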